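/- Let $G=U(n)$, with $M(n)$ the complex $n\times n$ matrices and $\mathcal G=u(n)$ the skew-Hermitian matrices, or $G=SO(n)$, with $M(n)$ the real $n\times n$ matrices and $\mathcal G=so(n)$ the skew-symmetric matrices. Let $\|\cdot\|$ be a unitarily invariant norm on $M(n)$, i.e. a norm with $\|uxv\|=\|x\|$ for all $x\in M(n)$ and $u,v\in G$. The length $\ell(\gamma)\in[0,\infty]$ of a continuous curve $\gamma:[a,b]\to G$ is the supremum of $\sum_i\|\gamma(t_{i+1})-\gamma(t_i)\|$ over the partitions of $[a,b]$ (so $\ell(\gamma)=\int_a^b\|\gamma'(t)\|\,dt$ if $\gamma$ is absolutely continuous), and the intrinsic metric $\rho(u,v)$ on $G$ is the infimum of the lengths of the continuous curves in $G$ from $u$ to $v$. A geodesic is a continuous curve $\gamma:I\to G$ on an interval $I\subseteq\mathbb R$ such that - every $t\in I$ has a neighbourhood $J$ in $I$ with $\ell(\gamma|_{[r,s]})=\rho(\gamma(r),\gamma(s))$ for all $r\le s$ in $J$, and - $\gamma$ is either constant on $I$ or not constant on any nondegenerate subinterval of $I$. Then: (a) For all $u\in G$ and $x\in\mathcal G$,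 the curve $t\mapsto ue^{tx}$, $t\in\mathbb R$, is a geodesic. (b) Suppose that $\|\cdot\|$ is strictly convex, i.e. its unit sphere $\{x:\|x\|=1\}$ contains no nondegenerate segment (this holds in particular if $\|x\|=\|x\|_p=(\operatorname{tr}|x|^p)^{1/p}$ for some $p\in(1,\infty)$). Then every geodesic $\gamma:I\to G$ is, up to a change of parameter, an arc of a curve as in (a): there are $u\in G$, $x\in\mathcal G$ and a continuous strictly increasing $\varphi:I\to\mathbb R$ with $\gamma(t)=ue^{\varphi(t)x}$ for all $t\in I$. (c) If, furthermore, $u,v\in G$ and $-1$ is not in the spectrum of $u^{-1}v$, then the curve of shortest length from $u$ to $v$ exists and is unique up to parametrization: there is $x\in\mathcal G$ such that $t\mapsto ue^{tx}$, $0\le t\le1$, is a curve from $u$ to $v$ of length $\rho(u,v)$, and every continuous curve $\gamma:[a,b]\to G$, $a<b$, from $u$ to $v$ of length $\rho(u,v)$ is of the form $\gamma(t)=ue^{\varphi(t)x}$ with a continuous nondecreasing $\varphi:[a,b]\to[0,1]$, $\varphi(a)=0$, $\varphi(b)=1$. -/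

import Mathlib

open scoped ENNReal

/-- The square matrices of size `n` over `𝕜` (which will be `ℝ` or `ℂ`). -/
abbrev Mat (n : ℕ) (𝕜 : Type) : Type := Matrix (Fin n) (Fin n) 𝕜

/-- `ν` is a norm on the space of all `n × n` matrices which is invariant under left and right
multiplication by elements of the group `G`. -/
structure IsInvariantNorm {n : ℕ} {𝕜 : Type} [RCLike 𝕜] (G : Submonoid (Mat n 𝕜))
    (ν : Seminorm 𝕜 (Mat n 𝕜)) : Prop where
  eq_zero : ∀ x, ν x = 0 → x = 0
  invariant : ∀ u ∈ G, ∀ v ∈ G, ∀ x, ν (u * x * v) = ν x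

/-- Strict convexity: the unit sphere of `ν` contains no nondegenerate segment. -/
def IsStrictlyConvexNorm {n : ℕ} {𝕜 : Type} [RCLike 𝕜] (ν : Seminorm 𝕜 (Mat n 𝕜)) : Prop :=
  ∀ x y : Mat n 𝕜, x ≠ y → ¬ segment ℝ x y ⊆ {z | ν z = 1}

/-- The Schatten norm `‖x‖_p = (tr |x| ^ p) ^ (1 / p)`, computed from the singular values of `x`,
the square roots of the eigenvalues of `xᴴ * x`. -/
noncomputable def schattenNorm {n : ℕ} {𝕜 : Type} [RCLike 𝕜] (p : ℝ) (x : Mat n 𝕜) : ℝ :=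
  (∑ i, Real.sqrt ((Matrix.isHermitian_conjTranspose_mul_self x).eigenvalues i) ^ p) ^ (1 / p)

/-- The length of the curve `γ : [a, b] → M(n)` with respect to the norm `ν`, that is, the supremum
of `∑ ν (γ (t (i + 1)) - γ (t i))` over all finite increasing sequences `t` in `[a, b]`. -/
noncomputable def curveLength {n : ℕ} {𝕜 : Type} [RCLike 𝕜] (ν : Seminorm 𝕜 (Mat n 𝕜))
    (γ : ℝ → Mat n 𝕜) (a b : ℝ) : ℝ≥0∞ :=
  letI : SeminormedAddCommGroup (Mat n 𝕜) := ν.toAddGroupSeminorm.toSeminormedAddCommGroup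
  eVariationOn γ (Set.Icc a b)

/-- `γ` restricted to `[a, b]` is a (continuous) curve in `G` from `u` to `v`. -/
structure IsCurveFromTo {n : ℕ} {𝕜 : Type} [RCLike 𝕜] (G : Submonoid (Mat n 𝕜))
    (γ : ℝ → Mat n 𝕜) (a b : ℝ) (u v : Mat n 𝕜) : Prop where
  continuousOn : ContinuousOn γ (Set.Icc a b)
  mapsTo : Set.MapsTo γ (Set.Icc a b) G
  source : γ a = u
  target : γ b = v

/-- The intrinsic metric on `G` induced by `ν`: the infimum of the lengths of the curves in `G`
which connect `u` and `v`. -/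
noncomputable def intrinsicDist {n : ℕ} {𝕜 : Type} [RCLike 𝕜] (G : Submonoid (Mat n 𝕜))
    (ν : Seminorm 𝕜 (Mat n 𝕜)) (u v : Mat n 𝕜) : ℝ≥0∞ :=
  ⨅ (γ : ℝ → Mat n 𝕜) (_ : IsCurveFromTo G γ 0 1 u v), curveLength ν γ 0 1

/-- `γ` restricted to `[a, b]` is a shortest curve in `G` from `u` to `v`. -/
structure IsShortestCurve {n : ℕ} {𝕜 : Type} [RCLike 𝕜] (G : Submonoid (Mat n 𝕜))
    (ν : Seminorm 𝕜 (Mat n 𝕜)) (γ : ℝ → Mat n 𝕜) (a b : ℝ) (u v : Mat n 𝕜) : Prop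
    extends IsCurveFromTo G γ a b u v where
  length_eq : curveLength ν γ a b = intrinsicDist G ν u v

/-- `γ`, defined on the interval `I`, is a geodesic of `G` with its intrinsic metric: a continuous
curve that locally realizes the distance between its points. A geodesic is moreover either constant
(the degenerate case) or not constant on any nondegenerate subinterval: otherwise a curve could
stop for a while and leave in another direction. -/
structure IsGeodesicOn {n : ℕ} {𝕜 : Type} [RCLike 𝕜] (G : Submonoid (Mat n 𝕜))
    (ν : Seminorm 𝕜 (Mat n 𝕜)) (γ : ℝ → Mat n 𝕜) (I : Set ℝ) : Prop where
  continuousOn : ContinuousOn γ I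
  mapsTo : Set.MapsTo γ I G
  locally_shortest : ∀ t ∈ I, ∃ ε > 0, ∀ r ∈ I, ∀ s ∈ I, |r - t| < ε → |s - t| < ε → r ≤ s →
    curveLength ν γ r s = intrinsicDist G ν (γ r) (γ s)
  nonstop : (∀ r ∈ I, ∀ s ∈ I, γ r = γ s) ∨
    ∀ r ∈ I, ∀ s ∈ I, r < s → ∃ t ∈ Set.Icc r s, γ t ≠ γ r

/-! Two norms are at work: `ν` measures length, while the operator norm `‖·‖` controls spectra and
enters only through bounds by `π`. Everything rests on an explicit formula for the distance from
`1`, namely `arcNorm ν u = ν (arccos (Re u))` with `Re u = (u + u*) / 2`. If `x` is skew-Hermitian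
with `‖x‖ ≤ π`, then `arccos (Re (exp x)) = |x|`, and polar decomposition gives `arcNorm ν (exp x) =
ν x` (`arcNorm_exp`).

The key inequality is `arcNorm ν u ≤ arcNorm ν (u * exp h) + ν h` (`arcNorm_le_mul_exp`). For a
polynomial `p` in place of `arccos`, the derivative of `p (Re (u * exp (t h)))` equals `p' (Re w) *
Im w * h` up to a commutator with the current point `w`. Commutators with `w` cannot decrease the
norm of a matrix commuting with `w`, by averaging over conjugations by powers of `w`
(`norm_le_norm_add_commutator`). The factor `p' (Re w) * Im w` is skew-Hermitian with eigenvalues of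
modulus `|p' c| √(1 - c²)`, hence at most `L` times half the difference of two elements of `G`
(`norm_cfc_mul_imPart_mul_le`). Since `|arccos' c| √(1 - c²) = 1`, polynomials approximating
`arccos` can be chosen with `L` tending to `1`.

Summing this inequality over fine partitions bounds the length of any curve from below by `arcNorm`
of the quotient of its endpoints (`arcNorm_le_curveLength`). One-parameter curves attain the bound
as long as the exponent has operator norm at most `π`, which is (a) and the existence in (c).

For uniqueness, suppose `exp y` lies between `1` and `exp x = exp y * exp z`, with no excess of
distance. Cutting the corner at `exp y` on a small scale shows `ν (y + z) = ν y + ν z`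
(`norm_add_eq_of_le_arcNorm`). Strict convexity makes `y` and `z` proportional, so they commute and
`y + z = x`. Continuous induction along a shortest curve gives (c). Applied locally, this shows that
a geodesic runs along one-parameter groups, whose directions agree on overlaps; signed arc length is
the parameter in (b). Schatten norms are strictly convex by the equality case of Hölder's
inequality.

The two groups are treated together. As real skew-symmetric matrices have no real diagonalization,
the functional calculus is applied only to the Hermitian matrices `x* x` and `Re u`. All auxiliary
unitaries are built so that `-1` is not an eigenvalue, which places them in `SO(n)` as well. -/

section

open scoped Matrix.Norms.L2Operator
open Filter Topology Polynomial

namespace InvariantNorm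

variable {n : ℕ} {𝕜 : Type} [RCLike 𝕜]

/-- The operator norm makes `Mat n 𝕜` a normed algebra over `ℝ`. -/
@[reducible] noncomputable def realNormedAlgebra : NormedAlgebra ℝ (Mat n 𝕜) where
  norm_smul_le r x := by
    have h : r • x = (r : 𝕜) • x := by
      ext i j; simp [Algebra.smul_def]
    rw [h, norm_smul, RCLike.norm_ofReal, Real.norm_eq_abs]

attribute [local instance] realNormedAlgebra

theorem ofReal_smul_eq (r : ℝ) (x : Mat n 𝕜) : (r : 𝕜) • x = r • x := by
  ext i j; simp [Algebra.smul_def]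

/-! ### Functional calculus of Hermitian matrices -/

/-- The spectrum is finite, so every function is continuous on it; if `a` is not self-adjoint, all
three terms have the default value `0`. -/
theorem cfc_mul_all (f g : ℝ → ℝ) (a : Mat n 𝕜) :
    cfc f a * cfc g a = cfc (fun x => f x * g x) a := by
  by_cases ha : IsSelfAdjoint a
  · refine (cfc_mul f g a ?_ ?_).symm <;>
      exact (Matrix.finite_real_spectrum (A := a)).continuousOn _
  · simp [cfc_apply_of_not_predicate a ha]

theorem continuousOn_spectrum (f : ℝ → ℝ) (a : Mat n 𝕜) : ContinuousOn f (spectrum ℝ a) :=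
  (Matrix.finite_real_spectrum (A := a)).continuousOn _

theorem cfc_sub_all (f g : ℝ → ℝ) (a : Mat n 𝕜) :
    cfc f a - cfc g a = cfc (fun x => f x - g x) a :=
  (cfc_sub f g a (continuousOn_spectrum _ _) (continuousOn_spectrum _ _)).symm

theorem cfc_comp_all (f g : ℝ → ℝ) {a : Mat n 𝕜} (ha : IsSelfAdjoint a) :
    cfc g (cfc f a) = cfc (fun x => g (f x)) a :=
  (cfc_comp' g f a ((((Matrix.finite_real_spectrum (A := a)).image f)).continuousOn _)
    (continuousOn_spectrum _ _) ha).symm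

theorem cfc_eq_diagonal {a : Mat n 𝕜} (ha : IsSelfAdjoint a) (f : ℝ → ℝ) :
    cfc f a = (Matrix.IsHermitian.eigenvectorUnitary (A := a) ha : Mat n 𝕜) *
      Matrix.diagonal (fun i => ((f (Matrix.IsHermitian.eigenvalues (A := a) ha i) : ℝ) : 𝕜)) *
      star (Matrix.IsHermitian.eigenvectorUnitary (A := a) ha : Mat n 𝕜) := by
  rw [Matrix.IsHermitian.cfc_eq ha f]
  unfold Matrix.IsHermitian.cfc
  rw [Unitary.conjStarAlgAut_apply]
  rfl

/-- Pointwise convergence on the spectrum implies convergence of the functional calculus. -/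
theorem tendsto_cfc {ι : Type*} {l : Filter ι} {F : ι → ℝ → ℝ} {f : ℝ → ℝ} {a : Mat n 𝕜}
    (ha : IsSelfAdjoint a) (h : ∀ c ∈ spectrum ℝ a, Tendsto (fun i => F i c) l (𝓝 (f c))) :
    Tendsto (fun i => cfc (F i) a) l (𝓝 (cfc f a)) := by
  simp only [cfc_eq_diagonal ha]
  refine Tendsto.mul (Tendsto.mul tendsto_const_nhds ?_) tendsto_const_nhds
  refine ((continuous_id.matrix_diagonal (n := Fin n) (R := 𝕜)).tendsto _).comp ?_
  refine tendsto_pi_nhds.2 fun i => ?_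
  exact (RCLike.continuous_ofReal.tendsto _).comp
    (h _ (Matrix.IsHermitian.eigenvalues_mem_spectrum_real (A := a) ha i))

theorem hasSum_cfc {F : ℕ → ℝ → ℝ} {f : ℝ → ℝ} {a : Mat n 𝕜}
    (ha : IsSelfAdjoint a) (h : ∀ c ∈ spectrum ℝ a, HasSum (fun k => F k c) (f c)) :
    HasSum (fun k => cfc (F k) a) (cfc f a) := by
  have : (fun s : Finset ℕ => ∑ k ∈ s, cfc (F k) a) =
      fun s => cfc (fun c => ∑ k ∈ s, F k c) a := by
    ext1 s
    rw [← cfc_sum F a s fun i _ => continuousOn_spectrum _ _]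
    congr 1; ext1; simp
  unfold HasSum
  rw [this]
  exact tendsto_cfc ha h

theorem norm_cfc_le_of_forall {a : Mat n 𝕜} (ha : IsSelfAdjoint a) {f : ℝ → ℝ} {M : ℝ} (hM : 0 ≤ M)
    (h : ∀ c ∈ spectrum ℝ a, |f c| ≤ M) : ‖cfc f a‖ ≤ M := by
  rw [cfc_eq_diagonal ha, ← Unitary.coe_star, CStarRing.norm_mul_coe_unitary,
    CStarRing.norm_coe_unitary_mul, Matrix.l2_opNorm_diagonal]
  refine (pi_norm_le_iff_of_nonneg hM).2 fun i => ?_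
  rw [RCLike.norm_ofReal]
  exact h _ (Matrix.IsHermitian.eigenvalues_mem_spectrum_real (A := a) ha i)

theorem abs_le_norm_cfc {a : Mat n 𝕜} (ha : IsSelfAdjoint a) {f : ℝ → ℝ} {c : ℝ}
    (hc : c ∈ spectrum ℝ a) : |f c| ≤ ‖cfc f a‖ := by
  rw [cfc_eq_diagonal ha, ← Unitary.coe_star, CStarRing.norm_mul_coe_unitary,
    CStarRing.norm_coe_unitary_mul, Matrix.l2_opNorm_diagonal]
  obtain ⟨i, rfl⟩ := (Matrix.IsHermitian.spectrum_real_eq_range_eigenvalues (A := a) ha) ▸ hc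
  refine le_trans ?_ (norm_le_pi_norm _ i)
  rw [RCLike.norm_ofReal]

theorem norm_lt_of_forall {a : Mat n 𝕜} (ha : IsSelfAdjoint a) {M : ℝ} (hM : 0 < M)
    (h : ∀ c ∈ spectrum ℝ a, |c| < M) : ‖a‖ < M := by
  rw [← cfc_id' ℝ a ha, cfc_eq_diagonal ha, ← Unitary.coe_star, CStarRing.norm_mul_coe_unitary,
    CStarRing.norm_coe_unitary_mul, Matrix.l2_opNorm_diagonal]
  refine (pi_norm_lt_iff hM).2 fun i => ?_
  rw [RCLike.norm_ofReal]
  exact h _ (Matrix.IsHermitian.eigenvalues_mem_spectrum_real (A := a) ha i)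

theorem abs_le_norm_of_mem_spectrum {a : Mat n 𝕜} (ha : IsSelfAdjoint a) {c : ℝ}
    (hc : c ∈ spectrum ℝ a) : |c| ≤ ‖a‖ := by
  have := abs_le_norm_cfc ha (f := fun c => c) hc
  rwa [cfc_id' ℝ a ha] at this

theorem isSelfAdjoint_star_mul (x : Mat n 𝕜) : IsSelfAdjoint (star x * x) :=
  IsSelfAdjoint.star_mul_self x

theorem spectrum_star_mul_self_nonneg (x : Mat n 𝕜) {c : ℝ} (hc : c ∈ spectrum ℝ (star x * x)) :
    0 ≤ c := by
  open scoped ComplexOrder in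
  obtain ⟨i, rfl⟩ := (Matrix.IsHermitian.spectrum_real_eq_range_eigenvalues
    (Matrix.isHermitian_conjTranspose_mul_self x)) ▸ hc
  exact (Matrix.posSemidef_conjTranspose_mul_self x).eigenvalues_nonneg i

theorem cfc_const_mul_sq (a : Mat n 𝕜) (ha : IsSelfAdjoint a) (r : ℝ) (k : ℕ) :
    cfc (fun c : ℝ => r * c ^ k) a = r • a ^ k := by
  rw [cfc_const_mul r (fun c : ℝ => c ^ k) a (continuousOn_spectrum _ _), cfc_pow_id a k ha]

/-! ### The exponential of a skew-Hermitian matrix -/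

theorem skew_star {x : Mat n 𝕜} (hx : x ∈ skewAdjoint (Mat n 𝕜)) : star x = -x :=
  skewAdjoint.mem_iff.1 hx

theorem hasSum_exp (x : Mat n 𝕜) :
    HasSum (fun k : ℕ => ((k.factorial : ℝ)⁻¹) • x ^ k) (NormedSpace.exp x) :=
  NormedSpace.exp_series_hasSum_exp' (𝕂 := ℝ) x

theorem hasSum_of_eq {E : Type*} [AddCommMonoid E] [TopologicalSpace E] {f g : ℕ → E} {a : E}
    (h : HasSum f a) (e : ∀ k, g k = f k) : HasSum g a :=
  (funext e : g = f) ▸ h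

theorem pow_two_mul_of_skew {x : Mat n 𝕜} (hx : x ∈ skewAdjoint (Mat n 𝕜)) (k : ℕ) :
    x ^ (2 * k) = (-1 : ℝ) ^ k • (star x * x) ^ k := by
  have hsq : star x * x = - x ^ 2 := by rw [skew_star hx]; noncomm_ring
  rw [pow_mul, ← neg_neg (x ^ 2), ← hsq, neg_pow]
  rcases Nat.even_or_odd k with h | h <;> simp [h.neg_one_pow]

theorem hasSum_exp_even {x : Mat n 𝕜} (hx : x ∈ skewAdjoint (Mat n 𝕜)) :
    HasSum (fun k : ℕ => (((2 * k).factorial : ℝ)⁻¹) • x ^ (2 * k))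
      (cfc (fun c => Real.cos (Real.sqrt c)) (star x * x)) := by
  have hs := isSelfAdjoint_star_mul x
  have := hasSum_cfc (F := fun k c => ((-1) ^ k * ((2 * k).factorial : ℝ)⁻¹) * c ^ k)
    (f := fun c => Real.cos (Real.sqrt c)) hs fun c hc => by
      have h0 := spectrum_star_mul_self_nonneg x hc
      refine hasSum_of_eq (Real.hasSum_cos (Real.sqrt c)) fun k => ?_
      rw [pow_mul, Real.sq_sqrt h0]; ring
  refine hasSum_of_eq this fun k => ?_
  rw [cfc_const_mul_sq _ hs, pow_two_mul_of_skew hx, smul_smul, mul_comm]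

theorem hasSum_exp_odd {x : Mat n 𝕜} (hx : x ∈ skewAdjoint (Mat n 𝕜)) :
    HasSum (fun k : ℕ => (((2 * k + 1).factorial : ℝ)⁻¹) • x ^ (2 * k + 1))
      (x * cfc (fun c => Real.sinc (Real.sqrt c)) (star x * x)) := by
  have hs := isSelfAdjoint_star_mul x
  have := hasSum_cfc (F := fun k c => ((-1) ^ k * ((2 * k + 1).factorial : ℝ)⁻¹) * c ^ k)
    (f := fun c => Real.sinc (Real.sqrt c)) hs fun c hc => by
      have h0 := spectrum_star_mul_self_nonneg x hc
      rcases h0.eq_or_lt with rfl | h0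
      · rw [Real.sqrt_zero, Real.sinc_zero]
        have := hasSum_single (f := fun k : ℕ =>
          ((-1) ^ k * ((2 * k + 1).factorial : ℝ)⁻¹) * (0 : ℝ) ^ k) 0 fun b hb => by simp [hb]
        simpa using this
      · have hne : Real.sqrt c ≠ 0 := (Real.sqrt_pos.2 h0).ne'
        rw [Real.sinc_of_ne_zero hne]
        refine hasSum_of_eq ((Real.hasSum_sin (Real.sqrt c)).div_const (Real.sqrt c)) fun k => ?_
        rw [pow_succ, pow_mul, Real.sq_sqrt h0.le]; field_simp
  refine hasSum_of_eq (this.mul_left x) fun k => ?_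
  rw [cfc_const_mul_sq _ hs, pow_succ', pow_two_mul_of_skew hx, mul_smul_comm, mul_smul_comm,
    smul_smul, mul_comm]

/-- Since `x ^ 2 = -(x* x)`, the even part of the exponential series is the series of `cos √c` at
`x* x`, and the odd part is `x` times that of `sinc √c`. This replaces the diagonalization of `x`
and is valid over `ℝ`. -/
theorem exp_eq_cos_add_sinc {x : Mat n 𝕜} (hx : x ∈ skewAdjoint (Mat n 𝕜)) :
    NormedSpace.exp x = cfc (fun c => Real.cos (Real.sqrt c)) (star x * x) +
      x * cfc (fun c => Real.sinc (Real.sqrt c)) (star x * x) := by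
  have h := HasSum.even_add_odd (f := fun k : ℕ => ((k.factorial : ℝ)⁻¹) • x ^ k)
    (hasSum_exp_even hx) (hasSum_exp_odd hx)
  have h' := hasSum_exp x
  generalize NormedSpace.exp x = e at *
  generalize cfc (fun c => Real.cos (Real.sqrt c)) (star x * x) +
      x * cfc (fun c => Real.sinc (Real.sqrt c)) (star x * x) = e' at *
  exact h'.unique h

end InvariantNorm

end

section

open scoped Matrix.Norms.L2Operator
open Filter Topology Polynomial

namespace InvariantNorm

variable {n : ℕ} {𝕜 : Type} [RCLike 𝕜]

attribute [local instance] realNormedAlgebra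

/-! ### Hermitian and skew-Hermitian parts, the principal logarithm -/

/-- The Hermitian part of a matrix. -/
noncomputable def rePart (u : Mat n 𝕜) : Mat n 𝕜 := (2⁻¹ : ℝ) • (u + star u)

/-- The skew-Hermitian part of a matrix. -/
noncomputable def imPart (u : Mat n 𝕜) : Mat n 𝕜 := (2⁻¹ : ℝ) • (u - star u)

theorem half_smul_add_self (a : Mat n 𝕜) : (2⁻¹ : ℝ) • (a + a) = a := by
  rw [← two_smul ℝ a, smul_smul]; norm_num

theorem rePart_add_imPart (u : Mat n 𝕜) : rePart u + imPart u = u := by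
  rw [rePart, imPart, ← smul_add]
  convert half_smul_add_self u using 2
  abel

theorem rePart_star (u : Mat n 𝕜) : rePart (star u) = rePart u := by
  simp [rePart, add_comm]

theorem isSelfAdjoint_rePart (u : Mat n 𝕜) : IsSelfAdjoint (rePart u) := by
  simp [IsSelfAdjoint, rePart, add_comm]

theorem star_imPart (u : Mat n 𝕜) : star (imPart u) = -imPart u := by
  simp [imPart, ← smul_neg]

theorem isUnitary_comm {u : Mat n 𝕜} : star u * u = 1 ↔ u * star u = 1 := mul_eq_one_comm

theorem commute_star {u : Mat n 𝕜} (hu : star u * u = 1) : Commute u (star u) := by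
  rw [commute_iff_eq, hu, isUnitary_comm.1 hu]

theorem commute_rePart {u y : Mat n 𝕜} (h : Commute y u) (h' : Commute y (star u)) :
    Commute y (rePart u) := (h.add_right h').smul_right _

theorem commute_imPart {u y : Mat n 𝕜} (h : Commute y u) (h' : Commute y (star u)) :
    Commute y (imPart u) := (h.sub_right h').smul_right _

theorem commute_star_of_commute {u y : Mat n 𝕜} (hu : star u * u = 1) (h : Commute y u) :
    Commute y (star u) := by
  have hu' := isUnitary_comm.1 hu
  rw [commute_iff_eq] at *
  calc y * star u = star u * (u * y) * star u := by rw [← mul_assoc, hu, one_mul]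
    _ = star u * (y * u) * star u := by rw [h]
    _ = star u * y * (u * star u) := by noncomm_ring
    _ = star u * y := by rw [hu', mul_one]

theorem commute_rePart_imPart {u : Mat n 𝕜} (hu : star u * u = 1) :
    Commute (rePart u) (imPart u) := by
  have h := commute_star hu
  refine commute_imPart ?_ ?_
  · exact (commute_rePart (Commute.refl u) h).symm
  · exact (commute_rePart h.symm (Commute.refl _)).symm

theorem star_imPart_mul_imPart {u : Mat n 𝕜} (hu : star u * u = 1) :
    star (imPart u) * imPart u = 1 - rePart u ^ 2 := by
  have hu' := isUnitary_comm.1 hu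
  rw [star_imPart, eq_sub_iff_add_eq, rePart, imPart, pow_two]
  simp only [← smul_neg, smul_mul_smul_comm, ← smul_add]
  have : -(u - star u) * (u - star u) + (u + star u) * (u + star u) =
      (1 + 1) + (1 + 1) := by
    calc _ = (u * star u + u * star u) + (star u * u + star u * u) := by noncomm_ring
      _ = _ := by rw [hu, hu']
  rw [this, mul_smul, half_smul_add_self, half_smul_add_self]

theorem norm_one_le : ‖(1 : Mat n 𝕜)‖ ≤ 1 := by
  rw [← Matrix.diagonal_one, Matrix.l2_opNorm_diagonal]
  exact (pi_norm_le_iff_of_nonneg zero_le_one).2 fun i => by simp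

theorem norm_unitary_le {u : Mat n 𝕜} (hu : star u * u = 1) : ‖u‖ ≤ 1 := by
  have h : ‖u‖ * ‖u‖ ≤ 1 := by
    rw [← CStarRing.norm_star_mul_self, hu]; exact norm_one_le
  nlinarith [norm_nonneg u]

theorem abs_le_one_of_mem_spectrum {u : Mat n 𝕜} (hu : star u * u = 1) {c : ℝ}
    (hc : c ∈ spectrum ℝ (rePart u)) : |c| ≤ 1 := by
  refine (abs_le_norm_of_mem_spectrum (isSelfAdjoint_rePart u) hc).trans ?_
  rw [rePart, norm_smul]
  have := norm_add_le u (star u)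
  rw [norm_star] at this
  have h := norm_unitary_le hu
  rw [Real.norm_of_nonneg (by norm_num)]
  linarith

theorem sqrt_le_norm {x : Mat n 𝕜} {c : ℝ} (hc : c ∈ spectrum ℝ (star x * x)) :
    Real.sqrt c ≤ ‖x‖ := by
  have := abs_le_norm_of_mem_spectrum (isSelfAdjoint_star_mul x) hc
  rw [CStarRing.norm_star_mul_self] at this
  exact Real.sqrt_le_iff.2 ⟨norm_nonneg _, by nlinarith [le_abs_self c]⟩

theorem smul_mem_skew {x : Mat n 𝕜} (hx : x ∈ skewAdjoint (Mat n 𝕜)) (r : ℝ) :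
    r • x ∈ skewAdjoint (Mat n 𝕜) := by
  rw [skewAdjoint.mem_iff, star_smul, skew_star hx]; simp

theorem exp_zero' : NormedSpace.exp (0 : Mat n 𝕜) = 1 := NormedSpace.exp_zero

theorem exp_add_of_comm {x y : Mat n 𝕜} (h : Commute x y) :
    NormedSpace.exp (x + y) = NormedSpace.exp x * NormedSpace.exp y :=
  Matrix.exp_add_of_commute x y h

theorem exp_mul_exp_neg (x : Mat n 𝕜) : NormedSpace.exp x * NormedSpace.exp (-x) = 1 := by
  rw [← exp_add_of_comm (Commute.neg_right (Commute.refl x)), add_neg_cancel, exp_zero']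

theorem exp_neg_mul_exp (x : Mat n 𝕜) : NormedSpace.exp (-x) * NormedSpace.exp x = 1 := by
  simpa using exp_mul_exp_neg (-x)

theorem star_exp {x : Mat n 𝕜} (hx : x ∈ skewAdjoint (Mat n 𝕜)) :
    star (NormedSpace.exp x) = NormedSpace.exp (-x) := by
  rw [Matrix.star_eq_conjTranspose, ← Matrix.exp_conjTranspose, ← Matrix.star_eq_conjTranspose,
    skew_star hx]

theorem star_exp_mul_exp {x : Mat n 𝕜} (hx : x ∈ skewAdjoint (Mat n 𝕜)) :
    star (NormedSpace.exp x) * NormedSpace.exp x = 1 := by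
  rw [star_exp hx, exp_neg_mul_exp]

theorem exp_neg_eq_cos_sub_sinc {x : Mat n 𝕜} (hx : x ∈ skewAdjoint (Mat n 𝕜)) :
    NormedSpace.exp (-x) = cfc (fun c => Real.cos (Real.sqrt c)) (star x * x) -
      x * cfc (fun c => Real.sinc (Real.sqrt c)) (star x * x) := by
  have h := exp_eq_cos_add_sinc (neg_mem hx)
  rw [star_neg, neg_mul_neg, neg_mul, ← sub_eq_add_neg] at h
  exact h

theorem rePart_exp {x : Mat n 𝕜} (hx : x ∈ skewAdjoint (Mat n 𝕜)) :
    rePart (NormedSpace.exp x) = cfc (fun c => Real.cos (Real.sqrt c)) (star x * x) := by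
  rw [rePart, star_exp hx, exp_neg_eq_cos_sub_sinc hx, exp_eq_cos_add_sinc hx]
  convert half_smul_add_self _ using 2
  abel

theorem imPart_exp {x : Mat n 𝕜} (hx : x ∈ skewAdjoint (Mat n 𝕜)) :
    imPart (NormedSpace.exp x) = x * cfc (fun c => Real.sinc (Real.sqrt c)) (star x * x) := by
  rw [imPart, star_exp hx, exp_neg_eq_cos_sub_sinc hx, exp_eq_cos_add_sinc hx]
  convert half_smul_add_self _ using 2
  abel

/-- The Hermitian part of `exp x` is `cos |x|`, and `arccos` undoes `cos` exactly on `[0, π]`, which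
contains the eigenvalues of `|x|`. -/
theorem cfc_arccos_rePart_exp {x : Mat n 𝕜} (hx : x ∈ skewAdjoint (Mat n 𝕜)) (h : ‖x‖ ≤ Real.pi) :
    cfc Real.arccos (rePart (NormedSpace.exp x)) = cfc Real.sqrt (star x * x) := by
  rw [rePart_exp hx, cfc_comp_all _ _ (isSelfAdjoint_star_mul x)]
  exact cfc_congr fun c hc => Real.arccos_cos (Real.sqrt_nonneg c) ((sqrt_le_norm hc).trans h)

theorem sinc_pos {θ : ℝ} (h0 : 0 ≤ θ) (h : θ < Real.pi) : 0 < Real.sinc θ := by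
  rcases h0.eq_or_lt with rfl | h0
  · simp
  · rw [Real.sinc_of_ne_zero h0.ne']
    exact div_pos (Real.sin_pos_of_pos_of_lt_pi h0 h) h0

/-- The principal logarithm of a unitary matrix `u` for which `1 + u` is invertible. -/
noncomputable def principalLog (u : Mat n 𝕜) : Mat n 𝕜 :=
  imPart u * cfc (fun c => (Real.sinc (Real.arccos c))⁻¹) (rePart u)

/-- The skew part of `exp x` is `x * sinc |x|`, and `|x|` is read off from the Hermitian part by
`arccos`. For `‖x‖ < π` the factor `sinc |x|` is invertible. -/
theorem principalLog_exp {x : Mat n 𝕜} (hx : x ∈ skewAdjoint (Mat n 𝕜)) (h : ‖x‖ < Real.pi) :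
    principalLog (NormedSpace.exp x) = x := by
  rw [principalLog, imPart_exp hx, rePart_exp hx, cfc_comp_all _ _ (isSelfAdjoint_star_mul x),
    mul_assoc, cfc_mul_all]
  rw [cfc_congr (g := fun _ => (1 : ℝ)) fun c hc => ?_, cfc_const_one ℝ _ (isSelfAdjoint_star_mul x),
    mul_one]
  have h' := (sqrt_le_norm hc).trans_lt h
  simp only
  rw [Real.arccos_cos (Real.sqrt_nonneg c) h'.le,
    mul_inv_cancel₀ (sinc_pos (Real.sqrt_nonneg c) h').ne']

theorem commute_principalLog {u y : Mat n 𝕜} (hu : star u * u = 1) (h : Commute y u) :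
    Commute y (principalLog u) := by
  have h' := commute_star_of_commute hu h
  exact (commute_imPart h h').mul_right ((commute_rePart h h').symm.cfc_real _).symm

/-- Below `π`, `x` is a function of `exp x` and its adjoint, through `principalLog`. -/
theorem commute_of_commute_exp {x y : Mat n 𝕜} (hx : x ∈ skewAdjoint (Mat n 𝕜))
    (h : ‖x‖ < Real.pi) (hy : Commute y (NormedSpace.exp x)) : Commute y x := by
  have := commute_principalLog (star_exp_mul_exp hx) hy
  rwa [principalLog_exp hx h] at this

/-- From `(1 + u) * (1 + u)* = 2 (1 + Re u)`: an eigenvalue `-1` of `Re u` would make `1 + u`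
singular. -/
theorem neg_one_lt_of_mem_spectrum {u : Mat n 𝕜} (hu : star u * u = 1) (h1 : IsUnit (1 + u)) {c : ℝ}
    (hc : c ∈ spectrum ℝ (rePart u)) : -1 < c := by
  refine lt_of_le_of_ne (abs_le.1 (abs_le_one_of_mem_spectrum hu hc)).1 ?_
  rintro rfl
  refine hc ?_
  have h2 : (1 + u) * star (1 + u) = (2 : ℝ) • (1 + rePart u) := by
    rw [rePart, smul_add, smul_smul, star_add, star_one]
    norm_num
    calc (1 + u) * (1 + star u) = 1 + u * star u + (u + star u) := by noncomm_ring
      _ = _ := by rw [isUnitary_comm.1 hu, two_smul]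
  have h3 : IsUnit ((2 : ℝ) • (1 + rePart u)) := h2 ▸ h1.mul h1.star
  have h4 : IsUnit (1 + rePart u) := by
    have := h3.smul (Units.mk0 (2⁻¹ : ℝ) (by norm_num))
    rw [Units.smul_def, Units.val_mk0, smul_smul] at this
    simpa using this
  have h5 : algebraMap ℝ (Mat n 𝕜) (-1) - rePart u = -(1 + rePart u) := by
    rw [map_neg, map_one]; abel
  rw [spectrum.mem_resolventSet_iff, h5]
  exact h4.neg

theorem star_principalLog {u : Mat n 𝕜} (hu : star u * u = 1) :
    star (principalLog u) = -principalLog u := by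
  have hc : Commute (cfc (fun c => (Real.sinc (Real.arccos c))⁻¹) (rePart u)) (imPart u) :=
    (commute_rePart_imPart hu).cfc_real _
  have hs : IsSelfAdjoint (cfc (fun c => (Real.sinc (Real.arccos c))⁻¹) (rePart u)) :=
    cfc_predicate _ _
  rw [principalLog, star_mul, hs.star_eq, star_imPart, mul_neg, hc.eq]

theorem star_principalLog_mul_self {u : Mat n 𝕜} (hu : star u * u = 1) (h1 : IsUnit (1 + u)) :
    star (principalLog u) * principalLog u = cfc (fun c => Real.arccos c ^ 2) (rePart u) := by
  have hs : IsSelfAdjoint (cfc (fun c => (Real.sinc (Real.arccos c))⁻¹) (rePart u)) :=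
    cfc_predicate _ _
  have hr := isSelfAdjoint_rePart u
  have h2 : (1 : Mat n 𝕜) - rePart u ^ 2 = cfc (fun c : ℝ => 1 - c ^ 2) (rePart u) := by
    rw [← cfc_sub_all, cfc_const_one ℝ _ hr, cfc_pow_id _ _ hr]
  rw [principalLog, star_mul, hs.star_eq, mul_assoc, ← mul_assoc (star _),
    star_imPart_mul_imPart hu, h2, cfc_mul_all, cfc_mul_all]
  refine cfc_congr fun c hc => ?_
  have hc1 := neg_one_lt_of_mem_spectrum hu h1 hc
  have hc2 := (abs_le.1 (abs_le_one_of_mem_spectrum hu hc)).2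
  rcases hc2.eq_or_lt with rfl | hc2
  · simp
  · have h3 : Real.arccos c ≠ 0 := (Real.arccos_pos.2 hc2).ne'
    have h4 : 0 < 1 - c ^ 2 := by nlinarith
    rw [Real.sinc_of_ne_zero h3, Real.sin_arccos]
    have h5 := Real.sq_sqrt h4.le
    have h6 := (Real.sqrt_pos.2 h4).ne'
    field_simp
    rw [h5]

theorem exp_principalLog {u : Mat n 𝕜} (hu : star u * u = 1) (h1 : IsUnit (1 + u)) :
    NormedSpace.exp (principalLog u) = u := by
  have hx : principalLog u ∈ skewAdjoint (Mat n 𝕜) := skewAdjoint.mem_iff.2 (star_principalLog hu)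
  have hr := isSelfAdjoint_rePart u
  rw [exp_eq_cos_add_sinc hx, star_principalLog_mul_self hu h1, cfc_comp_all _ _ hr,
    cfc_comp_all _ _ hr, principalLog, mul_assoc, cfc_mul_all]
  have e1 : cfc (fun c => Real.cos (Real.sqrt (Real.arccos c ^ 2))) (rePart u) = rePart u := by
    rw [cfc_congr (g := fun c => c) fun c hc => ?_, cfc_id' ℝ _ hr]
    have h2 := abs_le.1 (abs_le_one_of_mem_spectrum hu hc)
    simp only
    rw [Real.sqrt_sq (Real.arccos_nonneg c), Real.cos_arccos h2.1 h2.2]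
  rw [e1, cfc_congr (g := fun _ => (1 : ℝ)) fun c hc => ?_, cfc_const_one ℝ _ hr, mul_one,
    rePart_add_imPart]
  simp only
  rw [Real.sqrt_sq (Real.arccos_nonneg c), inv_mul_cancel₀ (sinc_pos (Real.arccos_nonneg c) ?_).ne']
  exact lt_of_le_of_ne (Real.arccos_le_pi c) fun h =>
    (neg_one_lt_of_mem_spectrum hu h1 hc).not_ge (Real.arccos_eq_pi.1 h)

theorem norm_principalLog_lt {u : Mat n 𝕜} (hu : star u * u = 1) (h1 : IsUnit (1 + u)) :
    ‖principalLog u‖ < Real.pi := by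
  have hpi := Real.pi_pos
  have h : ‖star (principalLog u) * principalLog u‖ < Real.pi ^ 2 := by
    have hs := isSelfAdjoint_star_mul (principalLog u)
    refine norm_lt_of_forall hs (by positivity) fun c hc => ?_
    rw [star_principalLog_mul_self hu h1, cfc_map_spectrum _ _ (isSelfAdjoint_rePart u)
      (continuousOn_spectrum _ _)] at hc
    obtain ⟨d, hd, rfl⟩ := hc
    have h2 : Real.arccos d < Real.pi := lt_of_le_of_ne (Real.arccos_le_pi d) fun h =>
      (neg_one_lt_of_mem_spectrum hu h1 hd).not_ge (Real.arccos_eq_pi.1 h)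
    rw [abs_of_nonneg (sq_nonneg _)]
    exact pow_lt_pow_left₀ h2 (Real.arccos_nonneg d) two_ne_zero
  rw [CStarRing.norm_star_mul_self] at h
  nlinarith [norm_nonneg (principalLog u)]

theorem exists_log {u : Mat n 𝕜} (hu : star u * u = 1) (h1 : IsUnit (1 + u)) :
    ∃ x ∈ skewAdjoint (Mat n 𝕜), NormedSpace.exp x = u ∧ ‖x‖ < Real.pi :=
  ⟨principalLog u, skewAdjoint.mem_iff.2 (star_principalLog hu), exp_principalLog hu h1,
    norm_principalLog_lt hu h1⟩

theorem isUnit_one_add_of_norm_lt {u : Mat n 𝕜} (h : ‖u - 1‖ < 2) : IsUnit (1 + u) := by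
  have h1 : ‖(2⁻¹ : ℝ) • (1 - u)‖ < 1 := by
    rw [norm_smul, norm_sub_rev, Real.norm_of_nonneg (by norm_num)]; linarith
  have h2 : IsUnit (1 - (2⁻¹ : ℝ) • (1 - u)) := isUnit_one_sub_of_norm_lt_one h1
  have h3 := h2.smul (Units.mk0 (2 : ℝ) (by norm_num))
  rw [Units.smul_def, Units.val_mk0, smul_sub, smul_smul] at h3
  norm_num at h3
  convert h3 using 1
  rw [two_smul]; abel

/-- The eigenvalues of `(u - 1)* (u - 1)` are `2 - 2 cos θ`, and `cos θ ≤ 1 - 2 θ² / π²` for `|θ| ≤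
π` bounds them below by `(2 θ / π)²`; hence the constant `π / 2`. -/
theorem norm_le_of_exp {x : Mat n 𝕜} (hx : x ∈ skewAdjoint (Mat n 𝕜)) (h : ‖x‖ ≤ Real.pi) :
    ‖x‖ ≤ Real.pi / 2 * ‖NormedSpace.exp x - 1‖ := by
  have hs := isSelfAdjoint_star_mul x
  have hpi := Real.pi_pos
  set u := NormedSpace.exp x with hu
  have hu1 : star u * u = 1 := star_exp_mul_exp hx
  have e : star (u - 1) * (u - 1) =
      cfc (fun c => 2 - 2 * Real.cos (Real.sqrt c)) (star x * x) := by
    rw [← cfc_sub_all, cfc_const_mul 2 _ _ (continuousOn_spectrum _ _), ← rePart_exp hx, rePart,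
      smul_smul, ← hu, cfc_const 2 _ hs, Algebra.algebraMap_eq_smul_one]
    norm_num
    calc (star u - 1) * (u - 1) = (1 + star u * u) - (u + star u) := by noncomm_ring
      _ = _ := by rw [hu1, two_smul]
  have h1 : ‖star x * x‖ ≤ (Real.pi / 2 * ‖u - 1‖) ^ 2 := by
    rw [← cfc_id' ℝ _ hs]
    refine norm_cfc_le_of_forall hs (by positivity) fun c hc => ?_
    have h0 := spectrum_star_mul_self_nonneg x hc
    have h2 := abs_le_norm_cfc hs (f := fun c => 2 - 2 * Real.cos (Real.sqrt c)) hc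
    rw [← e, CStarRing.norm_star_mul_self] at h2
    have h3 := le_abs_self (2 - 2 * Real.cos (Real.sqrt c))
    have h4 := Real.cos_le_one_sub_mul_cos_sq (x := Real.sqrt c)
      (by rw [abs_of_nonneg (Real.sqrt_nonneg c)]; exact (sqrt_le_norm hc).trans h)
    rw [Real.sq_sqrt h0] at h4
    rw [abs_of_nonneg h0]
    have h5 : 4 / Real.pi ^ 2 * c ≤ ‖u - 1‖ * ‖u - 1‖ := by
      have : 4 / Real.pi ^ 2 * c = 2 * (2 / Real.pi ^ 2 * c) := by ring
      linarith
    have h6 : c = Real.pi ^ 2 / 4 * (4 / Real.pi ^ 2 * c) := by field_simp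
    rw [h6]
    calc _ ≤ Real.pi ^ 2 / 4 * (‖u - 1‖ * ‖u - 1‖) := by gcongr
      _ = _ := by ring
  rw [CStarRing.norm_star_mul_self, ← pow_two] at h1
  exact le_of_sq_le_sq h1 (by positivity)

/-- The half `y = x / 2` satisfies `‖y‖ < π` and `exp y ^ 2 = 1`, so the unitary `exp y` is
Hermitian. Its skew part vanishes, and with it its principal logarithm `y`. -/
theorem eq_zero_of_exp_eq_one {x : Mat n 𝕜} (hx : x ∈ skewAdjoint (Mat n 𝕜))
    (h : ‖x‖ < 2 * Real.pi) (h1 : NormedSpace.exp x = 1) : x = 0 := by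
  have hy := smul_mem_skew hx 2⁻¹
  have hyn : ‖(2⁻¹ : ℝ) • x‖ < Real.pi := by
    rw [norm_smul, Real.norm_of_nonneg (by norm_num)]; linarith
  set y := (2⁻¹ : ℝ) • x with hy_def
  have hxy : x = y + y := by rw [hy_def, ← smul_add, half_smul_add_self]
  have h2 : NormedSpace.exp y * NormedSpace.exp y = 1 := by
    rw [← exp_add_of_comm (Commute.refl y), ← hxy, h1]
  have h3 : star (NormedSpace.exp y) = NormedSpace.exp y := by
    rw [star_exp hy]
    calc _ = NormedSpace.exp (-y) * (NormedSpace.exp y * NormedSpace.exp y) := by rw [h2, mul_one]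
      _ = _ := by rw [← mul_assoc, exp_neg_mul_exp, one_mul]
  have h4 := principalLog_exp hy hyn
  rw [principalLog, imPart, h3, sub_self, smul_zero, zero_mul] at h4
  rw [hxy, ← h4, add_zero]

end InvariantNorm

end

section

open scoped Matrix.Norms.L2Operator
open Filter Topology Polynomial

namespace InvariantNorm

variable {n : ℕ} {𝕜 : Type} [RCLike 𝕜]

attribute [local instance] realNormedAlgebra

/-! ### The groups and their invariant norms -/

/-- The properties shared by `U(n)` and `SO(n)`: a group of unitary matrices which contains every
unitary matrix without the eigenvalue `-1`. -/
structure IsAdmissible (G : Submonoid (Mat n 𝕜)) : Prop where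
  star_mul_self : ∀ u ∈ G, star u * u = 1
  star_mem : ∀ u ∈ G, star u ∈ G
  mem_of_isUnit : ∀ u, star u * u = 1 → IsUnit (1 + u) → u ∈ G

theorem isAdmissible_unitaryGroup : IsAdmissible (Matrix.unitaryGroup (Fin n) 𝕜) where
  star_mul_self _ hu := Matrix.mem_unitaryGroup_iff'.1 hu
  star_mem _ hu := Unitary.star_mem hu
  mem_of_isUnit _ hu _ := Matrix.mem_unitaryGroup_iff'.2 hu

theorem isAdmissible_specialOrthogonalGroup :
    IsAdmissible (Matrix.specialOrthogonalGroup (Fin n) ℝ) where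
  star_mul_self _ hu :=
    Matrix.mem_unitaryGroup_iff'.1 (Matrix.mem_specialOrthogonalGroup_iff.1 hu).1
  star_mem u hu := by
    rw [Matrix.mem_specialOrthogonalGroup_iff] at *
    refine ⟨Unitary.star_mem hu.1, ?_⟩
    rw [Matrix.star_eq_conjTranspose, Matrix.det_conjTranspose, hu.2, star_one]
  mem_of_isUnit u hu h := by
    rw [Matrix.mem_specialOrthogonalGroup_iff]
    refine ⟨Matrix.mem_unitaryGroup_iff'.2 hu, ?_⟩
    have h1 : Matrix.det u * Matrix.det u = 1 := by
      have := congrArg Matrix.det hu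
      rwa [Matrix.det_mul, Matrix.star_eq_conjTranspose, Matrix.det_conjTranspose, star_trivial,
        Matrix.det_one] at this
    -- Taking determinants in `1 + u = u * (1 + u)*` and cancelling `det (1 + u) ≠ 0` leaves `det u
    -- = 1`.
    have h2 : Matrix.det (1 + u) = Matrix.det u * Matrix.det (1 + u) := by
      have e : 1 + u = u * star (1 + u) := by
        rw [star_add, star_one, mul_add, mul_one, isUnitary_comm.1 hu, add_comm]
      conv_lhs => rw [e]
      rw [Matrix.det_mul, Matrix.star_eq_conjTranspose, Matrix.det_conjTranspose, star_trivial]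
    have h3 : Matrix.det (1 + u) ≠ 0 := ((Matrix.isUnit_iff_isUnit_det _).1 h).ne_zero
    exact (mul_right_cancel₀ h3 (by rw [one_mul]; exact h2)).symm

theorem continuous_seminorm (ν : Seminorm 𝕜 (Mat n 𝕜)) : Continuous ν := by
  refine Seminorm.continuous_of_continuousAt_zero (p := ν) ?_
  have h1 : ∀ x : Mat n 𝕜, ν x ≤ ∑ i, ∑ j, ‖x i j‖ * ν (Matrix.single i j 1) := fun x => by
    conv_lhs => rw [Matrix.matrix_eq_sum_single x]
    refine (Finset.le_sum_of_subadditive ν (map_zero ν).le (map_add_le_add ν) _ _).trans (Finset.sum_le_sum fun i _ => ?_)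
    refine (Finset.le_sum_of_subadditive ν (map_zero ν).le (map_add_le_add ν) _ _).trans (Finset.sum_le_sum fun j _ => ?_)
    rw [← map_smul_eq_mul, Matrix.smul_single, smul_eq_mul, mul_one]
  have h2 : Tendsto (fun x : Mat n 𝕜 => ∑ i, ∑ j, ‖x i j‖ * ν (Matrix.single i j 1)) (𝓝 0)
      (𝓝 0) := by
    have h3 : Continuous fun x : Mat n 𝕜 => ∑ i, ∑ j, ‖x i j‖ * ν (Matrix.single i j 1) :=
      continuous_finsetSum _ fun i _ => continuous_finsetSum _ fun j _ =>
        ((continuous_id.matrix_elem i j).norm).mul continuous_const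
    simpa using h3.tendsto 0
  rw [ContinuousAt, map_zero]
  exact squeeze_zero (fun x => apply_nonneg ν x) h1 h2

theorem IsAdmissible.mul_star_self {G : Submonoid (Mat n 𝕜)} (hG : IsAdmissible G) {u : Mat n 𝕜}
    (hu : u ∈ G) : u * star u = 1 := isUnitary_comm.1 (hG.star_mul_self u hu)

/-- For large `m` the matrix `exp (x / (m + 1))` is so close to `1` that `-1` is not an eigenvalue;
`exp x` is its power of exponent `m + 1`. -/
theorem IsAdmissible.exp_mem {G : Submonoid (Mat n 𝕜)} (hG : IsAdmissible G) {x : Mat n 𝕜}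
    (hx : x ∈ skewAdjoint (Mat n 𝕜)) : NormedSpace.exp x ∈ G := by
  have h1 : Tendsto (fun m : ℕ => NormedSpace.exp (((m : ℝ) + 1)⁻¹ • x)) atTop (𝓝 1) := by
    have h2 : Tendsto (fun m : ℕ => ((m : ℝ) + 1)⁻¹ • x) atTop (𝓝 ((0 : ℝ) • x)) := by
      refine Tendsto.smul_const ?_ x
      simpa using tendsto_one_div_add_atTop_nhds_zero_nat (𝕜 := ℝ)
    rw [zero_smul] at h2
    have h3 := (hasFDerivAt_exp_zero (𝕂 := ℝ) (𝔸 := Mat n 𝕜)).continuousAt.tendsto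
    rw [exp_zero'] at h3
    exact h3.comp h2
  obtain ⟨m, hm⟩ := (h1.eventually (Metric.ball_mem_nhds 1 two_pos)).exists
  have h4 : NormedSpace.exp (((m : ℝ) + 1)⁻¹ • x) ∈ G :=
    hG.mem_of_isUnit _ (star_exp_mul_exp (smul_mem_skew hx _))
      (isUnit_one_add_of_norm_lt (by rw [← dist_eq_norm]; exact hm))
  have h5 := pow_mem h4 (m + 1)
  rw [← Matrix.exp_nsmul, ← Nat.cast_smul_eq_nsmul ℝ, smul_smul] at h5
  push_cast at h5
  rwa [mul_inv_cancel₀ (by positivity), one_smul] at h5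

/-- The product `(1 + V)* (1 + V) = 2 + (V + V*)` is a function of `a` with positive values on the
spectrum, hence invertible. -/
theorem isUnit_one_add_of_add_star {V a : Mat n 𝕜} (hV : star V * V = 1) (ha : IsSelfAdjoint a)
    {f : ℝ → ℝ} (hf : ∀ c ∈ spectrum ℝ a, -2 < f c) (h : V + star V = cfc f a) :
    IsUnit (1 + V) := by
  have h1 : (1 + star V) * (1 + V) = cfc (fun c => 2 + f c) a := by
    rw [cfc_const_add 2 f a (continuousOn_spectrum _ _) ha, ← h, map_ofNat]
    calc _ = 1 + star V * V + (V + star V) := by noncomm_ring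
      _ = _ := by rw [hV, one_add_one_eq_two]
  refine IsUnit.of_mul_eq_one_right (cfc (fun c => (2 + f c)⁻¹) a * (1 + star V)) ?_
  rw [mul_assoc, h1, cfc_mul_all, cfc_congr (g := fun _ => (1 : ℝ)) fun c hc => ?_,
    cfc_const_one ℝ _ ha]
  have := hf c hc
  exact inv_mul_cancel₀ (by linarith)

theorem isUnit_one_add_exp {x : Mat n 𝕜} (hx : x ∈ skewAdjoint (Mat n 𝕜)) (h : ‖x‖ < Real.pi) :
    IsUnit (1 + NormedSpace.exp x) := by
  refine isUnit_one_add_of_add_star (star_exp_mul_exp hx) (isSelfAdjoint_star_mul x)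
    (f := fun c => 2 * Real.cos (Real.sqrt c)) (fun c hc => ?_) ?_
  · have h1 := Real.cos_lt_cos_of_nonneg_of_le_pi (Real.sqrt_nonneg c) le_rfl
      ((sqrt_le_norm hc).trans_lt h)
    rw [Real.cos_pi] at h1
    linarith
  · rw [cfc_const_mul 2 _ _ (continuousOn_spectrum _ _), ← rePart_exp hx, rePart, smul_smul]
    norm_num

/-- A unitary matrix with nonnegative Hermitian part belongs to every admissible group. -/
theorem IsAdmissible.mem_of_add_star {G : Submonoid (Mat n 𝕜)} (hG : IsAdmissible G)
    {V a : Mat n 𝕜} (hV : star V * V = 1) (ha : IsSelfAdjoint a) {f : ℝ → ℝ}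
    (hf : ∀ c ∈ spectrum ℝ a, 0 ≤ f c) (h : V + star V = cfc f a) : V ∈ G :=
  hG.mem_of_isUnit V hV
    (isUnit_one_add_of_add_star hV ha (fun c hc => by linarith [hf c hc]) h)

/-! ### Norm inequalities that follow from invariance -/

section

variable {G : Submonoid (Mat n 𝕜)} {ν : Seminorm 𝕜 (Mat n 𝕜)}

theorem norm_mul_left (hν : IsInvariantNorm G ν) {u : Mat n 𝕜} (hu : u ∈ G) (x : Mat n 𝕜) :
    ν (u * x) = ν x := by
  simpa using hν.invariant u hu 1 (one_mem G) x

theorem seminorm_smul_real (ν : Seminorm 𝕜 (Mat n 𝕜)) (r : ℝ) (x : Mat n 𝕜) :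
    ν (r • x) = |r| * ν x := by
  rw [← ofReal_smul_eq, map_smul_eq_mul, RCLike.norm_ofReal]

theorem exists_seminorm_le (ν : Seminorm 𝕜 (Mat n 𝕜)) : ∃ K > 0, ∀ x, ν x ≤ K * ‖x‖ :=
  Seminorm.bound_of_continuous_normedSpace ν (continuous_seminorm ν)

theorem exists_norm_le (hν : IsInvariantNorm G ν) : ∃ K > 0, ∀ x, ‖x‖ ≤ K * ν x := by
  have hproper : ProperSpace (Mat n 𝕜) := FiniteDimensional.proper ℝ _
  -- The unit sphere is empty exactly when `n = 0`.
  rcases (Metric.sphere (0 : Mat n 𝕜) 1).eq_empty_or_nonempty with h | h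
  · refine ⟨1, one_pos, fun x => ?_⟩
    rcases eq_or_ne x 0 with rfl | hx
    · simp
    · have : ‖x‖⁻¹ • x ∈ Metric.sphere (0 : Mat n 𝕜) 1 := by
        rw [mem_sphere_zero_iff_norm, norm_smul, norm_inv, norm_norm,
          inv_mul_cancel₀ (norm_ne_zero_iff.2 hx)]
      simp [h] at this
  · obtain ⟨y, hy, hmin⟩ := (isCompact_sphere (0 : Mat n 𝕜) 1).exists_isMinOn h
      (continuous_seminorm ν).continuousOn
    have hy0 : 0 < ν y := by
      refine lt_of_le_of_ne (apply_nonneg ν y) fun h0 => ?_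
      rw [mem_sphere_zero_iff_norm, hν.eq_zero y h0.symm, norm_zero] at hy
      exact zero_ne_one hy
    refine ⟨(ν y)⁻¹, inv_pos.2 hy0, fun x => ?_⟩
    rcases eq_or_ne x 0 with rfl | hx
    · simp
    · have hx' := norm_pos_iff.2 hx
      have h1 : ν y ≤ ν (‖x‖⁻¹ • x) := hmin (by
        rw [mem_sphere_zero_iff_norm, norm_smul, norm_inv, norm_norm, inv_mul_cancel₀ hx'.ne'])
      rw [seminorm_smul_real, abs_of_pos (inv_pos.2 hx')] at h1
      field_simp at h1 ⊢
      linarith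

/-- Multiplication by a skew-Hermitian contraction commuting with `u` does not increase an
invariant norm. -/
theorem norm_cfc_mul_imPart_mul_le (hG : IsAdmissible G) (hν : IsInvariantNorm G ν) {u : Mat n 𝕜}
    (hu : star u * u = 1) {f : ℝ → ℝ} {L : ℝ} (hL : 0 < L)
    (hf : ∀ c ∈ spectrum ℝ (rePart u), f c ^ 2 * (1 - c ^ 2) ≤ L ^ 2) (h : Mat n 𝕜) :
    ν (cfc f (rePart u) * imPart u * h) ≤ L * ν h := by
  have hr := isSelfAdjoint_rePart u
  set S := imPart u with hS
  -- The product `T = B * S` is a skew-Hermitian contraction and `R = √(1 - T* T)` commutes with it,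
  -- so `R + T` is unitary with adjoint `R - T`. Thus `T` is half the difference of these two
  -- unitaries, which lie in `G` because their Hermitian part `R` is nonnegative.
  set R := cfc (fun c => Real.sqrt (1 - f c ^ 2 * (1 - c ^ 2) / L ^ 2)) (rePart u) with hR
  set B := cfc (fun c => f c / L) (rePart u) with hB
  have hcS : Commute (rePart u) S := commute_rePart_imPart hu
  have hBS : Commute B S := hcS.cfc_real _
  have hRS : Commute R S := hcS.cfc_real _
  have hRB : Commute R B := cfc_commute_cfc _ _ _
  have hRs : star R = R := (cfc_predicate (R := ℝ) (p := IsSelfAdjoint) _ _ : IsSelfAdjoint R)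
  have hBs : star B = B := (cfc_predicate (R := ℝ) (p := IsSelfAdjoint) _ _ : IsSelfAdjoint B)
  have hSs : star S = -S := star_imPart u
  have hstar : star (R + B * S) = R - B * S := by
    rw [star_add, star_mul, hRs, hBs, hSs, neg_mul, ← hBS.eq, sub_eq_add_neg]
  have hSS : -(S * S) = cfc (fun c : ℝ => 1 - c ^ 2) (rePart u) := by
    rw [← neg_mul, ← hSs, star_imPart_mul_imPart hu, ← cfc_sub_all, cfc_const_one ℝ _ hr,
      cfc_pow_id _ _ hr]
  have hV : star (R + B * S) * (R + B * S) = 1 := by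
    have e : (R - B * S) * (R + B * S) = R * R + B * B * -(S * S) := by
      have e1 : R * (B * S) = B * S * R := (hRB.mul_right hRS).eq
      have e2 : B * S * (B * S) = B * B * (S * S) := by
        rw [mul_assoc, ← mul_assoc S, ← hBS.eq, mul_assoc, mul_assoc]
      rw [sub_mul, mul_add, mul_add, e1, e2]; noncomm_ring
    rw [hstar, e, hSS, hR, hB, cfc_mul_all, cfc_mul_all, cfc_mul_all,
      ← cfc_add (hf := continuousOn_spectrum _ _) (hg := continuousOn_spectrum _ _),
      cfc_congr (g := fun _ => (1 : ℝ)) fun c hc => ?_, cfc_const_one ℝ _ hr]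
    have h1 : 0 ≤ 1 - f c ^ 2 * (1 - c ^ 2) / L ^ 2 := by
      rw [sub_nonneg, div_le_one (by positivity)]; exact hf c hc
    simp only
    rw [Real.mul_self_sqrt h1]
    ring
  have hVG : R + B * S ∈ G := by
    refine hG.mem_of_add_star hV hr
      (f := fun c => 2 * Real.sqrt (1 - f c ^ 2 * (1 - c ^ 2) / L ^ 2))
      (fun c _ => by positivity) ?_
    rw [hstar, cfc_const_mul 2 _ _ (continuousOn_spectrum _ _), ← hR, two_smul]
    abel
  have hV'G : R - B * S ∈ G := hstar ▸ hG.star_mem _ hVG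
  have e : cfc f (rePart u) * S * h = (L / 2) • ((R + B * S) * h - (R - B * S) * h) := by
    have : cfc f (rePart u) = L • B := by
      rw [hB, ← cfc_const_mul L _ _ (continuousOn_spectrum _ _)]
      refine cfc_congr fun c _ => ?_
      field_simp
    rw [← sub_mul, add_sub_sub_cancel, ← two_smul ℝ (B * S), this, smul_mul_assoc, smul_mul_assoc,
      smul_mul_assoc, smul_smul, div_mul_cancel₀ _ two_ne_zero]
  rw [e, seminorm_smul_real, abs_of_pos (by positivity)]
  have h1 := map_sub_le_add ν ((R + B * S) * h) ((R - B * S) * h)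
  rw [norm_mul_left hν hVG, norm_mul_left hν hV'G] at h1
  nlinarith

/-- Polar decomposition `x = V * |x|`. As `x` commutes with `|x|`, the partial isometry `x * |x|⁻¹`
is skew-Hermitian; completing it by the projection `P` onto the kernel gives a unitary `V` with
Hermitian part `P ≥ 0`, hence an element of `G`. -/
theorem norm_sqrt_star_mul_self (hG : IsAdmissible G) (hν : IsInvariantNorm G ν) {x : Mat n 𝕜}
    (hx : x ∈ skewAdjoint (Mat n 𝕜)) : ν (cfc Real.sqrt (star x * x)) = ν x := by
  have hr := isSelfAdjoint_star_mul x
  have hxs := skew_star hx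
  set H := star x * x with hH
  -- The convention `0⁻¹ = 0` makes `R` the pseudo-inverse of `|x|`, zero on the kernel.
  set R := cfc (fun c => (Real.sqrt c)⁻¹) H with hR
  set P := cfc (fun c : ℝ => if c = 0 then 1 else 0) H with hP
  have hxH : Commute H x := by
    rw [hH, hxs]; exact ((Commute.refl x).neg_left).mul_left (Commute.refl x)
  have hRx : Commute R x := hxH.cfc_real _
  have hPx : Commute P x := hxH.cfc_real _
  have hRs : star R = R := (cfc_predicate (R := ℝ) (p := IsSelfAdjoint) _ _ : IsSelfAdjoint R)
  have hPs : star P = P := (cfc_predicate (R := ℝ) (p := IsSelfAdjoint) _ _ : IsSelfAdjoint P)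
  have hRP : R * P = 0 := by
    rw [hR, hP, cfc_mul_all, cfc_congr (g := fun _ => (0 : ℝ)) fun c _ => ?_, cfc_const_zero]
    by_cases hc : c = 0 <;> simp [hc]
  have hPR : P * R = 0 := by rw [hP, hR, (cfc_commute_cfc _ _ H).eq, ← hR, ← hP, hRP]
  have hHid : cfc (fun c : ℝ => c) H = H := cfc_id' ℝ H hr
  have hxP : x * P = 0 := by
    have : star (x * P) * (x * P) = 0 := by
      rw [star_mul, hPs, mul_assoc, ← mul_assoc (star x), ← hH]
      conv_lhs => rw [← hHid]
      rw [hP, cfc_mul_all, cfc_mul_all, cfc_congr (g := fun _ => (0 : ℝ)) fun c _ => ?_,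
        cfc_const_zero]
      by_cases hc : c = 0 <;> simp [hc]
    exact CStarRing.star_mul_self_eq_zero_iff _ |>.1 this
  have hstar : star (x * R + P) = P - x * R := by
    rw [star_add, star_mul, hRs, hPs, hxs, mul_neg, hRx.eq]; abel
  have hV : star (x * R + P) * (x * R + P) = 1 := by
    have e : (P - x * R) * (x * R + P) = P * P + H * (R * R) := by
      have e1 : P * (x * R) = 0 := by rw [← mul_assoc, hPx.eq, mul_assoc, hPR, mul_zero]
      have e2 : x * R * P = 0 := by rw [mul_assoc, hRP, mul_zero]
      have e3 : x * R * (x * R) = - (H * (R * R)) := by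
        rw [hH, hxs, mul_assoc, ← mul_assoc R, hRx.eq]; noncomm_ring
      rw [sub_mul, mul_add, mul_add, e1, e2, e3]; noncomm_ring
    rw [hstar, e]
    have e4 : H * (R * R) = cfc (fun c => c * ((Real.sqrt c)⁻¹ * (Real.sqrt c)⁻¹)) H := by
      have := cfc_mul_all (fun c : ℝ => c) (fun c => (Real.sqrt c)⁻¹ * (Real.sqrt c)⁻¹) H
      rw [hHid] at this
      rw [← this, hR, cfc_mul_all]
    rw [e4, hP, cfc_mul_all,
      ← cfc_add (hf := continuousOn_spectrum _ _) (hg := continuousOn_spectrum _ _),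
      cfc_congr (g := fun _ => (1 : ℝ)) fun c hc => ?_, cfc_const_one ℝ _ hr]
    have h0 := spectrum_star_mul_self_nonneg x hc
    rcases h0.eq_or_lt with rfl | h0
    · simp
    · have := Real.mul_self_sqrt h0.le
      have h1 := (Real.sqrt_pos.2 h0).ne'
      simp only [h0.ne', if_false, mul_zero, zero_add]
      rw [← mul_inv, this, mul_inv_cancel₀ h0.ne']
  have hVG : x * R + P ∈ G := by
    refine hG.mem_of_add_star hV hr (f := fun c => 2 * if c = 0 then 1 else 0)
      (fun c _ => by positivity) ?_
    rw [hstar, cfc_const_mul 2 _ _ (continuousOn_spectrum _ _), ← hP, two_smul]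
    abel
  have hxRR : x * (R * cfc Real.sqrt H) = x := by
    have e5 : R * cfc Real.sqrt H = 1 - P := by
      rw [hR, hP, cfc_mul_all, eq_sub_iff_add_eq,
        ← cfc_add (hf := continuousOn_spectrum _ _) (hg := continuousOn_spectrum _ _),
        cfc_congr (g := fun _ => (1 : ℝ)) fun c hc => ?_, cfc_const_one ℝ _ hr]
      have h0 := spectrum_star_mul_self_nonneg x hc
      rcases h0.eq_or_lt with rfl | h0
      · simp
      · have h1 := (Real.sqrt_pos.2 h0).ne'
        simp only [h0.ne', if_false, add_zero]
        rw [inv_mul_cancel₀ h1]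
    rw [e5, mul_sub, hxP, mul_one, sub_zero]
  have hPQ : P * cfc Real.sqrt H = 0 := by
    rw [hP, cfc_mul_all, cfc_congr (g := fun _ => (0 : ℝ)) fun c _ => ?_, cfc_const_zero]
    by_cases hc : c = 0 <;> simp [hc]
  rw [← norm_mul_left hν hVG, add_mul, mul_assoc, hxRR, hPQ, add_zero]

/-- Adding a commutator with `u` does not decrease the norm of a matrix commuting with `u`. -/
theorem norm_le_norm_add_commutator (hG : IsAdmissible G) (hν : IsInvariantNorm G ν) {u : Mat n 𝕜}
    (hu : u ∈ G) {A : Mat n 𝕜} (hA : Commute u A) (Y : Mat n 𝕜) :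
    ν A ≤ ν (A + (u * Y - Y * u)) := by
  have hu1 := hG.mul_star_self hu
  have hu2 := hG.star_mul_self u hu
  set Z := Y * u with hZ
  have e : u * Y - Y * u = u * Z * star u - Z := by
    rw [hZ, ← mul_assoc, mul_assoc _ u, hu1, mul_one]
  rw [e]
  -- The conjugates of `A + (u Z u* - Z)` by `1, u, …, u ^ (m - 1)` all have the same norm, and
  -- their sum telescopes because `u` commutes with `A`. The leftover commutator term has norm at
  -- most `2 ν Z`, negligible against `m` times `ν A`.
  have key : ∀ m : ℕ, ν ((m : ℝ) • A + (u ^ m * Z * star u ^ m - Z)) ≤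
      m * ν (A + (u * Z * star u - Z)) := by
    intro m
    induction m with
    | zero => simp
    | succ m ih =>
      have e1 : ((m + 1 : ℕ) : ℝ) • A + (u ^ (m + 1) * Z * star u ^ (m + 1) - Z) =
          u * ((m : ℝ) • A + (u ^ m * Z * star u ^ m - Z)) * star u +
            (A + (u * Z * star u - Z)) := by
        have e2 : u * ((m : ℝ) • A) * star u = (m : ℝ) • A := by
          rw [mul_smul_comm, hA.eq, smul_mul_assoc, mul_assoc, hu1, mul_one]
        rw [mul_add, add_mul, e2, pow_succ' u, pow_succ (star u)]
        push_cast
        rw [add_smul, one_smul]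
        noncomm_ring
      rw [e1]
      refine (map_add_le_add ν _ _).trans ?_
      rw [hν.invariant u hu _ (hG.star_mem u hu)]
      push_cast
      linarith
  have key2 : ∀ m : ℕ, (m : ℝ) * (ν A - ν (A + (u * Z * star u - Z))) ≤ 2 * ν Z := by
    intro m
    have h1 := key m
    have h2 : ν (u ^ m * Z * star u ^ m - Z) ≤ 2 * ν Z := by
      refine (map_sub_le_add ν _ _).trans ?_
      rw [hν.invariant _ (pow_mem hu m) _ (pow_mem (hG.star_mem u hu) m)]
      linarith
    have h3 : ν ((m : ℝ) • A) ≤ ν ((m : ℝ) • A + (u ^ m * Z * star u ^ m - Z)) +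
        ν (u ^ m * Z * star u ^ m - Z) := by
      simpa using map_sub_le_add ν ((m : ℝ) • A + (u ^ m * Z * star u ^ m - Z))
        (u ^ m * Z * star u ^ m - Z)
    rw [seminorm_smul_real, abs_of_nonneg (Nat.cast_nonneg m)] at h3
    linarith
  by_contra hlt
  push Not at hlt
  obtain ⟨m, hm⟩ := exists_nat_gt (2 * ν Z / (ν A - ν (A + (u * Z * star u - Z))))
  rw [div_lt_iff₀ (by linarith)] at hm
  linarith [key2 m]

end

end InvariantNorm

end

section

open scoped Matrix.Norms.L2Operator
open Filter Topology Polynomial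

namespace InvariantNorm

variable {n : ℕ} {𝕜 : Type} [RCLike 𝕜]

attribute [local instance] realNormedAlgebra

/-! ### Commutators and derivatives of polynomials along a curve -/

/-- `Z` is a commutator with `u`. -/
def IsCommutatorWith (u Z : Mat n 𝕜) : Prop := ∃ Y, Z = u * Y - Y * u

namespace IsCommutatorWith

variable {u Z W : Mat n 𝕜}

theorem add (hZ : IsCommutatorWith u Z) (hW : IsCommutatorWith u W) :
    IsCommutatorWith u (Z + W) := by
  obtain ⟨Y, rfl⟩ := hZ
  obtain ⟨X, rfl⟩ := hW
  exact ⟨Y + X, by noncomm_ring⟩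

theorem smul (hZ : IsCommutatorWith u Z) (r : ℝ) : IsCommutatorWith u (r • Z) := by
  obtain ⟨Y, rfl⟩ := hZ
  exact ⟨r • Y, by rw [mul_smul_comm, smul_mul_assoc, smul_sub]⟩

theorem mul_left (hZ : IsCommutatorWith u Z) {w : Mat n 𝕜} (hw : Commute u w) :
    IsCommutatorWith u (w * Z) := by
  obtain ⟨Y, rfl⟩ := hZ
  exact ⟨w * Y, by rw [← mul_assoc u, hw.eq]; noncomm_ring⟩

theorem mul_right (hZ : IsCommutatorWith u Z) {w : Mat n 𝕜} (hw : Commute u w) :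
    IsCommutatorWith u (Z * w) := by
  obtain ⟨Y, rfl⟩ := hZ
  exact ⟨Y * w, by rw [mul_assoc Y, ← hw.eq]; noncomm_ring⟩

theorem commutator (u Y : Mat n 𝕜) : IsCommutatorWith u (u * Y - Y * u) := ⟨Y, rfl⟩

/-- For unitary `u`, `u* Y - Y u* = u* (Y u - u Y) u*`, and both outer factors commute with `u`. -/
theorem star_commutator (hu : star u * u = 1) (Y : Mat n 𝕜) :
    IsCommutatorWith u (star u * Y - Y * star u) := by
  have hu' := isUnitary_comm.1 hu
  have h := ((commutator u (-Y)).mul_left (commute_star hu)).mul_right (commute_star hu)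
  convert h using 1
  calc star u * Y - Y * star u = star u * Y * (u * star u) - (star u * u) * Y * star u := by
        rw [hu, hu', one_mul, mul_one]
    _ = _ := by noncomm_ring

theorem rePart_commutator (hu : star u * u = 1) (Y : Mat n 𝕜) :
    IsCommutatorWith u (rePart u * Y - Y * rePart u) := by
  have h := ((commutator u Y).add (star_commutator hu Y)).smul (2⁻¹ : ℝ)
  convert h using 1
  rw [rePart, smul_mul_assoc, mul_smul_comm, ← smul_sub]
  congr 1
  noncomm_ring

end IsCommutatorWith

theorem commute_self_rePart {u : Mat n 𝕜} (hu : star u * u = 1) : Commute u (rePart u) :=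
  commute_rePart (Commute.refl u) (commute_star hu)

theorem commute_aeval {u w : Mat n 𝕜} (h : Commute u w) (p : ℝ[X]) : Commute u (aeval w p) := by
  induction p using Polynomial.induction_on with
  | C a => rw [aeval_C]; exact (Algebra.commutes a u).symm
  | add p q hp hq => rw [map_add]; exact hp.add_right hq
  | monomial k a _ =>
    rw [map_mul, aeval_C, map_pow, aeval_X]
    exact Commute.mul_right (Algebra.commutes a u).symm (h.pow_right _)

/-- Modulo commutators with `u`, polynomials are differentiated along a curve through `rePart u` as
in the commutative case. -/
theorem exists_hasDerivAt_aeval {u : Mat n 𝕜} (hu : star u * u = 1) {C : ℝ → Mat n 𝕜}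
    {C' : Mat n 𝕜} {t : ℝ} (hC : HasDerivAt C C' t) (hCt : C t = rePart u) (p : ℝ[X]) :
    ∃ D, HasDerivAt (fun s => aeval (C s) p) D t ∧
      IsCommutatorWith u (D - aeval (rePart u) (derivative p) * C') := by
  have hmulX : ∀ q : ℝ[X], (∃ D, HasDerivAt (fun s => aeval (C s) q) D t ∧
      IsCommutatorWith u (D - aeval (rePart u) (derivative q) * C')) →
      ∃ D, HasDerivAt (fun s => aeval (C s) (q * X)) D t ∧
      IsCommutatorWith u (D - aeval (rePart u) (derivative (q * X)) * C') := by
    rintro q ⟨D, hD, hZ⟩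
    refine ⟨D * rePart u + aeval (rePart u) q * C', ?_, ?_⟩
    · have h0 : HasDerivAt (fun s => aeval (C s) q * C s) (D * C t + aeval (C t) q * C') t :=
        hD.mul hC
      rw [hCt] at h0
      simpa only [map_mul, aeval_X] using h0
    · have hc := commute_self_rePart hu
      -- The product rule leaves `(D - q' C') R + q' (C' R - R C')` with `R = rePart u` and `q'`
      -- evaluated at `R`; both terms are commutators with `u`, since `q' (R)` and `R` commute with
      -- `u`.
      have h1 := hZ.mul_right hc
      have h2 := ((IsCommutatorWith.rePart_commutator hu C').smul (-1)).mul_left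
        (commute_aeval hc (derivative q))
      convert h1.add h2 using 1
      rw [derivative_mul, derivative_X, mul_one, map_add, map_mul, aeval_X, neg_smul, one_smul]
      noncomm_ring
  induction p using Polynomial.induction_on with
  | C a =>
    refine ⟨0, ?_, 0, ?_⟩
    · simpa only [aeval_C] using hasDerivAt_const t _
    · simp
  | add p q hp hq =>
    obtain ⟨D, hD, hZ⟩ := hp
    obtain ⟨E, hE, hW⟩ := hq
    refine ⟨D + E, ?_, ?_⟩
    · have h0 : HasDerivAt (fun s => aeval (C s) p + aeval (C s) q) (D + E) t := hD.add hE
      simpa only [map_add] using h0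
    · convert hZ.add hW using 1
      rw [derivative_add, map_add]
      noncomm_ring
  | monomial k a h =>
    have := hmulX _ h
    rwa [mul_assoc, ← pow_succ] at this

/-! ### The Lipschitz estimate -/

section

variable {G : Submonoid (Mat n 𝕜)} {ν : Seminorm 𝕜 (Mat n 𝕜)}

/-- As `ν` need not be differentiable, the mean value inequality is used in its form for lower right
slopes: the hypothesis bounds those of `-ν ∘ P` by `M`. -/
theorem seminorm_le_of_hasDerivAt (ν : Seminorm 𝕜 (Mat n 𝕜)) {P : ℝ → Mat n 𝕜} {M : ℝ}
    (hP : ∀ t, ∃ D, HasDerivAt P D t ∧ ∀ ε : ℝ, 0 ≤ ε → ν (P t) ≤ ν (P t + ε • D) + ε * M) :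
    ν (P 0) ≤ ν (P 1) + M := by
  have hcont : Continuous P := continuous_iff_continuousAt.2 fun t =>
    let ⟨_, hD, _⟩ := hP t
    hD.continuousAt
  have key := image_le_of_liminf_slope_right_le_deriv_boundary (f := fun t => -ν (P t)) (a := 0)
    (b := 1) (((continuous_seminorm ν).comp hcont).neg.continuousOn)
    (B := fun t => -ν (P 0) + t * M) (B' := fun _ => M) (by simp) (by fun_prop)
    (fun t _ => by
      simpa using (((hasDerivAt_id t).mul_const M).const_add (-ν (P 0))).hasDerivWithinAt)
    (fun t _ r hr => by
      obtain ⟨D, hD, hle⟩ := hP t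
      have h1 : Tendsto (fun z => M + ν (slope P t z - D)) (𝓝[>] t) (𝓝 (M + ν (D - D))) := by
        refine tendsto_const_nhds.add (((continuous_seminorm ν).tendsto _).comp ?_)
        have h2 := (hasDerivAt_iff_tendsto_slope.1 hD).mono_left
          (nhdsWithin_mono t (fun z (hz : t < z) => ne_of_gt hz) : 𝓝[>] t ≤ _)
        exact h2.sub_const D
      rw [sub_self, map_zero, add_zero] at h1
      refine Eventually.frequently ?_
      filter_upwards [h1.eventually_lt_const hr, self_mem_nhdsWithin] with z hz hzt
      have hzt' : 0 < z - t := sub_pos.2 hzt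
      refine lt_of_le_of_lt ?_ hz
      rw [slope_def_field, div_le_iff₀ hzt']
      have h3 := hle (z - t) hzt'.le
      have h4 : P t + (z - t) • D = P z - (z - t) • (slope P t z - D) := by
        rw [smul_sub, sub_smul_slope, vsub_eq_sub]; abel
      have h5 := map_sub_le_add ν (P z) ((z - t) • (slope P t z - D))
      rw [← h4, seminorm_smul_real, abs_of_pos hzt'] at h5
      linarith)
    (Set.right_mem_Icc.2 zero_le_one)
  linarith

/-- At `w = u * exp (t h)`, the matrices `Re (w h)` and `Im w * h` differ by half of `w* h - h w*`,
a commutator with `w`. So the derivative of `p (Re w)` is `p' (Re w) * Im w * h` modulo commutators.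
These can be dropped in a lower bound for the norm, because `p (Re w)` commutes with `w`; the
remaining term costs at most `L * ν h` per unit of time. -/
theorem seminorm_aeval_rePart_le (hG : IsAdmissible G) (hν : IsInvariantNorm G ν) {p : ℝ[X]} {L : ℝ}
    (hL : 0 < L)
    (hp : ∀ c ∈ Set.Icc (-1 : ℝ) 1, (derivative p).eval c ^ 2 * (1 - c ^ 2) ≤ L ^ 2)
    {u h : Mat n 𝕜} (hu : u ∈ G) (hh : h ∈ skewAdjoint (Mat n 𝕜)) :
    ν (aeval (rePart u) p) ≤ ν (aeval (rePart (u * NormedSpace.exp h)) p) + L * ν h := by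
  have key := seminorm_le_of_hasDerivAt ν (M := L * ν h)
    (P := fun t => aeval (rePart (u * NormedSpace.exp (t • h))) p) ?_
  · simpa only [zero_smul, exp_zero', mul_one, one_smul] using key
  intro t
  set w := u * NormedSpace.exp (t • h) with hw
  have hwG : w ∈ G := mul_mem hu (hG.exp_mem (smul_mem_skew hh t))
  have hw1 := hG.star_mul_self w hwG
  have hd : HasDerivAt (fun s : ℝ => u * NormedSpace.exp (s • h)) (w * h) t := by
    rw [hw, mul_assoc]
    exact (hasDerivAt_exp_smul_const (𝕂 := ℝ) h t).const_mul u
  have hd' : HasDerivAt (fun s : ℝ => rePart (u * NormedSpace.exp (s • h)))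
      (rePart (w * h)) t := (hd.add hd.star).const_smul (2⁻¹ : ℝ)
  obtain ⟨D, hD, hZ⟩ := exists_hasDerivAt_aeval hw1 hd' rfl p
  refine ⟨D, hD, fun ε hε => ?_⟩
  have hc := commute_self_rePart hw1
  have h1 : IsCommutatorWith w (rePart (w * h) - imPart w * h) := by
    have := (IsCommutatorWith.star_commutator hw1 h).smul (2⁻¹ : ℝ)
    convert this using 1
    rw [rePart, imPart, smul_mul_assoc, ← smul_sub, star_mul, skew_star hh]
    congr 1
    noncomm_ring
  have h2 := (hZ.add (h1.mul_left (commute_aeval hc (derivative p)))).smul ε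
  obtain ⟨Y, hY⟩ := h2
  have h3 := norm_le_norm_add_commutator hG hν hwG (commute_aeval hc p) Y
  rw [← hY] at h3
  set K := aeval (rePart w) (derivative p) * imPart w * h with hK
  have h4 : ν K ≤ L * ν h := by
    rw [hK, ← cfc_polynomial (derivative p) (rePart w) (isSelfAdjoint_rePart w)]
    exact norm_cfc_mul_imPart_mul_le hG hν hw1 hL
      (fun c hc => hp c (abs_le.1 (abs_le_one_of_mem_spectrum hw1 hc))) h
  have h5 : aeval (rePart w) p + ε • (D - aeval (rePart w) (derivative p) * rePart (w * h) +
      aeval (rePart w) (derivative p) * (rePart (w * h) - imPart w * h)) =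
      (aeval (rePart w) p + ε • D) - ε • K := by
    rw [hK, mul_sub, ← mul_assoc, add_sub_assoc, ← smul_sub]
    congr 2
    abel
  rw [h5] at h3
  have h6 := map_sub_le_add ν (aeval (rePart w) p + ε • D) (ε • K)
  rw [seminorm_smul_real, abs_of_nonneg hε] at h6
  have h7 := mul_le_mul_of_nonneg_left h4 hε
  linarith

end

/-! ### Polynomial approximation of the arc cosine -/

theorem exists_derivative_eq (r : ℝ[X]) : ∃ p : ℝ[X], derivative p = r := by
  induction r using Polynomial.induction_on' with
  | add p q hp hq =>
    obtain ⟨a, rfl⟩ := hp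
    obtain ⟨b, rfl⟩ := hq
    exact ⟨a + b, derivative_add⟩
  | monomial k a =>
    refine ⟨monomial (k + 1) (a / (k + 1)), ?_⟩
    rw [derivative_monomial]
    push_cast
    rw [div_mul_cancel₀ _ (by positivity)]

/-- Shrinking the argument by `l < 1` removes the singularities of `arccos'` at `±1`. Weierstrass
approximation is applied to the derivative of `arccos (l c)` and the result integrated. The weight
satisfies `√(1 - c²) ≤ √(1 - l² c²)`, so the weighted derivative is at most `1 + ε`. -/
theorem exists_polynomial_near_arccos_mul {l ε : ℝ} (hl0 : 0 < l) (hl1 : l < 1) (hε : 0 < ε) :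
    ∃ p : ℝ[X], ∀ c ∈ Set.Icc (-1 : ℝ) 1,
      (derivative p).eval c ^ 2 * (1 - c ^ 2) ≤ (1 + ε) ^ 2 ∧
        |p.eval c - Real.arccos (l * c)| ≤ ε := by
  have hpos : ∀ c ∈ Set.Icc (-1 : ℝ) 1, 0 < 1 - (l * c) ^ 2 := fun c hc => by
    have h1 : c ^ 2 ≤ 1 := by nlinarith [hc.1, hc.2]
    have h2 : l ^ 2 < 1 := by nlinarith
    rw [mul_pow]
    nlinarith [sq_nonneg l]
  have hder : ∀ c ∈ Set.Icc (-1 : ℝ) 1, HasDerivAt (fun c => Real.arccos (l * c))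
      (-(1 / Real.sqrt (1 - (l * c) ^ 2)) * l) c := fun c hc => by
    have h1 := hpos c hc
    refine (Real.hasDerivAt_arccos ?_ ?_).comp c (by simpa using (hasDerivAt_id c).const_mul l)
    · intro h; rw [h] at h1; norm_num at h1
    · intro h; rw [h] at h1; norm_num at h1
  have hcont : ContinuousOn (fun c => -(1 / Real.sqrt (1 - (l * c) ^ 2)) * l)
      (Set.Icc (-1) 1) := by
    refine ContinuousOn.mul (ContinuousOn.neg (ContinuousOn.div (by fun_prop) (by fun_prop) ?_))
      (by fun_prop)
    exact fun c hc => (Real.sqrt_pos.2 (hpos c hc)).ne'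
  obtain ⟨r, hr⟩ := exists_polynomial_near_of_continuousOn _ _ _ hcont ε hε
  obtain ⟨q, hq⟩ := exists_derivative_eq r
  -- The constant makes the values at `0` agree, so that the error is at most `ε |c| ≤ ε`.
  refine ⟨q + C (Real.arccos 0 - q.eval 0), fun c hc => ⟨?_, ?_⟩⟩
  · rw [derivative_add, derivative_C, add_zero, hq]
    have h1 := hr c hc
    have h2 := hpos c hc
    have h3 : c ^ 2 ≤ 1 := by nlinarith [hc.1, hc.2]
    have hsq : 0 ≤ 1 - c ^ 2 := by linarith
    set s := Real.sqrt (1 - c ^ 2) with hs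
    have hs2 : s ^ 2 = 1 - c ^ 2 := Real.sq_sqrt hsq
    have hs0 : 0 ≤ s := Real.sqrt_nonneg _
    have hs1 : s ≤ 1 := by nlinarith [sq_nonneg c]
    have h4 : s ≤ Real.sqrt (1 - (l * c) ^ 2) := Real.sqrt_le_sqrt (by
      have h2 : l ^ 2 < 1 := by nlinarith
      rw [mul_pow]
      nlinarith [sq_nonneg c])
    have h5 := Real.sqrt_pos.2 h2
    have h6 : |r.eval c| ≤ 1 / Real.sqrt (1 - (l * c) ^ 2) * l + ε := by
      have h8 : |-(1 / Real.sqrt (1 - (l * c) ^ 2)) * l| = 1 / Real.sqrt (1 - (l * c) ^ 2) * l := by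
        rw [neg_mul, abs_neg, abs_of_nonneg (by positivity)]
      have h7 := abs_sub_abs_le_abs_sub (r.eval c) (-(1 / Real.sqrt (1 - (l * c) ^ 2)) * l)
      rw [h8] at h7
      linarith
    have h9 : |r.eval c| * s ≤ 1 + ε := by
      have h10 : 1 / Real.sqrt (1 - (l * c) ^ 2) * s ≤ 1 := by
        rw [one_div, inv_mul_le_iff₀ h5]; linarith
      calc |r.eval c| * s ≤ (1 / Real.sqrt (1 - (l * c) ^ 2) * l + ε) * s := by gcongr
        _ = (1 / Real.sqrt (1 - (l * c) ^ 2) * s) * l + ε * s := by ring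
        _ ≤ 1 * 1 + ε * 1 := by gcongr
        _ = 1 + ε := by ring
    rw [← hs2, ← sq_abs, ← mul_pow]
    gcongr
  · have hmv := (convex_Icc (-1 : ℝ) 1).norm_image_sub_le_of_norm_hasDerivWithin_le
      (f := fun c => q.eval c - Real.arccos (l * c))
      (f' := fun c => r.eval c - -(1 / Real.sqrt (1 - (l * c) ^ 2)) * l) (C := ε) (x := 0) (y := c)
      (fun c hc => by
        have h := (q.hasDerivAt c).sub (hder c hc)
        rw [hq] at h
        exact h.hasDerivWithinAt)
      (fun c hc => (hr c hc).le) ⟨by norm_num, by norm_num⟩ hc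
    rw [eval_add, eval_C]
    have e : q.eval c + (Real.arccos 0 - q.eval 0) - Real.arccos (l * c) =
        q.eval c - Real.arccos (l * c) - (q.eval 0 - Real.arccos (l * 0)) := by
      rw [mul_zero]; ring
    rw [e]
    refine hmv.trans ?_
    rw [sub_zero, Real.norm_eq_abs]
    have := abs_le.2 hc
    nlinarith

theorem exists_polynomial_tendsto_arccos : ∃ p : ℕ → ℝ[X],
    (∀ k, ∀ c ∈ Set.Icc (-1 : ℝ) 1,
      (derivative (p k)).eval c ^ 2 * (1 - c ^ 2) ≤ (1 + 1 / ((k : ℝ) + 1)) ^ 2) ∧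
    ∀ c ∈ Set.Icc (-1 : ℝ) 1, Tendsto (fun k => (p k).eval c) atTop (𝓝 (Real.arccos c)) := by
  have h : ∀ k : ℕ, ∃ p : ℝ[X], ∀ c ∈ Set.Icc (-1 : ℝ) 1,
      (derivative p).eval c ^ 2 * (1 - c ^ 2) ≤ (1 + 1 / ((k : ℝ) + 1)) ^ 2 ∧
        |p.eval c - Real.arccos ((1 - 1 / ((k : ℝ) + 2)) * c)| ≤ 1 / ((k : ℝ) + 1) := fun k => by
    -- The denominator `k + 2` keeps the factor `l = 1 - 1 / (k + 2)` positive already for `k = 0`.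
    refine exists_polynomial_near_arccos_mul ?_ ?_ (by positivity)
    · have : 1 / ((k : ℝ) + 2) < 1 := by rw [div_lt_one (by positivity)]; linarith [k.cast_nonneg (α := ℝ)]
      linarith
    · have : 0 < 1 / ((k : ℝ) + 2) := by positivity
      linarith
  choose p hp using h
  refine ⟨p, fun k c hc => (hp k c hc).1, fun c hc => ?_⟩
  have h1 : Tendsto (fun k : ℕ => 1 / ((k : ℝ) + 1)) atTop (𝓝 0) :=
    tendsto_one_div_add_atTop_nhds_zero_nat
  have h2 : Tendsto (fun k : ℕ => 1 / ((k : ℝ) + 2)) atTop (𝓝 0) := by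
    have := h1.comp (tendsto_add_atTop_nat 1)
    refine this.congr fun k => ?_
    simp only [Function.comp]
    push_cast
    ring_nf
  have h3 : Tendsto (fun k : ℕ => Real.arccos ((1 - 1 / ((k : ℝ) + 2)) * c)) atTop
      (𝓝 (Real.arccos c)) := by
    have h4 : Tendsto (fun k : ℕ => (1 - 1 / ((k : ℝ) + 2)) * c) atTop (𝓝 c) := by
      simpa using (h2.const_sub 1).mul_const c
    exact (Real.continuous_arccos.tendsto c).comp h4
  have h5 : Tendsto (fun k => (p k).eval c - Real.arccos ((1 - 1 / ((k : ℝ) + 2)) * c)) atTop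
      (𝓝 0) := squeeze_zero_norm (fun k => (hp k c hc).2) h1
  simpa using h5.add h3

/-! ### The distance from the identity -/

/-- The function on the group which turns out to be the intrinsic distance from `1`. -/
noncomputable def arcNorm (ν : Seminorm 𝕜 (Mat n 𝕜)) (u : Mat n 𝕜) : ℝ :=
  ν (cfc Real.arccos (rePart u))

section

variable {G : Submonoid (Mat n 𝕜)} {ν : Seminorm 𝕜 (Mat n 𝕜)}

theorem arcNorm_nonneg (u : Mat n 𝕜) : 0 ≤ arcNorm ν u := apply_nonneg ν _

theorem arcNorm_star (u : Mat n 𝕜) : arcNorm ν (star u) = arcNorm ν u := by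
  rw [arcNorm, rePart_star, arcNorm]

/-- Limit of the polynomial estimates, whose Lipschitz constants `1 + 1 / (k + 1)` tend to `1`. -/
theorem arcNorm_le_mul_exp (hG : IsAdmissible G) (hν : IsInvariantNorm G ν) {u h : Mat n 𝕜}
    (hu : u ∈ G) (hh : h ∈ skewAdjoint (Mat n 𝕜)) :
    arcNorm ν u ≤ arcNorm ν (u * NormedSpace.exp h) + ν h := by
  obtain ⟨p, hp1, hp2⟩ := exists_polynomial_tendsto_arccos
  have hlim : ∀ w ∈ G, Tendsto (fun k => ν (aeval (rePart w) (p k))) atTop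
      (𝓝 (arcNorm ν w)) := fun w hw => by
    have h1 := tendsto_cfc (F := fun k c => (p k).eval c) (f := Real.arccos) (l := atTop)
      (isSelfAdjoint_rePart w)
      (fun c hc => hp2 c (abs_le.1 (abs_le_one_of_mem_spectrum (hG.star_mul_self w hw) hc)))
    simp only [cfc_polynomial _ (rePart w) (isSelfAdjoint_rePart w)] at h1
    exact ((continuous_seminorm ν).tendsto _).comp h1
  have h2 : Tendsto (fun k : ℕ => 1 + 1 / ((k : ℝ) + 1)) atTop (𝓝 1) := by
    simpa using tendsto_one_div_add_atTop_nhds_zero_nat.const_add (1 : ℝ)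
  have h3 := (hlim _ (mul_mem hu (hG.exp_mem hh))).add (h2.mul_const (ν h))
  rw [one_mul] at h3
  exact le_of_tendsto_of_tendsto' (hlim u hu) h3 fun k =>
    seminorm_aeval_rePart_le hG hν (by positivity) (hp1 k) hu hh

theorem arcNorm_mul_exp_le (hG : IsAdmissible G) (hν : IsInvariantNorm G ν) {u h : Mat n 𝕜}
    (hu : u ∈ G) (hh : h ∈ skewAdjoint (Mat n 𝕜)) :
    arcNorm ν (u * NormedSpace.exp h) ≤ arcNorm ν u + ν h := by
  have := arcNorm_le_mul_exp hG hν (mul_mem hu (hG.exp_mem hh)) (neg_mem hh)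
  rwa [mul_assoc, exp_mul_exp_neg, mul_one, map_neg_eq_map] at this

theorem arcNorm_exp_mul_le (hG : IsAdmissible G) (hν : IsInvariantNorm G ν) {u h : Mat n 𝕜}
    (hu : u ∈ G) (hh : h ∈ skewAdjoint (Mat n 𝕜)) :
    arcNorm ν (NormedSpace.exp h * u) ≤ ν h + arcNorm ν u := by
  have := arcNorm_mul_exp_le hG hν (hG.star_mem u hu) (neg_mem hh)
  rwa [← star_exp hh, ← star_mul, arcNorm_star, arcNorm_star, map_neg_eq_map, add_comm] at this

theorem arcNorm_exp (hG : IsAdmissible G) (hν : IsInvariantNorm G ν) {x : Mat n 𝕜}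
    (hx : x ∈ skewAdjoint (Mat n 𝕜)) (h : ‖x‖ ≤ Real.pi) : arcNorm ν (NormedSpace.exp x) = ν x := by
  rw [arcNorm, cfc_arccos_rePart_exp hx h, norm_sqrt_star_mul_self hG hν hx]

theorem arcNorm_one (hG : IsAdmissible G) (hν : IsInvariantNorm G ν) :
    arcNorm ν (1 : Mat n 𝕜) = 0 := by
  have := arcNorm_exp hG hν (zero_mem (skewAdjoint (Mat n 𝕜))) (by simpa using Real.pi_pos.le)
  rwa [exp_zero', map_zero] at this

end

end InvariantNorm

end

section

namespace InvariantNorm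

variable {n : ℕ} {𝕜 : Type} [RCLike 𝕜]

/-! ### The length of curves -/

section

variable (ν : Seminorm 𝕜 (Mat n 𝕜)) (γ : ℝ → Mat n 𝕜)

theorem curveLength_add {a b c : ℝ} (hab : a ≤ b) (hbc : b ≤ c) :
    curveLength ν γ a b + curveLength ν γ b c = curveLength ν γ a c := by
  let _ : SeminormedAddCommGroup (Mat n 𝕜) := ν.toAddGroupSeminorm.toSeminormedAddCommGroup
  have := eVariationOn.Icc_add_Icc γ (s := Set.univ) hab hbc (Set.mem_univ b)
  rw [Set.univ_inter, Set.univ_inter, Set.univ_inter] at this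
  exact this

theorem edist_seminorm (x y : Mat n 𝕜) :
    (ν.toAddGroupSeminorm.toSeminormedAddCommGroup).toPseudoMetricSpace.toEDist.edist x y =
      ENNReal.ofReal (ν (x - y)) := by
  let _ : SeminormedAddCommGroup (Mat n 𝕜) := ν.toAddGroupSeminorm.toSeminormedAddCommGroup
  exact edist_dist x y |>.trans (congrArg ENNReal.ofReal (dist_eq_norm x y))

theorem ofReal_le_curveLength {a b r s : ℝ} (hr : r ∈ Set.Icc a b) (hs : s ∈ Set.Icc a b) :
    ENNReal.ofReal (ν (γ r - γ s)) ≤ curveLength ν γ a b := by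
  rw [← edist_seminorm]
  let _ : SeminormedAddCommGroup (Mat n 𝕜) := ν.toAddGroupSeminorm.toSeminormedAddCommGroup
  exact eVariationOn.edist_le γ hr hs

theorem curveLength_mono {a b c d : ℝ} (hca : c ≤ a) (hbd : b ≤ d) :
    curveLength ν γ a b ≤ curveLength ν γ c d := by
  let _ : SeminormedAddCommGroup (Mat n 𝕜) := ν.toAddGroupSeminorm.toSeminormedAddCommGroup
  exact eVariationOn.mono γ (Set.Icc_subset_Icc hca hbd)

theorem curveLength_self (a : ℝ) : curveLength ν γ a a = 0 := by
  let _ : SeminormedAddCommGroup (Mat n 𝕜) := ν.toAddGroupSeminorm.toSeminormedAddCommGroup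
  exact eVariationOn.subsingleton γ (by simp)

variable {γ}

theorem curveLength_le_of_lipschitz {a b C : ℝ}
    (hC : ∀ r s, r ≤ s → ν (γ s - γ r) ≤ (s - r) * C) (hC0 : 0 ≤ C) :
    curveLength ν γ a b ≤ ENNReal.ofReal ((b - a) * C) := by
  let _ : SeminormedAddCommGroup (Mat n 𝕜) := ν.toAddGroupSeminorm.toSeminormedAddCommGroup
  refine iSup_le fun ⟨m, u, hu, hmem⟩ => ?_
  have h1 : ∀ k, edist (γ (u (k + 1))) (γ (u k)) ≤ ENNReal.ofReal ((u (k + 1) - u k) * C) :=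
    fun k => (edist_seminorm ν _ _).le.trans
      (ENNReal.ofReal_le_ofReal (hC _ _ (hu k.le_succ)))
  refine (Finset.sum_le_sum fun k _ => h1 k).trans ?_
  rw [← ENNReal.ofReal_sum_of_nonneg fun k _ =>
    mul_nonneg (sub_nonneg.2 (hu k.le_succ)) hC0, ← Finset.sum_mul, Finset.sum_range_sub]
  refine ENNReal.ofReal_le_ofReal (mul_le_mul_of_nonneg_right ?_ hC0)
  linarith [(hmem m).2, (hmem 0).1]

end

end InvariantNorm

end

section

open scoped Matrix.Norms.L2Operator
open Filter Topology

namespace InvariantNorm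

variable {n : ℕ} {𝕜 : Type} [RCLike 𝕜]

attribute [local instance] realNormedAlgebra

/-! ### Chords of one-parameter groups -/

section

variable {G : Submonoid (Mat n 𝕜)} {ν : Seminorm 𝕜 (Mat n 𝕜)}

theorem tendsto_smul_exp_sub_one (h : Mat n 𝕜) :
    Tendsto (fun m : ℕ => ((m : ℝ) + 1) • (NormedSpace.exp (((m : ℝ) + 1)⁻¹ • h) - 1)) atTop
      (𝓝 h) := by
  have h1 : HasDerivAt (fun t : ℝ => NormedSpace.exp (t • h)) h 0 := by
    have := hasDerivAt_exp_smul_const (𝕂 := ℝ) h (0 : ℝ)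
    rwa [zero_smul, exp_zero', one_mul] at this
  have h2 := hasDerivAt_iff_tendsto_slope.1 h1
  have h3 : Tendsto (fun m : ℕ => ((m : ℝ) + 1)⁻¹) atTop (𝓝[≠] 0) := by
    refine tendsto_nhdsWithin_iff.2 ⟨?_, Eventually.of_forall fun m => ?_⟩
    · simpa using tendsto_one_div_add_atTop_nhds_zero_nat (𝕜 := ℝ)
    · exact inv_ne_zero (by positivity)
  refine (h2.comp h3).congr fun m => ?_
  simp only [Function.comp, slope, zero_smul, exp_zero', sub_zero, inv_inv, vsub_eq_sub]

theorem norm_pow_sub_one_le (hν : IsInvariantNorm G ν) {v : Mat n 𝕜} (hv : v ∈ G) (m : ℕ) :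
    ν (v ^ m - 1) ≤ m * ν (v - 1) := by
  induction m with
  | zero => simp
  | succ m ih =>
    have e : v ^ (m + 1) - 1 = v * (v ^ m - 1) + (v - 1) := by rw [pow_succ']; noncomm_ring
    rw [e]
    refine (map_add_le_add ν _ _).trans ?_
    rw [norm_mul_left hν hv]
    push_cast
    linarith

/-- The chord of `exp h` is at most `m + 1` times the chord of `exp (h / (m + 1))`, and these
multiples tend to `ν h`. -/
theorem norm_exp_sub_one_le (hG : IsAdmissible G) (hν : IsInvariantNorm G ν) {h : Mat n 𝕜}
    (hh : h ∈ skewAdjoint (Mat n 𝕜)) : ν (NormedSpace.exp h - 1) ≤ ν h := by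
  have h1 := ((continuous_seminorm ν).tendsto _).comp (tendsto_smul_exp_sub_one h)
  refine ge_of_tendsto' h1 fun m => ?_
  have h2 := norm_pow_sub_one_le hν (hG.exp_mem (smul_mem_skew hh ((m : ℝ) + 1)⁻¹)) (m + 1)
  rw [← Matrix.exp_nsmul, ← Nat.cast_smul_eq_nsmul ℝ, smul_smul] at h2
  push_cast at h2
  rw [mul_inv_cancel₀ (by positivity), one_smul] at h2
  simp only [Function.comp]
  rwa [seminorm_smul_real, abs_of_pos (by positivity)]

theorem exists_le_mul_norm_exp_sub_one (hν : IsInvariantNorm G ν) {ε : ℝ} (hε : 0 < ε) :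
    ∃ δ > 0, ∀ h : Mat n 𝕜, ‖h‖ < δ → ν h ≤ (1 + ε) * ν (NormedSpace.exp h - 1) := by
  obtain ⟨K, hK, hK1⟩ := exists_seminorm_le ν
  obtain ⟨K', hK', hK1'⟩ := exists_norm_le hν
  have h1 := (hasFDerivAt_exp_zero (𝕂 := ℝ) (𝔸 := Mat n 𝕜)).isLittleO.def
    -- After passing from `‖·‖` to `ν` at the cost of `K * K'`, the error is `ε / (1 + ε) * ν h`,
    -- and `1 - ε / (1 + ε) = 1 / (1 + ε)`.
    (c := ε / (1 + ε) / (K * K')) (by positivity)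
  obtain ⟨δ, hδ, hball⟩ := Metric.eventually_nhds_iff.1 h1
  refine ⟨δ, hδ, fun h hh => ?_⟩
  have h2 := hball (y := h) (by rwa [dist_zero_right])
  rw [exp_zero', sub_zero] at h2
  replace h2 : ‖NormedSpace.exp h - 1 - h‖ ≤ ε / (1 + ε) / (K * K') * ‖h‖ := h2
  have h3 : ν h ≤ ν (NormedSpace.exp h - 1) + ν (NormedSpace.exp h - 1 - h) := by
    simpa using map_sub_le_add ν (NormedSpace.exp h - 1) (NormedSpace.exp h - 1 - h)
  have h4 : ν (NormedSpace.exp h - 1 - h) ≤ ε / (1 + ε) * ν h := by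
    calc _ ≤ K * ‖NormedSpace.exp h - 1 - h‖ := hK1 _
      _ ≤ K * (ε / (1 + ε) / (K * K') * (K' * ν h)) := by
        gcongr
        exact h2.trans (by gcongr; exact hK1' h)
      _ = _ := by field_simp
  have h5 : ν h - ε / (1 + ε) * ν h = ν h / (1 + ε) := by field_simp; ring
  have h6 : ν h / (1 + ε) ≤ ν (NormedSpace.exp h - 1) := by linarith
  rwa [div_le_iff₀' (by positivity)] at h6

/-- Elements of the group near `1` have small logarithms, comparable to the chord. -/
theorem exists_log_of_near (hG : IsAdmissible G) (hν : IsInvariantNorm G ν) {ε : ℝ} (hε : 0 < ε) :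
    ∃ η > 0, ∀ w ∈ G, ‖w - 1‖ < η → ∃ h ∈ skewAdjoint (Mat n 𝕜), NormedSpace.exp h = w ∧
      ‖h‖ < Real.pi ∧ ‖h‖ ≤ Real.pi / 2 * ‖w - 1‖ ∧ ν h ≤ (1 + ε) * ν (w - 1) := by
  obtain ⟨δ, hδ, hδ1⟩ := exists_le_mul_norm_exp_sub_one hν hε
  have hpi := Real.pi_pos
  refine ⟨min 2 (2 * δ / Real.pi), by positivity, fun w hw hwn => ?_⟩
  obtain ⟨h, hh, rfl, hn⟩ := exists_log (hG.star_mul_self w hw)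
    (isUnit_one_add_of_norm_lt (hwn.trans_le (min_le_left _ _)))
  have h1 := norm_le_of_exp hh hn.le
  refine ⟨h, hh, rfl, hn, h1, hδ1 h (h1.trans_lt ?_)⟩
  have h2 := hwn.trans_le (min_le_right _ _)
  rw [lt_div_iff₀ hpi] at h2
  linarith

theorem norm_star_mul_sub_one_le (hG : IsAdmissible G) {p q : Mat n 𝕜} (hp : p ∈ G) :
    ‖star p * q - 1‖ ≤ ‖q - p‖ := by
  have e : star p * q - 1 = star p * (q - p) := by rw [mul_sub, hG.star_mul_self p hp]
  rw [e]
  refine (norm_mul_le _ _).trans ?_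
  have := norm_unitary_le (hG.star_mul_self p hp)
  rw [norm_star]
  nlinarith [norm_nonneg (q - p)]

theorem seminorm_star_mul_sub_one (hG : IsAdmissible G) (hν : IsInvariantNorm G ν) {p q : Mat n 𝕜}
    (hp : p ∈ G) : ν (star p * q - 1) = ν (q - p) := by
  rw [← norm_mul_left hν (hG.star_mem p hp) (q - p), mul_sub, hG.star_mul_self p hp]

/-! ### Length and intrinsic distance of one-parameter curves -/

/-- On a fine partition each quotient `γ (t k)* γ (t (k + 1))` is an exponential whose exponent has
`ν` at most `1 + ε` times the chord. The Lipschitz estimate for `arcNorm` adds these up, and `ε`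
tends to `0`. -/
theorem arcNorm_le_curveLength (hG : IsAdmissible G) (hν : IsInvariantNorm G ν) {γ : ℝ → Mat n 𝕜}
    {a b : ℝ} (hab : a ≤ b) (hγ : ContinuousOn γ (Set.Icc a b)) (hγG : Set.MapsTo γ (Set.Icc a b) G) :
    ENNReal.ofReal (arcNorm ν (star (γ a) * γ b)) ≤ curveLength ν γ a b := by
  have key : ∀ ε : ℝ, 0 < ε → ENNReal.ofReal (arcNorm ν (star (γ a) * γ b)) ≤
      ENNReal.ofReal (1 + ε) * curveLength ν γ a b := by
    intro ε hε
    obtain ⟨η, hη, hlog⟩ := exists_log_of_near hG hν hε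
    have huc := isCompact_Icc.uniformContinuousOn_of_continuous hγ
    obtain ⟨δ, hδ, hδ1⟩ := Metric.uniformContinuousOn_iff.1 huc η hη
    obtain ⟨m, hm⟩ := exists_nat_gt ((b - a) / δ)
    have hm0 : (0 : ℝ) < m := lt_of_le_of_lt (div_nonneg (sub_nonneg.2 hab) hδ.le) hm
    set t : ℕ → ℝ := fun k => a + k * ((b - a) / m) with ht
    have hstep : 0 ≤ (b - a) / m := div_nonneg (sub_nonneg.2 hab) hm0.le
    have htmono : ∀ k, t k ≤ t (k + 1) := fun k => by
      simp only [ht]; push_cast; nlinarith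
    have hta : ∀ k, a ≤ t k := fun k => by
      simp only [ht]; have : (0 : ℝ) ≤ k * ((b - a) / m) := by positivity
      linarith
    have htb : ∀ k ≤ m, t k ≤ b := fun k hk => by
      have h1 : (k : ℝ) * ((b - a) / m) ≤ m * ((b - a) / m) := by gcongr
      rw [mul_div_cancel₀ _ hm0.ne'] at h1
      simp only [ht]; linarith
    have ht0 : t 0 = a := by simp [ht]
    have htm : t m = b := by simp only [ht]; rw [mul_div_cancel₀ _ hm0.ne']; ring
    have haG : γ a ∈ G := hγG ⟨le_rfl, hab⟩
    have ind : ∀ k ≤ m, ENNReal.ofReal (arcNorm ν (star (γ a) * γ (t k))) ≤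
        ENNReal.ofReal (1 + ε) * curveLength ν γ a (t k) := by
      intro k
      induction k with
      | zero =>
        intro _
        rw [ht0, hG.star_mul_self _ haG, arcNorm_one hG hν, ENNReal.ofReal_zero]
        exact zero_le
      | succ k ih =>
        intro hk
        have hk1 : t k ∈ Set.Icc a b := ⟨hta k, htb k (by omega)⟩
        have hk2 : t (k + 1) ∈ Set.Icc a b := ⟨hta _, htb _ hk⟩
        have hG1 : γ (t k) ∈ G := hγG hk1
        have hG2 : γ (t (k + 1)) ∈ G := hγG hk2
        have hdist : ‖γ (t (k + 1)) - γ (t k)‖ < η := by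
          rw [← dist_eq_norm]
          refine hδ1 _ hk2 _ hk1 ?_
          have e : t (k + 1) - t k = (b - a) / m := by simp only [ht]; push_cast; ring
          rw [Real.dist_eq, e, abs_of_nonneg hstep, div_lt_comm₀ hm0 hδ]
          exact hm
        obtain ⟨h, hh, hexp, -, -, hle⟩ := hlog (star (γ (t k)) * γ (t (k + 1)))
          (mul_mem (hG.star_mem _ hG1) hG2)
          ((norm_star_mul_sub_one_le hG hG1).trans_lt hdist)
        rw [seminorm_star_mul_sub_one hG hν hG1] at hle
        have e : star (γ a) * γ (t (k + 1)) = star (γ a) * γ (t k) * NormedSpace.exp h := by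
          rw [hexp, mul_assoc, ← mul_assoc (γ (t k)), hG.mul_star_self hG1, one_mul]
        have h1 := arcNorm_mul_exp_le hG hν (mul_mem (hG.star_mem _ haG) hG1) hh
        rw [← e] at h1
        rw [← curveLength_add ν γ (hta k) (htmono k), mul_add]
        calc _ ≤ ENNReal.ofReal (arcNorm ν (star (γ a) * γ (t k)) +
              (1 + ε) * ν (γ (t (k + 1)) - γ (t k))) := ENNReal.ofReal_le_ofReal (by linarith)
          _ = ENNReal.ofReal (arcNorm ν (star (γ a) * γ (t k))) +
              ENNReal.ofReal (1 + ε) * ENNReal.ofReal (ν (γ (t (k + 1)) - γ (t k))) := by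
            rw [ENNReal.ofReal_add (arcNorm_nonneg _)
              (mul_nonneg (by positivity) (apply_nonneg ν _)), ENNReal.ofReal_mul (by positivity)]
          _ ≤ _ := by
            gcongr
            · exact ih (by omega)
            · exact ofReal_le_curveLength ν γ (Set.right_mem_Icc.2 (htmono k))
                (Set.left_mem_Icc.2 (htmono k))
    have := ind m le_rfl
    rwa [htm] at this
  have hlim : Tendsto (fun ε : ℝ => ENNReal.ofReal (1 + ε) * curveLength ν γ a b) (𝓝[>] 0)
      (𝓝 (ENNReal.ofReal (1 + 0) * curveLength ν γ a b)) := by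
    refine ENNReal.Tendsto.mul_const ?_ (Or.inl (by simp))
    refine (ENNReal.continuous_ofReal.tendsto _).comp ?_
    exact (tendsto_const_nhds.add tendsto_id).mono_left nhdsWithin_le_nhds
  rw [add_zero, ENNReal.ofReal_one, one_mul] at hlim
  exact ge_of_tendsto hlim (by filter_upwards [self_mem_nhdsWithin] with ε hε using key ε hε)

theorem arcNorm_le_intrinsicDist (hG : IsAdmissible G) (hν : IsInvariantNorm G ν) (u v : Mat n 𝕜) :
    ENNReal.ofReal (arcNorm ν (star u * v)) ≤ intrinsicDist G ν u v := by
  refine le_iInf₂ fun γ hγ => ?_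
  have := arcNorm_le_curveLength hG hν zero_le_one hγ.continuousOn hγ.mapsTo
  rwa [hγ.source, hγ.target] at this

theorem continuous_exp_smul (u x : Mat n 𝕜) :
    Continuous fun t : ℝ => u * NormedSpace.exp (t • x) :=
  continuous_iff_continuousAt.2 fun t =>
    ((hasDerivAt_exp_smul_const (𝕂 := ℝ) x t).const_mul u).continuousAt

theorem exp_smul_add (x : Mat n 𝕜) (r s : ℝ) :
    NormedSpace.exp ((r + s) • x) = NormedSpace.exp (r • x) * NormedSpace.exp (s • x) := by
  rw [add_smul, exp_add_of_comm (((Commute.refl x).smul_left r).smul_right s)]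

theorem isCurveFromTo_exp (hG : IsAdmissible G) {u x : Mat n 𝕜} (hu : u ∈ G)
    (hx : x ∈ skewAdjoint (Mat n 𝕜)) :
    IsCurveFromTo G (fun t : ℝ => u * NormedSpace.exp (t • x)) 0 1 u (u * NormedSpace.exp x) where
  continuousOn := (continuous_exp_smul u x).continuousOn
  mapsTo _ _ := mul_mem hu (hG.exp_mem (smul_mem_skew hx _))
  source := by simp only [zero_smul, exp_zero', mul_one]
  target := by simp only [one_smul]

theorem curveLength_exp_le (hG : IsAdmissible G) (hν : IsInvariantNorm G ν) {u x : Mat n 𝕜}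
    (hu : u ∈ G) (hx : x ∈ skewAdjoint (Mat n 𝕜)) (r s : ℝ) :
    curveLength ν (fun t : ℝ => u * NormedSpace.exp (t • x)) r s ≤
      ENNReal.ofReal ((s - r) * ν x) := by
  refine curveLength_le_of_lipschitz ν (fun r s hrs => ?_) (apply_nonneg ν x)
  have e : u * NormedSpace.exp (s • x) - u * NormedSpace.exp (r • x) =
      u * NormedSpace.exp (r • x) * (NormedSpace.exp ((s - r) • x) - 1) := by
    rw [mul_sub, mul_one, mul_assoc, ← exp_smul_add, add_sub_cancel]
  rw [e, norm_mul_left hν (mul_mem hu (hG.exp_mem (smul_mem_skew hx r)))]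
  refine (norm_exp_sub_one_le hG hν (smul_mem_skew hx _)).trans ?_
  rw [seminorm_smul_real, abs_of_nonneg (sub_nonneg.2 hrs)]

theorem intrinsicDist_exp_le (hG : IsAdmissible G) (hν : IsInvariantNorm G ν) {u x : Mat n 𝕜}
    (hu : u ∈ G) (hx : x ∈ skewAdjoint (Mat n 𝕜)) :
    intrinsicDist G ν u (u * NormedSpace.exp x) ≤ ENNReal.ofReal (ν x) := by
  refine (iInf₂_le (f := fun γ (_ : IsCurveFromTo G γ 0 1 u (u * NormedSpace.exp x)) =>
    curveLength ν γ 0 1) _ (isCurveFromTo_exp hG hu hx)).trans ?_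
  simpa using curveLength_exp_le hG hν hu hx 0 1

theorem star_mul_mul_cancel (hG : IsAdmissible G) {u : Mat n 𝕜} (hu : u ∈ G) (w : Mat n 𝕜) :
    star u * (u * w) = w := by
  rw [← mul_assoc, hG.star_mul_self u hu, one_mul]

theorem mul_star_mul_cancel (hG : IsAdmissible G) {u : Mat n 𝕜} (hu : u ∈ G) (w : Mat n 𝕜) :
    u * (star u * w) = w := by
  rw [← mul_assoc, hG.mul_star_self hu, one_mul]

theorem intrinsicDist_exp (hG : IsAdmissible G) (hν : IsInvariantNorm G ν) {u x : Mat n 𝕜}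
    (hu : u ∈ G) (hx : x ∈ skewAdjoint (Mat n 𝕜)) (h : ‖x‖ ≤ Real.pi) :
    intrinsicDist G ν u (u * NormedSpace.exp x) = ENNReal.ofReal (ν x) := by
  refine le_antisymm (intrinsicDist_exp_le hG hν hu hx) ?_
  have := arcNorm_le_intrinsicDist hG hν u (u * NormedSpace.exp x)
  rwa [star_mul_mul_cancel hG hu, arcNorm_exp hG hν hx h] at this

theorem star_mul_exp_mul_exp (hG : IsAdmissible G) {u x : Mat n 𝕜} (hu : u ∈ G)
    (hx : x ∈ skewAdjoint (Mat n 𝕜)) (r s : ℝ) :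
    star (u * NormedSpace.exp (r • x)) * (u * NormedSpace.exp (s • x)) =
      NormedSpace.exp ((s - r) • x) := by
  rw [star_mul, mul_assoc, star_mul_mul_cancel hG hu, star_exp (smul_mem_skew hx r), ← neg_smul,
    ← exp_smul_add]
  congr 2; ring

theorem curveLength_exp (hG : IsAdmissible G) (hν : IsInvariantNorm G ν) {u x : Mat n 𝕜}
    (hu : u ∈ G) (hx : x ∈ skewAdjoint (Mat n 𝕜)) {r s : ℝ} (hrs : r ≤ s)
    (h : ‖(s - r) • x‖ ≤ Real.pi) :
    curveLength ν (fun t : ℝ => u * NormedSpace.exp (t • x)) r s =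
      ENNReal.ofReal ((s - r) * ν x) := by
  refine le_antisymm (curveLength_exp_le hG hν hu hx r s) ?_
  have := arcNorm_le_curveLength hG hν hrs (continuous_exp_smul u x).continuousOn
    (fun t _ => mul_mem hu (hG.exp_mem (smul_mem_skew hx t)))
  rwa [star_mul_exp_mul_exp hG hu hx, arcNorm_exp hG hν (smul_mem_skew hx _) h,
    seminorm_smul_real, abs_of_nonneg (sub_nonneg.2 hrs)] at this

theorem isGeodesicOn_exp (hG : IsAdmissible G) (hν : IsInvariantNorm G ν) {u x : Mat n 𝕜}
    (hu : u ∈ G) (hx : x ∈ skewAdjoint (Mat n 𝕜)) :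
    IsGeodesicOn G ν (fun t : ℝ => u * NormedSpace.exp (t • x)) Set.univ where
  continuousOn := (continuous_exp_smul u x).continuousOn
  mapsTo _ _ := mul_mem hu (hG.exp_mem (smul_mem_skew hx _))
  locally_shortest t _ := by
    have hpi := Real.pi_pos
    -- Two parameters within this radius of `t` differ by at most `π / (‖x‖ + 1)`, so that `‖(s - r)
    -- • x‖ ≤ π`; the `+ 1` covers `x = 0`.
    refine ⟨Real.pi / (2 * (‖x‖ + 1)), by positivity, fun r _ s _ hr hs hrs => ?_⟩
    have hrs' : ‖(s - r) • x‖ ≤ Real.pi := by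
      rw [norm_smul, Real.norm_eq_abs]
      have h1 : |s - r| ≤ Real.pi / (‖x‖ + 1) := by
        have h2 := abs_sub_le s t r
        rw [abs_sub_comm t r] at h2
        have h3 : Real.pi / (‖x‖ + 1) =
          Real.pi / (2 * (‖x‖ + 1)) + Real.pi / (2 * (‖x‖ + 1)) := by field_simp; ring
        linarith
      calc |s - r| * ‖x‖ ≤ Real.pi / (‖x‖ + 1) * (‖x‖ + 1) := by
            gcongr; linarith
        _ = Real.pi := by field_simp
    have e : u * NormedSpace.exp (s • x) =
        u * NormedSpace.exp (r • x) * NormedSpace.exp ((s - r) • x) := by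
      rw [mul_assoc, ← exp_smul_add, add_sub_cancel]
    rw [curveLength_exp hG hν hu hx hrs hrs', e, intrinsicDist_exp hG hν
      (mul_mem hu (hG.exp_mem (smul_mem_skew hx r))) (smul_mem_skew hx _) hrs', seminorm_smul_real,
      abs_of_nonneg (sub_nonneg.2 hrs)]
  nonstop := by
    rcases eq_or_ne x 0 with rfl | hx0
    · left; intro r _ s _; simp only [smul_zero]
    · right
      intro r _ s _ hrs
      have hpi := Real.pi_pos
      have hxn := norm_pos_iff.2 hx0
      -- With `0 < d ‖x‖ ≤ π < 2 π`, `exp (d x)` cannot be `1`.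
      set d := min (s - r) (Real.pi / ‖x‖) with hd
      have hd0 : 0 < d := lt_min (sub_pos.2 hrs) (by positivity)
      refine ⟨r + d, ⟨by linarith, by linarith [min_le_left (s - r) (Real.pi / ‖x‖)]⟩, fun h => ?_⟩
      have h1 := star_mul_exp_mul_exp hG hu hx r (r + d)
      replace h : u * NormedSpace.exp ((r + d) • x) = u * NormedSpace.exp (r • x) := h
      rw [h, hG.star_mul_self _ (mul_mem hu (hG.exp_mem (smul_mem_skew hx _))),
        add_sub_cancel_left] at h1
      have h2 : ‖d • x‖ < 2 * Real.pi := by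
        rw [norm_smul, Real.norm_of_nonneg hd0.le]
        have h3 : d * ‖x‖ ≤ Real.pi / ‖x‖ * ‖x‖ := by gcongr; exact min_le_right _ _
        rw [div_mul_cancel₀ _ hxn.ne'] at h3
        linarith
      have h4 := eq_zero_of_exp_eq_one (smul_mem_skew hx d) h2 h1.symm
      rcases smul_eq_zero.1 h4 with h5 | h5
      · exact hd0.ne' h5
      · exact hx0 h5

end

end InvariantNorm

end

section

open scoped Matrix.Norms.L2Operator
open Filter Topology

namespace InvariantNorm

variable {n : ℕ} {𝕜 : Type} [RCLike 𝕜]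

attribute [local instance] realNormedAlgebra

section

variable {G : Submonoid (Mat n 𝕜)} {ν : Seminorm 𝕜 (Mat n 𝕜)}

/-! ### Strict convexity and uniqueness of shortest curves -/

theorem seminorm_pos (hν : IsInvariantNorm G ν) {x : Mat n 𝕜} (hx : x ≠ 0) : 0 < ν x :=
  lt_of_le_of_ne (apply_nonneg ν x) fun h => hx (hν.eq_zero x h.symm)

/-- Let `a` and `b` be the normalizations of `y` and `z`. Taking a small multiple of `s a + t b` out
of `y + z` leaves a nonnegative combination of `a` and `b`, so additivity of `ν` on `y, z` forces `ν
(s a + t b) = 1`. The whole segment would lie on the sphere, unless `a = b`. -/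
theorem smul_eq_smul_of_strictlyConvex (hs : IsStrictlyConvexNorm ν) {y z : Mat n 𝕜}
    (hy : 0 < ν y) (hz : 0 < ν z) (h : ν (y + z) = ν y + ν z) : ν z • y = ν y • z := by
  by_contra hne
  have hab : (ν y)⁻¹ • y ≠ (ν z)⁻¹ • z := fun h1 => hne <| by
    have h2 := congrArg (fun w => (ν y * ν z) • w) h1
    simp only [smul_smul] at h2
    rw [mul_right_comm, mul_inv_cancel₀ hy.ne', one_mul, mul_assoc, mul_inv_cancel₀ hz.ne',
      mul_one] at h2
    exact h2
  refine hs _ _ hab ?_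
  rintro _ ⟨s, t, hs0, ht0, hst, rfl⟩
  set a := (ν y)⁻¹ • y with ha
  set b := (ν z)⁻¹ • z with hb
  have hya : y = ν y • a := by rw [ha, smul_smul, mul_inv_cancel₀ hy.ne', one_smul]
  have hzb : z = ν z • b := by rw [hb, smul_smul, mul_inv_cancel₀ hz.ne', one_smul]
  have hνa : ν a = 1 := by
    rw [ha, seminorm_smul_real, abs_of_pos (inv_pos.2 hy), inv_mul_cancel₀ hy.ne']
  have hνb : ν b = 1 := by
    rw [hb, seminorm_smul_real, abs_of_pos (inv_pos.2 hz), inv_mul_cancel₀ hz.ne']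
  clear_value a b
  refine le_antisymm ?_ ?_
  · refine (map_add_le_add ν _ _).trans ?_
    rw [seminorm_smul_real, seminorm_smul_real, hνa, hνb, abs_of_nonneg hs0, abs_of_nonneg ht0]
    linarith
  · set c := min (ν y) (ν z) with hc
    have hc0 : 0 < c := lt_min hy hz
    have h1 : 0 ≤ ν y - c * s := by nlinarith [min_le_left (ν y) (ν z)]
    have h2 : 0 ≤ ν z - c * t := by nlinarith [min_le_right (ν y) (ν z)]
    have e : y + z = c • (s • a + t • b) + ((ν y - c * s) • a + (ν z - c * t) • b) := by
      conv_lhs => rw [hya, hzb]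
      simp only [sub_smul, smul_add, smul_smul]
      abel
    have h3 := map_add_le_add ν (c • (s • a + t • b)) ((ν y - c * s) • a + (ν z - c * t) • b)
    have h4 := map_add_le_add ν ((ν y - c * s) • a) ((ν z - c * t) • b)
    rw [← e, h, seminorm_smul_real, abs_of_pos hc0] at h3
    rw [seminorm_smul_real, seminorm_smul_real, hνa, hνb, abs_of_nonneg h1, abs_of_nonneg h2] at h4
    have h5 : c * (s + t) ≤ c * ν (s • a + t • b) := by nlinarith
    rw [hst] at h5
    exact le_of_mul_le_mul_left h5 hc0

theorem arcNorm_exp_le (hG : IsAdmissible G) (hν : IsInvariantNorm G ν) {x : Mat n 𝕜}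
    (hx : x ∈ skewAdjoint (Mat n 𝕜)) : arcNorm ν (NormedSpace.exp x) ≤ ν x := by
  have := arcNorm_mul_exp_le hG hν (one_mem G) hx
  rwa [one_mul, arcNorm_one hG hν, zero_add] at this

/-- Equality in the triangle inequality for `arcNorm` forces equality for the norm. -/
theorem norm_add_eq_of_le_arcNorm (hG : IsAdmissible G) (hν : IsInvariantNorm G ν) {y z : Mat n 𝕜}
    (hy : y ∈ skewAdjoint (Mat n 𝕜)) (hz : z ∈ skewAdjoint (Mat n 𝕜))
    (h : ν y + ν z ≤ arcNorm ν (NormedSpace.exp y * NormedSpace.exp z)) :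
    ν (y + z) = ν y + ν z := by
  refine le_antisymm (map_add_le_add ν y z) ?_
  -- To first order `exp (ε y) * exp (ε z)` is `exp (ε (y + z))`: the quotient `f ε` is `1 + o(ε)`.
  set f : ℝ → Mat n 𝕜 := fun ε => NormedSpace.exp (ε • -(y + z)) *
    (NormedSpace.exp (ε • y) * NormedSpace.exp (ε • z)) with hf
  have hd : ∀ x : Mat n 𝕜, HasDerivAt (fun t : ℝ => NormedSpace.exp (t • x)) x 0 := fun x => by
    have := hasDerivAt_exp_smul_const (𝕂 := ℝ) x (0 : ℝ)
    rwa [zero_smul, exp_zero', one_mul] at this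
  have hfd : HasDerivAt f 0 0 := by
    have := (hd (-(y + z))).mul ((hd y).mul (hd z))
    simp only [zero_smul, exp_zero', mul_one, one_mul, Pi.mul_apply, neg_add_cancel] at this
    exact this
  have hf0 : f 0 = 1 := by simp only [hf, zero_smul, exp_zero', mul_one]
  have hfG : ∀ ε, f ε ∈ G := fun ε => mul_mem (hG.exp_mem (smul_mem_skew (neg_mem (add_mem hy hz)) ε))
    (mul_mem (hG.exp_mem (smul_mem_skew hy ε)) (hG.exp_mem (smul_mem_skew hz ε)))
  obtain ⟨η, hη, hlog⟩ := exists_log_of_near hG hν one_pos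
  have hev : ∀ᶠ ε in 𝓝[>] (0 : ℝ), ‖f ε - 1‖ < η := by
    have h1 : ∀ᶠ ε in 𝓝 (0 : ℝ), f ε ∈ Metric.ball (f 0) η :=
      hfd.continuousAt.eventually (Metric.ball_mem_nhds _ hη)
    refine (h1.filter_mono nhdsWithin_le_nhds).mono fun ε hε => ?_
    rwa [hf0, mem_ball_iff_norm] at hε
  have hlim : Tendsto (fun ε => ν (y + z) + 2 * ν (slope f 0 ε)) (𝓝[>] 0)
      (𝓝 (ν (y + z) + 2 * ν 0)) := by
    refine tendsto_const_nhds.add (Tendsto.const_mul 2 (((continuous_seminorm ν).tendsto _).comp ?_))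
    exact (hasDerivAt_iff_tendsto_slope.1 hfd).mono_left
      (nhdsWithin_mono 0 (fun z (hz : 0 < z) => ne_of_gt hz) : 𝓝[>] (0 : ℝ) ≤ _)
  rw [map_zero, mul_zero, add_zero] at hlim
  refine ge_of_tendsto hlim ?_
  have hlt1 : ∀ᶠ ε in 𝓝[>] (0 : ℝ), ε < 1 := by
    filter_upwards [Ioo_mem_nhdsGT (zero_lt_one (α := ℝ))] with ε hε using hε.2
  filter_upwards [hev, hlt1, self_mem_nhdsWithin] with ε hε1 hε2 (hε0 : 0 < ε)
  obtain ⟨k, hk, hfk, -, -, hkle⟩ := hlog (f ε) (hfG ε) hε1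
  set w := NormedSpace.exp (ε • y) * NormedSpace.exp (ε • z) with hw
  have hwG : w ∈ G :=
    mul_mem (hG.exp_mem (smul_mem_skew hy ε)) (hG.exp_mem (smul_mem_skew hz ε))
  have h1 : arcNorm ν w ≤ ε * ν (y + z) + 2 * ν (f ε - 1) := by
    have e : w = NormedSpace.exp (ε • (y + z)) * NormedSpace.exp k := by
      rw [hfk, hf]
      simp only
      rw [smul_neg, ← mul_assoc, exp_mul_exp_neg, one_mul, ← hw]
    have h2 := arcNorm_mul_exp_le hG hν (hG.exp_mem (smul_mem_skew (add_mem hy hz) ε)) hk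
    have h3 := arcNorm_exp_le hG hν (smul_mem_skew (add_mem hy hz) ε)
    rw [seminorm_smul_real, abs_of_pos hε0] at h3
    rw [← e] at h2
    linarith
  -- Only a corner of size `ε` is cut: the outer factors `exp ((1 - ε) y)` and `exp ((1 - ε) z)`
  -- contribute at most `(1 - ε)(ν y + ν z)`, so the corner `w` must account for `ε (ν y + ν z)`.
  have h4 : arcNorm ν (NormedSpace.exp y * NormedSpace.exp z) ≤
      (1 - ε) * ν y + arcNorm ν w + (1 - ε) * ν z := by
    have e : NormedSpace.exp y * NormedSpace.exp z =
        NormedSpace.exp ((1 - ε) • y) * w * NormedSpace.exp ((1 - ε) • z) := by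
      have e1 : NormedSpace.exp y = NormedSpace.exp ((1 - ε) • y) * NormedSpace.exp (ε • y) := by
        rw [← exp_smul_add, sub_add_cancel, one_smul]
      have e2 : NormedSpace.exp z = NormedSpace.exp (ε • z) * NormedSpace.exp ((1 - ε) • z) := by
        rw [← exp_smul_add, add_sub_cancel, one_smul]
      rw [e1, e2, hw]
      noncomm_ring
    have h5 := arcNorm_mul_exp_le hG hν
      (mul_mem (hG.exp_mem (smul_mem_skew hy (1 - ε))) hwG) (smul_mem_skew hz (1 - ε))
    have h6 := arcNorm_exp_mul_le hG hν hwG (smul_mem_skew hy (1 - ε))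
    rw [seminorm_smul_real, abs_of_nonneg (by linarith)] at h5 h6
    rw [e]
    linarith
  have h7 : ν (slope f 0 ε) = ε⁻¹ * ν (f ε - 1) := by
    rw [slope, sub_zero, vsub_eq_sub, hf0, seminorm_smul_real, abs_of_pos (inv_pos.2 hε0)]
  have h8 : ε * (ν y + ν z) ≤ ε * (ν (y + z) + 2 * ν (slope f 0 ε)) := by
    have : ε * (ν (y + z) + 2 * ν (slope f 0 ε)) = ε * ν (y + z) + 2 * ν (f ε - 1) := by
      rw [h7]; field_simp
    rw [this]
    linarith
  exact le_of_mul_le_mul_left h8 hε0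

/-- Near `1`, only the points of the one-parameter group lie between `1` and `exp x`. -/
theorem exists_eq_exp_smul_of_near (hG : IsAdmissible G) (hν : IsInvariantNorm G ν)
    (hs : IsStrictlyConvexNorm ν) {x : Mat n 𝕜} (hx : x ∈ skewAdjoint (Mat n 𝕜))
    (hxπ : ‖x‖ < Real.pi) :
    ∃ η > 0, ∀ w ∈ G, ‖w - 1‖ < η →
      arcNorm ν w + arcNorm ν (star w * NormedSpace.exp x) ≤ ν x →
      ∃ c ∈ Set.Icc (0 : ℝ) 1, w = NormedSpace.exp (c • x) := by
  have hpi := Real.pi_pos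
  obtain ⟨η, hη, hlog⟩ := exists_log_of_near hG hν one_pos
  have hopen : IsOpen {q : Mat n 𝕜 | IsUnit (1 + q)} :=
    Units.isOpen.preimage (continuous_const.add continuous_id)
  obtain ⟨δ, hδ, hball⟩ := Metric.isOpen_iff.1 hopen _ (isUnit_one_add_exp hx hxπ)
  -- The three bounds provide the logarithm `y` of `w`, the logarithm `z` of `w* exp x` (by keeping
  -- `1 + w* exp x` invertible), and `‖y‖ ≤ π - ‖x‖`. The last gives `‖y + z - x‖ < 2 π`, so that
  -- `exp (y + z - x) = 1` implies `y + z = x`.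
  refine ⟨min η (min δ (2 / Real.pi * (Real.pi - ‖x‖))),
    lt_min hη (lt_min hδ (mul_pos (by positivity) (by linarith))), fun w hw hwn hle => ?_⟩
  obtain ⟨y, hy, hyw, hyπ, hyn, -⟩ := hlog w hw (hwn.trans_le (min_le_left _ _))
  have hwn2 := hwn.trans_le (min_le_right _ _)
  have hw' : star w * NormedSpace.exp x ∈ G := mul_mem (hG.star_mem w hw) (hG.exp_mem hx)
  have hunit : IsUnit (1 + star w * NormedSpace.exp x) := by
    refine hball ?_
    rw [mem_ball_iff_norm]
    have e : star w * NormedSpace.exp x - NormedSpace.exp x = star (w - 1) * NormedSpace.exp x := by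
      rw [star_sub, star_one, sub_mul, one_mul]
    rw [e]
    refine (norm_mul_le _ _).trans_lt ?_
    have h1 := norm_unitary_le (star_exp_mul_exp hx)
    have h2 := hwn2.trans_le (min_le_left _ _)
    rw [norm_star]
    nlinarith [norm_nonneg (w - 1)]
  obtain ⟨z, hz, hzw, hzπ⟩ := exists_log (hG.star_mul_self _ hw') hunit
  have hyz : NormedSpace.exp y * NormedSpace.exp z = NormedSpace.exp x := by
    rw [hyw, hzw, mul_star_mul_cancel hG hw]
  have hsum : ν (y + z) = ν y + ν z := by
    refine norm_add_eq_of_le_arcNorm hG hν hy hz ?_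
    rw [← hzw, ← hyw, arcNorm_exp hG hν hy hyπ.le, arcNorm_exp hG hν hz hzπ.le] at hle
    rwa [hyz, arcNorm_exp hG hν hx hxπ.le]
  rcases eq_or_ne y 0 with rfl | hy0
  · exact ⟨0, by simp, by rw [zero_smul, hyw]⟩
  rcases eq_or_ne z 0 with rfl | hz0
  · refine ⟨1, by simp, ?_⟩
    rw [one_smul, ← hyz, exp_zero', mul_one, hyw]
  have hνy := seminorm_pos hν hy0
  have hνz := seminorm_pos hν hz0
  have hpar := smul_eq_smul_of_strictlyConvex hs hνy hνz hsum
  have hyz' : y = (ν y / ν z) • z := by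
    rw [div_eq_inv_mul, ← smul_smul, ← hpar, smul_smul, inv_mul_cancel₀ hνz.ne', one_smul]
  have hcomm : Commute y z := by
    rw [hyz']; exact (Commute.refl z).smul_left _
  have hexp : NormedSpace.exp (y + z) = NormedSpace.exp x := by rw [exp_add_of_comm hcomm, hyz]
  have hcomm2 : Commute (y + z) x := by
    refine commute_of_commute_exp hx hxπ ?_
    rw [← hexp]
    exact (Commute.refl (y + z)).exp_right
  have hx_eq : y + z - x = 0 := by
    refine eq_zero_of_exp_eq_one (sub_mem (add_mem hy hz) hx) ?_ ?_
    · have h1 : ‖y‖ ≤ Real.pi - ‖x‖ := by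
        refine hyn.trans ?_
        have h2 := hwn2.trans_le (min_le_right _ _)
        calc Real.pi / 2 * ‖w - 1‖ ≤ Real.pi / 2 * (2 / Real.pi * (Real.pi - ‖x‖)) := by gcongr
          _ = _ := by field_simp
      have h3 := norm_sub_le (y + z) x
      have h4 := norm_add_le y z
      linarith
    · rw [sub_eq_add_neg, exp_add_of_comm hcomm2.neg_right, hexp, exp_mul_exp_neg]
  rw [sub_eq_zero] at hx_eq
  refine ⟨ν y / (ν y + ν z), ⟨by positivity, ?_⟩, ?_⟩
  · rw [div_le_one (by positivity)]; linarith
  · rw [← hyw, ← hx_eq]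
    congr 1
    rw [div_eq_inv_mul, ← smul_smul, smul_add, ← hpar, ← add_smul, smul_smul,
      inv_mul_cancel₀ (by positivity), one_smul]

/-- Near `p` in `G` the Lipschitz estimates give `|arcNorm ν q - arcNorm ν p| ≤ 2 ν (q - p)`;
continuity of the functional calculus in the matrix is not needed. -/
theorem continuousOn_arcNorm (hG : IsAdmissible G) (hν : IsInvariantNorm G ν) :
    ContinuousOn (arcNorm ν) (G : Set (Mat n 𝕜)) := by
  intro p hp
  obtain ⟨η, hη, hlog⟩ := exists_log_of_near hG hν one_pos
  refine tendsto_iff_dist_tendsto_zero.2 ?_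
  have hlim : Tendsto (fun q => 2 * ν (q - p)) (𝓝[G] p) (𝓝 0) := by
    have : Continuous fun q => 2 * ν (q - p) :=
      continuous_const.mul ((continuous_seminorm ν).comp (continuous_id.sub continuous_const))
    have h := this.tendsto p
    rw [sub_self, map_zero, mul_zero] at h
    exact h.mono_left nhdsWithin_le_nhds
  refine squeeze_zero' (Eventually.of_forall fun _ => dist_nonneg) ?_ hlim
  filter_upwards [self_mem_nhdsWithin, mem_nhdsWithin_of_mem_nhds (Metric.ball_mem_nhds p hη)]
    with q (hq : q ∈ G) hqp
  rw [mem_ball_iff_norm] at hqp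
  obtain ⟨h, hh, hexp, -, -, hle⟩ := hlog (star p * q) (mul_mem (hG.star_mem p hp) hq)
    ((norm_star_mul_sub_one_le hG hp).trans_lt hqp)
  rw [seminorm_star_mul_sub_one hG hν hp] at hle
  have e : q = p * NormedSpace.exp h := by rw [hexp, mul_star_mul_cancel hG hp]
  have h1 := arcNorm_mul_exp_le hG hν hp hh
  have h2 := arcNorm_le_mul_exp hG hν hp hh
  rw [← e] at h1 h2
  rw [Real.dist_eq, abs_le]
  constructor <;> linarith

/-- A curve which is not longer than the segment of a one-parameter group with the same endpoints is
a reparametrization of this segment. -/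
theorem exists_reparametrization (hG : IsAdmissible G) (hν : IsInvariantNorm G ν)
    (hs : IsStrictlyConvexNorm ν) {u v x : Mat n 𝕜} (hu : u ∈ G) (hx : x ∈ skewAdjoint (Mat n 𝕜))
    (hxπ : ‖x‖ < Real.pi) (hv : v = u * NormedSpace.exp x) {γ : ℝ → Mat n 𝕜} {a b : ℝ} (hab : a < b)
    (hγ : IsCurveFromTo G γ a b u v) (hlen : curveLength ν γ a b ≤ ENNReal.ofReal (ν x)) :
    ∃ φ : ℝ → ℝ, ContinuousOn φ (Set.Icc a b) ∧ MonotoneOn φ (Set.Icc a b) ∧ φ a = 0 ∧ φ b = 1 ∧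
      (∀ t ∈ Set.Icc a b, γ t = u * NormedSpace.exp (φ t • x)) ∧
      ∀ r ∈ Set.Icc a b, ∀ s ∈ Set.Icc a b, r ≤ s →
        curveLength ν γ r s = ENNReal.ofReal ((φ s - φ r) * ν x) := by
  have hfin : ∀ r s, a ≤ r → s ≤ b → curveLength ν γ r s ≠ ∞ := fun r s hr hs' =>
    ((curveLength_mono ν γ hr hs').trans hlen).trans_lt ENNReal.ofReal_lt_top |>.ne
  have hlen' : (curveLength ν γ a b).toReal ≤ ν x := ENNReal.toReal_le_of_le_ofReal
    (apply_nonneg ν x) hlen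
  have hadd : ∀ r s t, a ≤ r → r ≤ s → s ≤ t → t ≤ b →
      (curveLength ν γ r s).toReal + (curveLength ν γ s t).toReal =
        (curveLength ν γ r t).toReal := fun r s t h1 h2 h3 h4 => by
    rw [← curveLength_add ν γ h2 h3, ENNReal.toReal_add (hfin r s h1 (h3.trans h4))
      (hfin s t (h1.trans h2) h4)]
  have hlow : ∀ r s, a ≤ r → r ≤ s → s ≤ b →
      arcNorm ν (star (γ r) * γ s) ≤ (curveLength ν γ r s).toReal := fun r s h1 h2 h3 => by
    have hsub := Set.Icc_subset_Icc h1 h3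
    exact (ENNReal.ofReal_le_iff_le_toReal (hfin r s h1 h3)).1
      (arcNorm_le_curveLength hG hν h2 (hγ.continuousOn.mono hsub) (hγ.mapsTo.mono_left hsub))
  have harc : ∀ c : ℝ, |c| ≤ 1 → arcNorm ν (NormedSpace.exp (c • x)) = |c| * ν x := fun c hc => by
    rw [arcNorm_exp hG hν (smul_mem_skew hx c), seminorm_smul_real]
    rw [norm_smul, Real.norm_eq_abs]
    nlinarith [norm_nonneg x]
  have hmem : ∀ t ∈ Set.Icc a b, ∃ c ∈ Set.Icc (0 : ℝ) 1, γ t = u * NormedSpace.exp (c • x) := by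
    -- Continuous induction on `[a, b]`: the set of times at which `γ` lies on the segment is
    -- closed, contains `a`, and contains a right neighbourhood of each of its points below `b`.
    set T := {t | ∃ c ∈ Set.Icc (0 : ℝ) 1, γ t = u * NormedSpace.exp (c • x)} with hT
    refine IsClosed.Icc_subset_of_forall_mem_nhdsWithin (s := T) ?_ ?_ ?_
    · have hK : IsClosed ((fun c : ℝ => u * NormedSpace.exp (c • x)) '' Set.Icc 0 1) :=
        (isCompact_Icc.image (continuous_exp_smul u x)).isClosed
      have := hγ.continuousOn.preimage_isClosed_of_isClosed isClosed_Icc hK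
      convert this using 1
      ext t
      simp only [hT, Set.mem_inter_iff, Set.mem_ofPred_eq, Set.mem_preimage, Set.mem_image]
      constructor
      · rintro ⟨⟨c, hc, h⟩, ht⟩; exact ⟨ht, c, hc, h.symm⟩
      · rintro ⟨ht, c, hc, h⟩; exact ⟨⟨c, hc, h.symm⟩, ht⟩
    · exact ⟨0, by simp, by rw [zero_smul, exp_zero', mul_one, hγ.source]⟩
    · rintro t ⟨⟨c, hc, hct⟩, hat, htb⟩
      have hx' := smul_mem_skew hx (1 - c)
      have hx'π : ‖(1 - c) • x‖ < Real.pi := by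
        rw [norm_smul, Real.norm_of_nonneg (by linarith [hc.2])]
        nlinarith [norm_nonneg x, hc.1]
      obtain ⟨η, hη, hstep⟩ := exists_eq_exp_smul_of_near hG hν hs hx' hx'π
      have htG : γ t ∈ G := hγ.mapsTo ⟨hat, htb.le⟩
      have hcont : Tendsto γ (𝓝[>] t) (𝓝 (γ t)) := by
        refine (hγ.continuousOn t ⟨hat, htb.le⟩).mono_left ?_
        rw [← nhdsWithin_Ioc_eq_nhdsGT htb]
        exact nhdsWithin_mono _ fun s hs' => ⟨hat.trans hs'.1.le, hs'.2⟩
      filter_upwards [hcont.eventually (Metric.ball_mem_nhds _ hη), Ioc_mem_nhdsGT htb]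
        with s hsη hsI
      rw [dist_eq_norm] at hsη
      have hsG : γ s ∈ G := hγ.mapsTo ⟨hat.trans hsI.1.le, hsI.2⟩
      -- Up to time `t` the curve has used length at least `c * ν x`, so at most `(1 - c) * ν x`
      -- remains from `t` to `b`.
      have hbetween : arcNorm ν (star (γ t) * γ s) +
          arcNorm ν (star (star (γ t) * γ s) * NormedSpace.exp ((1 - c) • x)) ≤
            ν ((1 - c) • x) := by
        have h1 := hlow t s hat hsI.1.le hsI.2
        have h2 := hlow s b (hat.trans hsI.1.le) hsI.2 le_rfl
        have h3 := hlow a t le_rfl hat htb.le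
        have h4 := hadd a t b le_rfl hat htb.le le_rfl
        have h5 := hadd t s b hat hsI.1.le hsI.2 le_rfl
        rw [hγ.source, hct, star_mul_mul_cancel hG hu, harc c (abs_le.2 ⟨by linarith [hc.1], hc.2⟩),
          abs_of_nonneg hc.1] at h3
        have e : star (star (γ t) * γ s) * NormedSpace.exp ((1 - c) • x) = star (γ s) * γ b := by
          rw [star_mul, star_star, mul_assoc, hct, mul_assoc u, ← exp_smul_add, add_sub_cancel,
            one_smul, hγ.target, hv]
        rw [e, seminorm_smul_real, abs_of_nonneg (by linarith [hc.2])]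
        linarith
      obtain ⟨d, hd, hwd⟩ := hstep (star (γ t) * γ s) (mul_mem (hG.star_mem _ htG) hsG)
        ((norm_star_mul_sub_one_le hG htG).trans_lt hsη) hbetween
      refine ⟨c + d * (1 - c), ⟨?_, ?_⟩, ?_⟩
      · nlinarith [hc.1, hc.2, hd.1]
      · nlinarith [hc.1, hc.2, hd.2]
      · rw [exp_smul_add, ← mul_assoc, ← hct, ← smul_smul, ← hwd, mul_star_mul_cancel hG htG]
  -- The lower bounds for the lengths on `[a, r]`, `[r, s]`, `[s, b]` add up to at least `ν x`,
  -- while the total length is at most `ν x`. Hence all are equalities, and `|φ s - φ r|` cannot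
  -- exceed `φ s - φ r` when `ν x > 0`.
  have hlen_eq : ∀ φ : ℝ → ℝ, φ a = 0 → φ b = 1 → (∀ t ∈ Set.Icc a b, φ t ∈ Set.Icc (0 : ℝ) 1) →
      (∀ t ∈ Set.Icc a b, γ t = u * NormedSpace.exp (φ t • x)) →
      ∀ r ∈ Set.Icc a b, ∀ s ∈ Set.Icc a b, r ≤ s →
        |φ s - φ r| * ν x ≤ (φ s - φ r) * ν x ∧
        curveLength ν γ r s = ENNReal.ofReal ((φ s - φ r) * ν x) := by
    intro φ hφa hφb hφ01 hφ r hr s hs' hrs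
    have hlow' : ∀ p ∈ Set.Icc a b, ∀ q ∈ Set.Icc a b, p ≤ q →
        |φ q - φ p| * ν x ≤ (curveLength ν γ p q).toReal := fun p hp q hq hpq => by
      have h1 := hlow p q hp.1 hpq hq.2
      rw [hφ p hp, hφ q hq, star_mul_exp_mul_exp hG hu hx, harc] at h1
      · exact h1
      · have h2 := hφ01 p hp
        have h3 := hφ01 q hq
        exact abs_le.2 ⟨by linarith [h2.2, h3.1], by linarith [h2.1, h3.2]⟩
    have ha : a ∈ Set.Icc a b := ⟨le_rfl, hab.le⟩
    have hb : b ∈ Set.Icc a b := ⟨hab.le, le_rfl⟩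
    have h1 := hlow' a ha r hr hr.1
    have h2 := hlow' r hr s hs' hrs
    have h3 := hlow' s hs' b hb hs'.2
    have h4 := hadd a r b le_rfl hr.1 hr.2 le_rfl
    have h5 := hadd r s b hr.1 hrs hs'.2 le_rfl
    rw [hφa, sub_zero, abs_of_nonneg (hφ01 r hr).1] at h1
    rw [hφb, abs_of_nonneg (by linarith [(hφ01 s hs').2])] at h3
    have h6 : |φ s - φ r| * ν x ≤ (φ s - φ r) * ν x := by linarith
    refine ⟨h6, ?_⟩
    have h7 : (φ s - φ r) * ν x ≤ |φ s - φ r| * ν x :=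
      mul_le_mul_of_nonneg_right (le_abs_self _) (apply_nonneg ν x)
    rw [← ENNReal.ofReal_toReal (hfin r s hr.1 hs'.2)]
    congr 1
    linarith
  -- For `x = 0` the curve is constant and does not determine `φ`; the affine parameter serves.
  rcases eq_or_ne x 0 with rfl | hx0
  · have hba : 0 < b - a := sub_pos.2 hab
    have hγu : ∀ t ∈ Set.Icc a b, γ t = u * NormedSpace.exp (((t - a) / (b - a)) • (0 : Mat n 𝕜)) :=
      fun t ht => by
        obtain ⟨c, -, h⟩ := hmem t ht
        rw [h, smul_zero, smul_zero]
    have hle := hlen_eq (fun t => (t - a) / (b - a)) (by simp) (div_self hba.ne')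
      (fun t ht => ⟨div_nonneg (by linarith [ht.1]) hba.le, (div_le_one hba).2 (by linarith [ht.2])⟩)
      hγu
    refine ⟨fun t => (t - a) / (b - a), by fun_prop, fun r _ s _ hrs => ?_, by simp,
      div_self hba.ne', hγu, fun r hr s hs' hrs => (hle r hr s hs' hrs).2⟩
    simp only; gcongr
  · have hνx := seminorm_pos hν hx0
    -- Recovering the exponent from `arcNorm` makes `φ` a continuous function of `t`.
    set φ : ℝ → ℝ := fun t => arcNorm ν (star u * γ t) / ν x with hφdef
    have hφ : ∀ t ∈ Set.Icc a b, φ t ∈ Set.Icc (0 : ℝ) 1 ∧ γ t = u * NormedSpace.exp (φ t • x) :=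
      fun t ht => by
        obtain ⟨c, hc, h⟩ := hmem t ht
        have : φ t = c := by
          simp only [hφdef]
          rw [h, star_mul_mul_cancel hG hu, harc c (abs_le.2 ⟨by linarith [hc.1], hc.2⟩),
            abs_of_nonneg hc.1, mul_div_cancel_right₀ _ hνx.ne']
        rw [this]
        exact ⟨hc, h⟩
    have hφa : φ a = 0 := by
      simp only [hφdef]
      rw [hγ.source, hG.star_mul_self u hu, arcNorm_one hG hν, zero_div]
    have hφb : φ b = 1 := by
      simp only [hφdef]
      rw [hγ.target, hv, star_mul_mul_cancel hG hu, arcNorm_exp hG hν hx hxπ.le, div_self hνx.ne']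
    have hle := hlen_eq φ hφa hφb (fun t ht => (hφ t ht).1) (fun t ht => (hφ t ht).2)
    refine ⟨φ, ?_, fun r hr s hs' hrs => ?_, hφa, hφb, fun t ht => (hφ t ht).2,
      fun r hr s hs' hrs => (hle r hr s hs' hrs).2⟩
    · refine ContinuousOn.div_const ?_ _
      refine (continuousOn_arcNorm hG hν).comp (continuousOn_const.mul hγ.continuousOn) ?_
      exact fun t ht => mul_mem (hG.star_mem u hu) (hγ.mapsTo ht)
    · have h1 := le_of_mul_le_mul_right (hle r hr s hs' hrs).1 hνx
      linarith [abs_nonneg (φ s - φ r)]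

theorem exists_shortest_curve (hG : IsAdmissible G) (hν : IsInvariantNorm G ν)
    (hs : IsStrictlyConvexNorm ν) {u v : Mat n 𝕜} (hu : u ∈ G) (hv : v ∈ G)
    (hspec : (-1 : 𝕜) ∉ spectrum 𝕜 (u⁻¹ * v)) :
    ∃ x ∈ skewAdjoint (Mat n 𝕜),
      IsShortestCurve G ν (fun t : ℝ => u * NormedSpace.exp (t • x)) 0 1 u v ∧
      ∀ (a b : ℝ) (γ : ℝ → Mat n 𝕜), a < b → IsShortestCurve G ν γ a b u v →
        ∃ φ : ℝ → ℝ, ContinuousOn φ (Set.Icc a b) ∧ MonotoneOn φ (Set.Icc a b) ∧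
          φ a = 0 ∧ φ b = 1 ∧ ∀ t ∈ Set.Icc a b, γ t = u * NormedSpace.exp (φ t • x) := by
  have hinv : u⁻¹ = star u := Matrix.inv_eq_left_inv (hG.star_mul_self u hu)
  have hunit : IsUnit (1 + star u * v) := by
    rw [spectrum.notMem_iff, hinv, map_neg, map_one] at hspec
    have := hspec.neg
    rwa [neg_sub, sub_neg_eq_add, add_comm] at this
  obtain ⟨x, hx, hexp, hxπ⟩ :=
    exists_log (hG.star_mul_self _ (mul_mem (hG.star_mem u hu) hv)) hunit
  have hv' : v = u * NormedSpace.exp x := by rw [hexp, mul_star_mul_cancel hG hu]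
  have hdist : intrinsicDist G ν u v = ENNReal.ofReal (ν x) := by
    rw [hv', intrinsicDist_exp hG hν hu hx hxπ.le]
  refine ⟨x, hx, ⟨hv' ▸ isCurveFromTo_exp hG hu hx, ?_⟩, fun a b γ hab hγ => ?_⟩
  · rw [hdist, curveLength_exp hG hν hu hx zero_le_one (by simpa using hxπ.le)]
    simp
  · obtain ⟨φ, h1, h2, h3, h4, h5, -⟩ := exists_reparametrization hG hν hs hu hx hxπ hv' hab
      hγ.toIsCurveFromTo (by rw [hγ.length_eq, hdist])
    exact ⟨φ, h1, h2, h3, h4, h5⟩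

end

end InvariantNorm

end

section

open scoped Matrix.Norms.L2Operator
open Filter Topology

namespace InvariantNorm

variable {n : ℕ} {𝕜 : Type} [RCLike 𝕜]

attribute [local instance] realNormedAlgebra

/-! ### Geodesics -/

/-- Provides the right end of a small closed interval that is a neighbourhood of `t` in `I`; `q = t`
if `t` is the last point of `I`. -/
theorem exists_le_eventually_le {I : Set ℝ} (hI : I.OrdConnected) {t δ : ℝ} (ht : t ∈ I)
    (hδ : 0 < δ) : ∃ q ∈ I, t ≤ q ∧ q < t + δ ∧ ∀ᶠ s in 𝓝[I] t, s ≤ q := by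
  by_cases h : ∃ s ∈ I, t < s
  · obtain ⟨s, hs, hts⟩ := h
    have h1 : t < min s (t + δ / 2) := lt_min hts (by linarith)
    refine ⟨min s (t + δ / 2), hI.out ht hs ⟨h1.le, min_le_left _ _⟩, h1.le,
      (min_le_right _ _).trans_lt (by linarith), ?_⟩
    exact nhdsWithin_le_nhds ((eventually_lt_nhds h1).mono fun _ h => h.le)
  · push Not at h
    exact ⟨t, ht, le_rfl, by linarith, eventually_nhdsWithin_of_forall h⟩

theorem exists_ge_eventually_ge {I : Set ℝ} (hI : I.OrdConnected) {t δ : ℝ} (ht : t ∈ I)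
    (hδ : 0 < δ) : ∃ p ∈ I, p ≤ t ∧ t - δ < p ∧ ∀ᶠ s in 𝓝[I] t, p ≤ s := by
  by_cases h : ∃ s ∈ I, s < t
  · obtain ⟨s, hs, hts⟩ := h
    have h1 : max s (t - δ / 2) < t := max_lt hts (by linarith)
    refine ⟨max s (t - δ / 2), hI.out hs ht ⟨le_max_left _ _, h1.le⟩, h1.le,
      lt_of_lt_of_le (by linarith) (le_max_right _ _), ?_⟩
    exact nhdsWithin_le_nhds ((eventually_gt_nhds h1).mono fun _ h => h.le)
  · push Not at h
    exact ⟨t, ht, le_rfl, by linarith, eventually_nhdsWithin_of_forall h⟩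

section

variable {G : Submonoid (Mat n 𝕜)} {ν : Seminorm 𝕜 (Mat n 𝕜)}

/-- From `r` to `s`, the curve `γ` runs along the one-parameter group in the direction `x`, as
described by its arc length. -/
def IsLine (ν : Seminorm 𝕜 (Mat n 𝕜)) (γ : ℝ → Mat n 𝕜) (x : Mat n 𝕜) (r s : ℝ) : Prop :=
  curveLength ν γ r s ≠ ∞ ∧ γ s = γ r * NormedSpace.exp ((curveLength ν γ r s).toReal • x)

theorem IsLine.trans {γ : ℝ → Mat n 𝕜} {x : Mat n 𝕜} {r s t : ℝ} (hrs : r ≤ s) (hst : s ≤ t)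
    (h : IsLine ν γ x r s) (h' : IsLine ν γ x s t) : IsLine ν γ x r t := by
  have hadd := curveLength_add ν γ hrs hst
  refine ⟨?_, ?_⟩
  · rw [← hadd]; exact ENNReal.add_ne_top.2 ⟨h.1, h'.1⟩
  · rw [← hadd, ENNReal.toReal_add h.1 h'.1, exp_smul_add, ← mul_assoc, ← h.2, ← h'.2]

/-- Locally, a geodesic runs along a one-parameter group. -/
theorem IsGeodesicOn.exists_isLine (hG : IsAdmissible G) (hν : IsInvariantNorm G ν)
    (hs : IsStrictlyConvexNorm ν) {I : Set ℝ} (hI : I.OrdConnected) (hI' : I.Nontrivial)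
    {γ : ℝ → Mat n 𝕜} (hγ : IsGeodesicOn G ν γ I)
    (hns : ∀ r ∈ I, ∀ s ∈ I, r < s → ∃ t ∈ Set.Icc r s, γ t ≠ γ r) {t : ℝ} (ht : t ∈ I) :
    ∃ K ∈ 𝓝[I] t, K ⊆ I ∧ ∃ x ∈ skewAdjoint (Mat n 𝕜), ν x = 1 ∧
      ∀ r ∈ K, ∀ s ∈ K, r ≤ s → IsLine ν γ x r s ∧
        ‖(curveLength ν γ r s).toReal • x‖ < Real.pi := by
  obtain ⟨ε, hε, hshort⟩ := hγ.locally_shortest t ht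
  -- Points of the curve within `1` of `γ t` are less than `2` apart, so the quotient of any two has
  -- a principal logarithm.
  obtain ⟨δ, hδ, hcont⟩ := Metric.continuousWithinAt_iff.1 (hγ.continuousOn t ht) 1 one_pos
  obtain ⟨q, hqI, htq, hqδ, hq⟩ := exists_le_eventually_le hI ht (lt_min hε hδ)
  obtain ⟨p, hpI, hpt, hpδ, hp⟩ := exists_ge_eventually_ge hI ht (lt_min hε hδ)
  have hK : Set.Icc p q ∈ 𝓝[I] t := by
    filter_upwards [hp, hq] with s h1 h2 using ⟨h1, h2⟩
  have hKI : Set.Icc p q ⊆ I := hI.out hpI hqI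
  have hpq : p < q := by
    have hacc := (hI.isPreconnected.preperfect_of_nontrivial hI') t ht
    obtain ⟨s, hst, hsK⟩ := (((accPt_iff_frequently.1 hacc).and_eventually
      (eventually_nhdsWithin_iff.1 hK)).exists)
    have hs' := hsK hst.2
    rcases lt_or_gt_of_ne hst.1 with h | h
    · exact lt_of_le_of_lt hs'.1 (h.trans_le htq)
    · exact lt_of_le_of_lt hpt (h.trans_le hs'.2)
  have hpt' : |p - t| < min ε δ := by rw [abs_lt]; constructor <;> linarith [lt_min hε hδ]
  have hqt' : |q - t| < min ε δ := by rw [abs_lt]; constructor <;> linarith [lt_min hε hδ]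
  have hpG : γ p ∈ G := hγ.mapsTo hpI
  have hqG : γ q ∈ G := hγ.mapsTo hqI
  have hunit : IsUnit (1 + star (γ p) * γ q) := by
    refine isUnit_one_add_of_norm_lt ((norm_star_mul_sub_one_le hG hpG).trans_lt ?_)
    have h1 := hcont hpI (by rw [Real.dist_eq]; exact hpt'.trans_le (min_le_right _ _))
    have h2 := hcont hqI (by rw [Real.dist_eq]; exact hqt'.trans_le (min_le_right _ _))
    rw [← dist_eq_norm]
    have h3 := dist_triangle_right (γ q) (γ p) (γ t)
    linarith
  obtain ⟨x, hx, hexp, hxπ⟩ :=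
    exists_log (hG.star_mul_self _ (mul_mem (hG.star_mem _ hpG) hqG)) hunit
  have hv : γ q = γ p * NormedSpace.exp x := by rw [hexp, mul_star_mul_cancel hG hpG]
  have hlen : curveLength ν γ p q ≤ ENNReal.ofReal (ν x) := by
    rw [hshort p hpI q hqI (hpt'.trans_le (min_le_left _ _)) (hqt'.trans_le (min_le_left _ _))
      hpq.le, hv, intrinsicDist_exp hG hν hpG hx hxπ.le]
  obtain ⟨φ, -, hmono, hφp, hφq, hφ, hφlen⟩ := exists_reparametrization hG hν hs hpG hx hxπ hv hpq
    ⟨hγ.continuousOn.mono hKI, hγ.mapsTo.mono_left hKI, rfl, rfl⟩ hlen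
  have hx0 : x ≠ 0 := by
    rintro rfl
    obtain ⟨τ, hτ, hne⟩ := hns p hpI q hqI hpq
    exact hne (by rw [hφ τ hτ, smul_zero, exp_zero', mul_one])
  have hνx := seminorm_pos hν hx0
  refine ⟨Set.Icc p q, hK, hKI, (ν x)⁻¹ • x, smul_mem_skew hx _, ?_, fun r hr s hs' hrs => ?_⟩
  -- Normalizing to `ν x = 1` makes arc length itself the parameter of the one-parameter group.
  · rw [seminorm_smul_real, abs_of_pos (inv_pos.2 hνx), inv_mul_cancel₀ hνx.ne']
  have h0 : 0 ≤ φ s - φ r := sub_nonneg.2 (hmono hr hs' hrs)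
  have hp' : p ∈ Set.Icc p q := ⟨le_rfl, hpq.le⟩
  have hq' : q ∈ Set.Icc p q := ⟨hpq.le, le_rfl⟩
  have h1 : φ s - φ r ≤ 1 := by
    have h2 := hmono hs' hq' hs'.2
    have h3 := hmono hp' hr hr.1
    linarith
  have hl : (curveLength ν γ r s).toReal • (ν x)⁻¹ • x = (φ s - φ r) • x := by
    rw [hφlen r hr s hs' hrs, ENNReal.toReal_ofReal (by positivity), smul_smul, mul_assoc,
      mul_inv_cancel₀ hνx.ne', mul_one]
  refine ⟨⟨?_, ?_⟩, ?_⟩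
  · rw [hφlen r hr s hs' hrs]; exact ENNReal.ofReal_ne_top
  · rw [hl, hφ s hs', hφ r hr, mul_assoc, ← exp_smul_add, add_sub_cancel]
  · rw [hl, norm_smul, Real.norm_of_nonneg h0]
    nlinarith [norm_nonneg x]

theorem curveLength_pos (hν : IsInvariantNorm G ν) {γ : ℝ → Mat n 𝕜} {r s : ℝ}
    (h : ∃ t ∈ Set.Icc r s, γ t ≠ γ r) : 0 < curveLength ν γ r s := by
  obtain ⟨t, ht, hne⟩ := h
  refine lt_of_lt_of_le ?_ (ofReal_le_curveLength ν γ ht ⟨le_rfl, ht.1.trans ht.2⟩)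
  exact ENNReal.ofReal_pos.2 (seminorm_pos hν (sub_ne_zero.2 hne))

/-- Both directions, scaled by the same positive length, are the principal logarithm of `γ(r)*
γ(s)`. -/
theorem eq_of_isLine (hG : IsAdmissible G) {γ : ℝ → Mat n 𝕜} {x y : Mat n 𝕜}
    (hx : x ∈ skewAdjoint (Mat n 𝕜)) (hy : y ∈ skewAdjoint (Mat n 𝕜)) {r s : ℝ}
    (hr : γ r ∈ G) (hpos : 0 < curveLength ν γ r s) (h : IsLine ν γ x r s)
    (h' : IsLine ν γ y r s) (hxπ : ‖(curveLength ν γ r s).toReal • x‖ < Real.pi)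
    (hyπ : ‖(curveLength ν γ r s).toReal • y‖ < Real.pi) : x = y := by
  have h1 := h.2.symm.trans h'.2
  have h2 := congrArg (fun w => star (γ r) * w) h1
  simp only [star_mul_mul_cancel hG hr] at h2
  have h3 := principalLog_exp (smul_mem_skew hx (curveLength ν γ r s).toReal) hxπ
  rw [h2, principalLog_exp (smul_mem_skew hy _) hyπ] at h3
  exact (smul_right_injective (Mat n 𝕜) (ENNReal.toReal_pos hpos.ne' h.1).ne' h3).symm

/-- The local directions at `a` and at a nearby `b` describe the same nondegenerate arc, from `b` to
some `c` in both neighbourhoods, so they coincide. A locally constant direction on the connected `I`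
is constant. -/
theorem IsGeodesicOn.exists_direction (hG : IsAdmissible G) (hν : IsInvariantNorm G ν)
    (hs : IsStrictlyConvexNorm ν) {I : Set ℝ} (hI : I.OrdConnected) (hI' : I.Nontrivial)
    {γ : ℝ → Mat n 𝕜} (hγ : IsGeodesicOn G ν γ I)
    (hns : ∀ r ∈ I, ∀ s ∈ I, r < s → ∃ t ∈ Set.Icc r s, γ t ≠ γ r) :
    ∃ x ∈ skewAdjoint (Mat n 𝕜), ν x = 1 ∧ ∀ t ∈ I, ∃ K ∈ 𝓝[I] t, K ⊆ I ∧
      ∀ r ∈ K, ∀ s ∈ K, r ≤ s → IsLine ν γ x r s ∧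
        ‖(curveLength ν γ r s).toReal • x‖ < Real.pi := by
  have hloc := fun t (ht : t ∈ I) => IsGeodesicOn.exists_isLine hG hν hs hI hI' hγ hns ht
  choose! K hK hKI X hX hX1 hline using hloc
  obtain ⟨t₀, ht₀⟩ := hI'.nonempty
  have hconst : ∀ t ∈ I, X t = X t₀ := by
    intro t ht
    refine hI.isPreconnected.induction₂' (fun a b => X a = X b) ?_
      (fun a b c _ _ _ h1 h2 => h1.trans h2) ht ht₀
    intro a ha
    have key : ∀ᶠ b in 𝓝[I] a, X a = X b := by
      filter_upwards [eventually_eventually_nhdsWithin.2 (hK a ha), self_mem_nhdsWithin]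
        with b hb hbI
      have hacc := (hI.isPreconnected.preperfect_of_nontrivial hI') b hbI
      obtain ⟨c, hcb, hcK⟩ := ((accPt_iff_frequently.1 hacc).and_eventually
        (eventually_nhdsWithin_iff.1 (inter_mem hb (hK b hbI)))).exists
      have hc := hcK hcb.2
      have hba : b ∈ K a := mem_of_mem_nhdsWithin hbI hb
      have hbb : b ∈ K b := mem_of_mem_nhdsWithin hbI (hK b hbI)
      have aux : ∀ r s, r ∈ K a → s ∈ K a → r ∈ K b → s ∈ K b → r < s → X a = X b :=
        fun r s h1 h2 h3 h4 hrs =>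
          eq_of_isLine hG (hX a ha) (hX b hbI) (hγ.mapsTo (hKI a ha h1))
            (curveLength_pos hν (hns r (hKI a ha h1) s (hKI a ha h2) hrs))
            (hline a ha r h1 s h2 hrs.le).1 (hline b hbI r h3 s h4 hrs.le).1
            (hline a ha r h1 s h2 hrs.le).2 (hline b hbI r h3 s h4 hrs.le).2
      rcases lt_or_gt_of_ne hcb.1 with h | h
      · exact aux c b hc.1 hba hc.2 hbb h
      · exact aux b c hba hc.1 hbb hc.2 h
    exact key.mono fun b h => ⟨h, h.symm⟩
  refine ⟨X t₀, hX t₀ ht₀, hX1 t₀ ht₀, fun t ht => ⟨K t, hK t ht, hKI t ht, ?_⟩⟩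
  rw [← hconst t ht]
  exact hline t ht

theorem isLine_of_locally {I : Set ℝ} (hI : I.OrdConnected) {γ : ℝ → Mat n 𝕜} {x : Mat n 𝕜}
    (h : ∀ t ∈ I, ∃ K ∈ 𝓝[I] t, ∀ r ∈ K, ∀ s ∈ K, r ≤ s → IsLine ν γ x r s) {p q : ℝ} (hp : p ∈ I)
    (hq : q ∈ I) (hpq : p ≤ q) : IsLine ν γ x p q := by
  have hsub : Set.Icc p q ⊆ I := hI.out hp hq
  choose! K hK hline using h
  obtain ⟨t, ht0, hmono, ⟨m, hm⟩, hsubset⟩ := exists_monotone_Icc_subset_open_cover_Icc hpq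
    (c := fun i : Set.Icc p q => interior ((fun s : Set.Icc p q => (s : ℝ)) ⁻¹' K i))
    (fun i => isOpen_interior) (fun i _ => Set.mem_iUnion.2 ⟨i, mem_interior_iff_mem_nhds.2 <| by
      have h1 : Tendsto (fun s : Set.Icc p q => (s : ℝ)) (𝓝 i) (𝓝[I] (i : ℝ)) :=
        tendsto_nhdsWithin_iff.2 ⟨continuous_subtype_val.tendsto i,
          Eventually.of_forall fun s => hsub s.2⟩
      exact h1 (hK i (hsub i.2))⟩)
  have hstep : ∀ k, IsLine ν γ x (t k) (t (k + 1)) := fun k => by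
    obtain ⟨i, hi⟩ := hsubset k
    have hk : t k ≤ t (k + 1) := hmono k.le_succ
    have h1 : t k ∈ (fun s : Set.Icc p q => (s : ℝ)) ⁻¹' K i := interior_subset (hi ⟨le_rfl, hk⟩)
    have h2 : t (k + 1) ∈ (fun s : Set.Icc p q => (s : ℝ)) ⁻¹' K i :=
      interior_subset (hi ⟨hk, le_rfl⟩)
    exact hline i (hsub i.2) _ h1 _ h2 hk
  have hind : ∀ k, IsLine ν γ x (t 0) (t k) := by
    intro k
    induction k with
    | zero =>
      refine ⟨by rw [curveLength_self]; exact ENNReal.zero_ne_top, ?_⟩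
      rw [curveLength_self, ENNReal.toReal_zero, zero_smul, exp_zero', mul_one]
    | succ k ih => exact ih.trans (hmono k.zero_le) (hmono k.le_succ) (hstep k)
  have := hind m
  rwa [ht0, hm m le_rfl] at this

theorem IsGeodesicOn.exists_reparametrization (hG : IsAdmissible G) (hν : IsInvariantNorm G ν)
    (hs : IsStrictlyConvexNorm ν) {I : Set ℝ} {γ : ℝ → Mat n 𝕜} (hI : I.OrdConnected)
    (hγ : IsGeodesicOn G ν γ I) :
    ∃ u ∈ G, ∃ x ∈ skewAdjoint (Mat n 𝕜), ∃ φ : ℝ → ℝ, ContinuousOn φ I ∧ StrictMonoOn φ I ∧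
      ∀ t ∈ I, γ t = u * NormedSpace.exp (φ t • x) := by
  by_cases hconst : ∀ r ∈ I, ∀ s ∈ I, γ r = γ s
  · obtain ⟨u, hu, hγu⟩ : ∃ u ∈ G, ∀ t ∈ I, γ t = u := by
      rcases I.eq_empty_or_nonempty with rfl | ⟨t₀, ht₀⟩
      · exact ⟨1, one_mem G, by simp⟩
      · exact ⟨γ t₀, hγ.mapsTo ht₀, fun t ht => hconst t ht t₀ ht₀⟩
    -- A constant geodesic has `x = 0`; any strictly increasing `φ` will do.
    exact ⟨u, hu, 0, zero_mem _, id, continuousOn_id, strictMono_id.strictMonoOn _,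
      fun t ht => by rw [smul_zero, exp_zero', mul_one, hγu t ht]⟩
  have hns := hγ.nonstop.resolve_left hconst
  have hI' : I.Nontrivial := by
    by_contra h
    rw [Set.not_nontrivial_iff] at h
    exact hconst fun r hr s hs' => by rw [h hr hs']
  obtain ⟨x, hx, hx1, hloc⟩ := IsGeodesicOn.exists_direction hG hν hs hI hI' hγ hns
  have hline : ∀ r ∈ I, ∀ s ∈ I, r ≤ s → IsLine ν γ x r s := fun r hr s hs' hrs =>
    isLine_of_locally hI (fun t ht =>
      let ⟨K, hK, _, h⟩ := hloc t ht
      ⟨K, hK, fun a ha b hb hab => (h a ha b hb hab).1⟩) hr hs' hrs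
  obtain ⟨t₀, ht₀⟩ := hI'.nonempty
  -- Signed arc length measured from `t₀`.
  set φ : ℝ → ℝ := fun t => if t₀ ≤ t then (curveLength ν γ t₀ t).toReal
    else -(curveLength ν γ t t₀).toReal with hφ
  have hadd : ∀ r ∈ I, ∀ s ∈ I, ∀ t ∈ I, r ≤ s → s ≤ t →
      (curveLength ν γ r s).toReal + (curveLength ν γ s t).toReal =
        (curveLength ν γ r t).toReal := fun r hr s hs' t ht h1 h2 => by
    rw [← curveLength_add ν γ h1 h2, ENNReal.toReal_add (hline r hr s hs' h1).1
      (hline s hs' t ht h2).1]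
  have hφsub : ∀ r ∈ I, ∀ s ∈ I, r ≤ s → φ s - φ r = (curveLength ν γ r s).toReal := by
    intro r hr s hs' hrs
    simp only [hφ]
    split_ifs with h1 h2 h2
    · linarith [hadd t₀ ht₀ r hr s hs' h2 hrs]
    · linarith [hadd r hr t₀ ht₀ s hs' (not_le.1 h2).le h1]
    · exact absurd (h2.trans hrs) h1
    · linarith [hadd r hr s hs' t₀ ht₀ hrs (not_le.1 h1).le]
  refine ⟨γ t₀, hγ.mapsTo ht₀, x, hx, φ, fun t ht => ?_, fun r hr s hs' hrs => ?_, fun t ht => ?_⟩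
  · obtain ⟨K, hK, hKI, hKline⟩ := hloc t ht
    have htK := mem_of_mem_nhdsWithin ht hK
    -- Since `ν x = 1`, arc length agrees locally with `arcNorm` of the quotient, which depends
    -- continuously on `s`; this yields the continuity of `φ`.
    have hdist : ∀ s ∈ K, dist (φ s) (φ t) = arcNorm ν (star (γ t) * γ s) := by
      have aux : ∀ r ∈ K, ∀ s ∈ K, r ≤ s →
          |φ s - φ r| = arcNorm ν (star (γ r) * γ s) := fun r hr s hs' hrs => by
        obtain ⟨h1, h2⟩ := hKline r hr s hs' hrs
        rw [h1.2, star_mul_mul_cancel hG (hγ.mapsTo (hKI hr)),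
          arcNorm_exp hG hν (smul_mem_skew hx _) h2.le, seminorm_smul_real, hx1, mul_one,
          hφsub r (hKI hr) s (hKI hs') hrs]
      intro s hs'
      rw [Real.dist_eq]
      rcases le_total t s with h | h
      · exact aux t htK s hs' h
      · rw [abs_sub_comm, aux s hs' t htK h, ← arcNorm_star, star_mul, star_star]
    refine tendsto_iff_dist_tendsto_zero.2 ?_
    have hlim : Tendsto (fun s => arcNorm ν (star (γ t) * γ s)) (𝓝[I] t) (𝓝 0) := by
      have h1 : ContinuousOn (fun s => arcNorm ν (star (γ t) * γ s)) I :=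
        (continuousOn_arcNorm hG hν).comp (continuousOn_const.mul hγ.continuousOn)
          fun s hs' => mul_mem (hG.star_mem _ (hγ.mapsTo ht)) (hγ.mapsTo hs')
      have h2 := h1 t ht
      rwa [ContinuousWithinAt, hG.star_mul_self _ (hγ.mapsTo ht), arcNorm_one hG hν] at h2
    refine hlim.congr' ?_
    filter_upwards [hK] with s hs' using (hdist s hs').symm
  · rw [← sub_pos, hφsub r hr s hs' hrs.le]
    exact ENNReal.toReal_pos (curveLength_pos hν (hns r hr s hs' hrs)).ne' (hline r hr s hs' hrs.le).1
  · simp only [hφ]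
    split_ifs with h
    · exact (hline t₀ ht₀ t ht h).2
    · have h1 := (hline t ht t₀ ht₀ (not_le.1 h).le).2
      rw [neg_smul]
      conv_rhs => rw [h1]
      rw [mul_assoc, exp_mul_exp_neg, mul_one]

end

end InvariantNorm

end

section

namespace InvariantNorm

variable {n : ℕ} {𝕜 : Type} [RCLike 𝕜]

/-! ### Strict convexity of the Schatten norms -/

/-- The singular values of a matrix. -/
noncomputable def singularValue (x : Mat n 𝕜) (i : Fin n) : ℝ :=
  Real.sqrt ((Matrix.isHermitian_conjTranspose_mul_self x).eigenvalues i)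

theorem singularValue_nonneg (x : Mat n 𝕜) (i : Fin n) : 0 ≤ singularValue x i := Real.sqrt_nonneg _

/-- If the columns of `B` are eigenvectors of `x* x`, the columns of `x B` are orthogonal with the
singular values as lengths. The nonzero ones, normalized, extend to an orthonormal basis, which
forms `A`. -/
theorem exists_svd (x : Mat n 𝕜) : ∃ A ∈ Matrix.unitaryGroup (Fin n) 𝕜,
    ∃ B ∈ Matrix.unitaryGroup (Fin n) 𝕜,
      x = A * Matrix.diagonal (fun i => ((singularValue x i : ℝ) : 𝕜)) * star B := by
  have hH := Matrix.isHermitian_conjTranspose_mul_self x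
  set s := singularValue x with hs
  set B : Mat n 𝕜 := hH.eigenvectorUnitary.1 with hB
  have hB1 : star B * B = 1 := Matrix.mem_unitaryGroup_iff'.1 hH.eigenvectorUnitary.2
  have hB2 : B * star B = 1 := Matrix.mem_unitaryGroup_iff.1 hH.eigenvectorUnitary.2
  have hspec : star (x * B) * (x * B) = Matrix.diagonal (fun i => ((s i : ℝ) : 𝕜) ^ 2) := by
    have h1 := hH.spectral_theorem
    rw [Unitary.conjStarAlgAut_apply] at h1
    have h2 : star B * (star x * x) * B = Matrix.diagonal (RCLike.ofReal ∘ hH.eigenvalues) := by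
      have h3 : star x * x = B * Matrix.diagonal (RCLike.ofReal ∘ hH.eigenvalues) * star B := h1
      rw [h3]
      calc _ = (star B * B) * Matrix.diagonal (RCLike.ofReal ∘ hH.eigenvalues) * (star B * B) := by
            noncomm_ring
        _ = _ := by rw [hB1, one_mul, mul_one]
    rw [star_mul, mul_assoc, ← mul_assoc (star x), ← mul_assoc, h2]
    congr 1
    ext1 i
    have h0 : 0 ≤ hH.eigenvalues i := spectrum_star_mul_self_nonneg x
      (Set.mem_of_eq_of_mem rfl (hH.spectrum_real_eq_range_eigenvalues ▸ Set.mem_range_self i))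
    rw [hs]
    simp only [singularValue, Function.comp]
    rw [← RCLike.ofReal_pow, Real.sq_sqrt h0]
  let col : Fin n → EuclideanSpace 𝕜 (Fin n) := fun k => WithLp.toLp 2 fun i => (x * B) i k
  have hcol : ∀ k l, inner 𝕜 (col k) (col l) = if k = l then ((s k : ℝ) : 𝕜) ^ 2 else 0 := by
    intro k l
    have h1 := congrFun (congrFun hspec k) l
    rw [Matrix.mul_apply, Matrix.diagonal_apply] at h1
    rw [← h1, PiLp.inner_apply]
    refine Finset.sum_congr rfl fun i _ => ?_
    simp only [col, RCLike.inner_apply, Matrix.star_apply, RCLike.star_def]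
    ring
  let v : Fin n → EuclideanSpace 𝕜 (Fin n) := fun k => ((s k : ℝ) : 𝕜)⁻¹ • col k
  have hv : Orthonormal 𝕜 (Set.domRestrict {k | s k ≠ 0} v) := by
    rw [orthonormal_iff_ite]
    rintro ⟨k, hk⟩ ⟨l, hl⟩
    simp only [Set.domRestrict_apply, v, inner_smul_left, inner_smul_right, hcol, Subtype.mk.injEq]
    split_ifs with h
    · subst h
      have : ((s k : ℝ) : 𝕜) ≠ 0 := RCLike.ofReal_ne_zero.2 hk
      simp only [map_inv₀, RCLike.conj_ofReal]
      field_simp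
    · simp
  obtain ⟨b, hb⟩ := hv.exists_orthonormalBasis_extension_of_card_eq (by simp)
  have hxB : ∀ k i, (x * B) i k = ((s k : ℝ) : 𝕜) * b k i := by
    intro k i
    by_cases hk : s k = 0
    · have h1 : col k = 0 := by
        rw [← inner_self_eq_zero (𝕜 := 𝕜), hcol, if_pos rfl, hk]; simp
      have h2 := congrArg (fun w : EuclideanSpace 𝕜 (Fin n) => w i) h1
      simp only [col] at h2
      rw [hk]
      simpa using h2
    · have h1 := hb k hk
      rw [h1]
      have : ((s k : ℝ) : 𝕜) ≠ 0 := RCLike.ofReal_ne_zero.2 hk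
      simp [v, col, this]
  refine ⟨Matrix.of fun i k => b k i, ?_, B, hH.eigenvectorUnitary.2, ?_⟩
  · rw [Matrix.mem_unitaryGroup_iff']
    ext k l
    have h1 := orthonormal_iff_ite.1 b.orthonormal k l
    rw [PiLp.inner_apply] at h1
    rw [Matrix.mul_apply, Matrix.one_apply, ← h1]
    refine Finset.sum_congr rfl fun i _ => ?_
    simp only [RCLike.inner_apply, Matrix.star_apply, RCLike.star_def, Matrix.of_apply]
    ring
  · have h1 : x * B = (Matrix.of fun i k => b k i) *
        Matrix.diagonal (fun i => ((s i : ℝ) : 𝕜)) := by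
      ext i k
      rw [Matrix.mul_diagonal, hxB, Matrix.of_apply, mul_comm]
    rw [← h1, mul_assoc, hB2, mul_one]

/-- Young's inequality in the form of the tangent line inequality. -/
theorem rpow_sub_one_mul_le {p d s : ℝ} (hp : 1 < p) (hd : 0 ≤ d) (hs : 0 ≤ s) :
    d ^ (p - 1) * s ≤ (1 - 1 / p) * d ^ p + 1 / p * s ^ p ∧
      (d ^ (p - 1) * s = (1 - 1 / p) * d ^ p + 1 / p * s ^ p → d = s) := by
  have hp0 : 0 < p := by linarith
  rcases hd.eq_or_lt with rfl | hd
  · rw [Real.zero_rpow (by linarith), Real.zero_rpow hp0.ne']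
    constructor
    · have := Real.rpow_nonneg hs p
      have : 0 ≤ 1 / p * s ^ p := by positivity
      linarith
    · intro h
      by_contra hne
      have h0 : 0 < s := lt_of_le_of_ne hs hne
      have : 0 < 1 / p * s ^ p := by positivity
      linarith
  · have hdp : d ^ (p - 1) = d ^ p / d := by rw [Real.rpow_sub_one hd.ne']
    have hpos : 0 < d ^ p := Real.rpow_pos_of_pos hd p
    have hsd : (s / d) ^ p = s ^ p / d ^ p := Real.div_rpow hs hd.le p
    -- After division by `d ^ p / p` this is Bernoulli's inequality for `(s / d) ^ p`, strict unless
    -- `s = d`.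
    have e : (1 - 1 / p) * d ^ p + 1 / p * s ^ p - d ^ (p - 1) * s =
        d ^ p / p * ((s / d) ^ p - (1 + p * (s / d - 1))) := by
      rw [hdp, hsd]; field_simp; ring
    have e1 : s / d = 1 + (s / d - 1) := by ring
    have hge : -1 ≤ s / d - 1 := by have : 0 ≤ s / d := by positivity
                                    linarith
    constructor
    · have h1 := one_add_mul_self_le_rpow_one_add hge hp.le
      rw [← e1] at h1
      have : 0 ≤ d ^ p / p * ((s / d) ^ p - (1 + p * (s / d - 1))) :=
        mul_nonneg (by positivity) (by linarith)
      linarith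
    · intro h
      by_contra hne
      have h1 := one_add_mul_self_lt_rpow_one_add hge
        (fun h0 => hne (by rw [sub_eq_zero, div_eq_one_iff_eq hd.ne'] at h0; exact h0.symm)) hp
      rw [← e1] at h1
      have : 0 < d ^ p / p * ((s / d) ^ p - (1 + p * (s / d - 1))) :=
        mul_pos (by positivity) (by linarith)
      linarith

theorem sum_norm_sq_row {A : Mat n 𝕜} (hA : A * star A = 1) (i : Fin n) :
    ∑ k, ‖A i k‖ ^ 2 = 1 := by
  have h := congrFun (congrFun hA i) i
  rw [Matrix.mul_apply, Matrix.one_apply_eq] at h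
  have h2 : ∀ k, A i k * star A k i = ((‖A i k‖ ^ 2 : ℝ) : 𝕜) := fun k => by
    rw [Matrix.star_apply, RCLike.star_def, RCLike.mul_conj]; push_cast; rfl
  simp only [h2] at h
  exact_mod_cast h

theorem sum_norm_sq_col {A : Mat n 𝕜} (hA : star A * A = 1) (k : Fin n) :
    ∑ i, ‖A i k‖ ^ 2 = 1 := by
  have h := sum_norm_sq_row (A := star A) (by rwa [star_star]) k
  simpa [Matrix.star_apply] using h

theorem norm_sub_sq_eq (a b : 𝕜) :
    ‖a - b‖ ^ 2 = ‖a‖ ^ 2 + ‖b‖ ^ 2 - 2 * RCLike.re (a * star b) := by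
  have h : ((‖a - b‖ ^ 2 : ℝ) : 𝕜) =
      ((‖a‖ ^ 2 : ℝ) : 𝕜) + ((‖b‖ ^ 2 : ℝ) : 𝕜) - (a * star b + star (a * star b)) := by
    push_cast
    rw [← RCLike.mul_conj, ← RCLike.mul_conj, ← RCLike.mul_conj]
    simp only [RCLike.star_def, map_sub, map_mul, RCLike.conj_conj]
    ring
  have h2 := congrArg RCLike.re h
  rw [RCLike.star_def, RCLike.add_conj] at h2
  simp only [map_sub, map_add, RCLike.ofReal_re] at h2
  rw [h2]
  simp

/-- Hölder's inequality for the pairing with a diagonal matrix, with the equality case. -/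
theorem sum_mul_re_diag_le {p : ℝ} (hp : 1 < p) {A B : Mat n 𝕜} (hA : star A * A = 1)
    (hB : star B * B = 1) {d s : Fin n → ℝ} (hd : ∀ i, 0 ≤ d i) (hs : ∀ i, 0 ≤ s i)
    (hd1 : ∑ i, d i ^ p = 1) (hs1 : ∑ i, s i ^ p = 1) {x : Mat n 𝕜}
    (hx : x = A * Matrix.diagonal (fun i => ((s i : ℝ) : 𝕜)) * star B) :
    ∑ i, d i ^ (p - 1) * RCLike.re (x i i) ≤ 1 ∧
      (∑ i, d i ^ (p - 1) * RCLike.re (x i i) = 1 →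
        x = Matrix.diagonal (fun i => ((d i : ℝ) : 𝕜))) := by
  have hp0 : 0 < p := by linarith
  have hA' : A * star A = 1 := mul_eq_one_comm.1 hA
  have hB' : B * star B = 1 := mul_eq_one_comm.1 hB
  have hxij : ∀ i j, x i j = ∑ k, (s k : 𝕜) * (A i k * star (B j k)) := fun i j => by
    rw [hx, Matrix.mul_apply]
    refine Finset.sum_congr rfl fun k _ => ?_
    rw [Matrix.mul_diagonal, Matrix.star_apply]; ring
  have hre : ∀ i, RCLike.re (x i i) = ∑ k, s k * RCLike.re (A i k * star (B i k)) := fun i => by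
    rw [hxij, map_sum]
    exact Finset.sum_congr rfl fun k _ => by rw [RCLike.re_ofReal_mul]
  -- The weights `w` are doubly stochastic and `Re (A i k * conj (B i k)) = w i k - ‖A i k - B i k‖²
  -- / 2`. So the pairing is a `w`-average of products `d i ^ (p - 1) * s k`, minus a nonnegative
  -- defect, and Young's inequality applies termwise.
  set w : Fin n → Fin n → ℝ := fun i k => (‖A i k‖ ^ 2 + ‖B i k‖ ^ 2) / 2 with hw
  have hw0 : ∀ i k, 0 ≤ w i k := fun i k => by positivity
  set Y : Fin n → Fin n → ℝ := fun i k => (1 - 1 / p) * d i ^ p + 1 / p * s k ^ p with hY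
  have hre_eq : ∀ i k, RCLike.re (A i k * star (B i k)) = w i k - ‖A i k - B i k‖ ^ 2 / 2 :=
    fun i k => by rw [norm_sub_sq_eq]; simp only [hw]; ring
  have hwrow : ∀ i, ∑ k, w i k = 1 := fun i => by
    simp only [hw]
    rw [← Finset.sum_div, Finset.sum_add_distrib, sum_norm_sq_row hA', sum_norm_sq_row hB']
    norm_num
  have hwcol : ∀ k, ∑ i, w i k = 1 := fun k => by
    simp only [hw]
    rw [← Finset.sum_div, Finset.sum_add_distrib, sum_norm_sq_col hA, sum_norm_sq_col hB]
    norm_num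
  have hYsum : ∑ i, ∑ k, w i k * Y i k = 1 := by
    have e : ∀ i k, w i k * Y i k =
        (1 - 1 / p) * (d i ^ p * w i k) + 1 / p * (s k ^ p * w i k) := fun i k => by
      simp only [hY]; ring
    simp only [e, Finset.sum_add_distrib, ← Finset.mul_sum, hwrow]
    rw [Finset.sum_comm]
    simp only [← Finset.mul_sum, hwcol, mul_one, hd1, hs1]
    ring
  have hterm1 : ∀ i k, d i ^ (p - 1) * (s k * RCLike.re (A i k * star (B i k))) ≤
      d i ^ (p - 1) * s k * w i k := fun i k => by
    rw [hre_eq, ← mul_assoc]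
    have := Real.rpow_nonneg (hd i) (p - 1)
    have h1 := hs k
    gcongr
    have : 0 ≤ ‖A i k - B i k‖ ^ 2 / 2 := by positivity
    linarith
  have hterm2 : ∀ i k, d i ^ (p - 1) * s k * w i k ≤ w i k * Y i k := fun i k => by
    rw [mul_comm (w i k)]
    exact mul_le_mul_of_nonneg_right (rpow_sub_one_mul_le hp (hd i) (hs k)).1 (hw0 i k)
  have hsum : ∑ i, d i ^ (p - 1) * RCLike.re (x i i) =
      ∑ i, ∑ k, d i ^ (p - 1) * (s k * RCLike.re (A i k * star (B i k))) := by
    refine Finset.sum_congr rfl fun i _ => ?_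
    rw [hre, Finset.mul_sum]
  have hterm : ∀ i k, d i ^ (p - 1) * (s k * RCLike.re (A i k * star (B i k))) ≤ w i k * Y i k :=
    fun i k => (hterm1 i k).trans (hterm2 i k)
  refine ⟨?_, fun heq => ?_⟩
  · rw [hsum]
    exact (Finset.sum_le_sum fun i _ => Finset.sum_le_sum fun k _ => hterm i k).trans hYsum.le
  -- Equality of the sums is equality in every term: no defect where `d i` and `s k` are nonzero,
  -- and `d i = s k` wherever `w i k ≠ 0`.
  have hall : ∀ i k, d i ^ (p - 1) * (s k * RCLike.re (A i k * star (B i k))) = w i k * Y i k := by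
    intro i k
    have heq' : ∑ i, ∑ k, d i ^ (p - 1) * (s k * RCLike.re (A i k * star (B i k))) =
        ∑ i, ∑ k, w i k * Y i k := (hsum.symm.trans heq).trans hYsum.symm
    have h1 := (Finset.sum_eq_sum_iff_of_le (fun i _ => Finset.sum_le_sum fun k _ => hterm i k)).1
      heq' i (Finset.mem_univ i)
    exact (Finset.sum_eq_sum_iff_of_le (fun k _ => hterm i k)).1 h1 k (Finset.mem_univ k)
  have hAB : ∀ i k, d i ≠ 0 → s k ≠ 0 → A i k = B i k := fun i k hdi hsk => by
    have h1 : d i ^ (p - 1) * (s k * RCLike.re (A i k * star (B i k))) =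
        d i ^ (p - 1) * s k * w i k :=
      le_antisymm (hterm1 i k) ((hterm2 i k).trans (hall i k).ge)
    rw [hre_eq, ← mul_assoc] at h1
    have h2 : d i ^ (p - 1) * s k ≠ 0 :=
      mul_ne_zero (Real.rpow_pos_of_pos (lt_of_le_of_ne (hd i) hdi.symm) _).ne' hsk
    have h3 := mul_left_cancel₀ h2 h1
    have h4 : ‖A i k - B i k‖ ^ 2 = 0 := by linarith
    exact sub_eq_zero.1 (norm_eq_zero.1 (pow_eq_zero_iff two_ne_zero |>.1 h4))
  have hds : ∀ i k, w i k ≠ 0 → d i = s k := fun i k hwik => by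
    have h1 : d i ^ (p - 1) * s k * w i k = w i k * Y i k :=
      le_antisymm (hterm2 i k) ((hall i k).ge.trans (hterm1 i k))
    rw [mul_comm (w i k)] at h1
    exact (rpow_sub_one_mul_le hp (hd i) (hs k)).2 (mul_right_cancel₀ hwik h1)
  have hAw : ∀ i k, A i k ≠ 0 → w i k ≠ 0 := fun i k h => by
    have : 0 < ‖A i k‖ := norm_pos_iff.2 h
    have : 0 < w i k := by simp only [hw]; positivity
    exact this.ne'
  have hBw : ∀ i k, B i k ≠ 0 → w i k ≠ 0 := fun i k h => by
    have : 0 < ‖B i k‖ := norm_pos_iff.2 h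
    have : 0 < w i k := by simp only [hw]; positivity
    exact this.ne'
  have hABall : ∀ i k, d i ≠ 0 → A i k = B i k := fun i k hdi => by
    by_cases hsk : s k = 0
    · have hA0 : A i k = 0 := by
        by_contra h; exact hdi ((hds i k (hAw i k h)).trans hsk)
      have hB0 : B i k = 0 := by
        by_contra h; exact hdi ((hds i k (hBw i k h)).trans hsk)
      rw [hA0, hB0]
    · exact hAB i k hdi hsk
  ext i j
  have hsA : ∀ k, (s k : 𝕜) * A i k = (d i : 𝕜) * A i k := fun k => by
    by_cases h : A i k = 0
    · rw [h, mul_zero, mul_zero]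
    · rw [hds i k (hAw i k h)]
  -- On the support of `A` the factor `s k` may be replaced by `d i`. If `d i ≠ 0`, row `i` of `A`
  -- is row `i` of `B`, and unitarity of `B` gives the diagonal matrix.
  have h1 : x i j = (d i : 𝕜) * ∑ k, A i k * star (B j k) := by
    rw [hxij, Finset.mul_sum]
    exact Finset.sum_congr rfl fun k _ => by rw [← mul_assoc, hsA, mul_assoc]
  rw [h1, Matrix.diagonal_apply]
  by_cases hdi : d i = 0
  · rw [hdi]; simp
  · have h2 : ∑ k, A i k * star (B j k) = if i = j then 1 else 0 := by
      have := congrFun (congrFun hB' i) j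
      rw [Matrix.mul_apply, Matrix.one_apply] at this
      rw [← this]
      exact Finset.sum_congr rfl fun k _ => by rw [hABall i k hdi, Matrix.star_apply]
    rw [h2]
    split_ifs <;> simp

theorem sum_singularValue_rpow {p : ℝ} (hp : 1 < p) {x : Mat n 𝕜} (h : schattenNorm p x = 1) :
    ∑ i, singularValue x i ^ p = 1 := by
  have h0 : 0 ≤ ∑ i, singularValue x i ^ p :=
    Finset.sum_nonneg fun i _ => Real.rpow_nonneg (singularValue_nonneg x i) p
  have h1 : (∑ i, singularValue x i ^ p) ^ (1 / p) = 1 := h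
  have h2 : ((∑ i, singularValue x i ^ p) ^ (1 / p)) ^ p = 1 ^ p := by rw [h1]
  rwa [← Real.rpow_mul h0, one_div, inv_mul_cancel₀ (by linarith), Real.rpow_one,
    Real.one_rpow] at h2

/-- Let `z = U D V*` be the midpoint of a segment on the unit sphere. The functional `w ↦ Re tr (D ^
(p - 1) U* w V)` is at most `1` on the sphere and equals `1` at `z`, hence also at both endpoints.
The equality case of Hölder's inequality identifies both `U* x V` and `U* y V` with `D`. -/
theorem isStrictlyConvexNorm_of_schattenNorm {ν : Seminorm 𝕜 (Mat n 𝕜)} {p : ℝ} (hp : 1 < p)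
    (hν : ∀ x, ν x = schattenNorm p x) : IsStrictlyConvexNorm ν := by
  intro x y hxy hseg
  refine hxy ?_
  set z : Mat n 𝕜 := (2⁻¹ : ℝ) • x + (2⁻¹ : ℝ) • y with hz
  have h1 : ∀ w ∈ segment ℝ x y, ∑ i, singularValue w i ^ p = 1 := fun w hw =>
    sum_singularValue_rpow hp (by rw [← hν]; exact hseg hw)
  have hx1 := h1 x (left_mem_segment ℝ x y)
  have hy1 := h1 y (right_mem_segment ℝ x y)
  have hz1 := h1 z ⟨2⁻¹, 2⁻¹, by norm_num, by norm_num, by norm_num, rfl⟩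
  obtain ⟨U, hU, V, hV, hzUV⟩ := exists_svd z
  have hU1 : star U * U = 1 := Matrix.mem_unitaryGroup_iff'.1 hU
  have hU2 : U * star U = 1 := Matrix.mem_unitaryGroup_iff.1 hU
  have hV1 : star V * V = 1 := Matrix.mem_unitaryGroup_iff'.1 hV
  have hV2 : V * star V = 1 := Matrix.mem_unitaryGroup_iff.1 hV
  set d := singularValue z with hd
  have key : ∀ w : Mat n 𝕜, ∑ i, singularValue w i ^ p = 1 →
      ∑ i, d i ^ (p - 1) * RCLike.re ((star U * w * V) i i) ≤ 1 ∧
        (∑ i, d i ^ (p - 1) * RCLike.re ((star U * w * V) i i) = 1 →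
          star U * w * V = Matrix.diagonal (fun i => ((d i : ℝ) : 𝕜))) := fun w hw => by
    obtain ⟨A, hA, B, hB, hwAB⟩ := exists_svd w
    refine sum_mul_re_diag_le hp (A := star U * A) (B := star V * B) ?_ ?_
      (fun i => singularValue_nonneg z i) (fun i => singularValue_nonneg w i) hz1 hw ?_
    · rw [star_mul, star_star, mul_assoc, ← mul_assoc U, hU2, one_mul]
      exact Matrix.mem_unitaryGroup_iff'.1 hA
    · rw [star_mul, star_star, mul_assoc, ← mul_assoc V, hV2, one_mul]
      exact Matrix.mem_unitaryGroup_iff'.1 hB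
    · conv_lhs => rw [hwAB]
      rw [star_mul, star_star]
      noncomm_ring
  have hzd : star U * z * V = Matrix.diagonal (fun i => ((d i : ℝ) : 𝕜)) := by
    conv_lhs => rw [hzUV]
    calc _ = star U * U * Matrix.diagonal (fun i => ((d i : ℝ) : 𝕜)) * (star V * V) := by
          noncomm_ring
      _ = _ := by rw [hU1, hV1, one_mul, mul_one]
  have hpz : ∑ i, d i ^ (p - 1) * RCLike.re ((star U * z * V) i i) = 1 := by
    rw [hzd]
    refine Eq.trans (Finset.sum_congr rfl fun i _ => ?_) hz1
    have h0 : 0 ≤ d i := singularValue_nonneg z i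
    rw [Matrix.diagonal_apply_eq, RCLike.ofReal_re]
    rcases h0.eq_or_lt with h0 | h0
    · rw [← h0, mul_zero, Real.zero_rpow (by linarith)]
    · rw [Real.rpow_sub_one h0.ne', div_mul_cancel₀ _ h0.ne']
  have hlin : ∑ i, d i ^ (p - 1) * RCLike.re ((star U * z * V) i i) =
      2⁻¹ * ∑ i, d i ^ (p - 1) * RCLike.re ((star U * x * V) i i) +
        2⁻¹ * ∑ i, d i ^ (p - 1) * RCLike.re ((star U * y * V) i i) := by
    rw [Finset.mul_sum, Finset.mul_sum, ← Finset.sum_add_distrib]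
    refine Finset.sum_congr rfl fun i _ => ?_
    have e : star U * z * V = (2⁻¹ : ℝ) • (star U * x * V) + (2⁻¹ : ℝ) • (star U * y * V) := by
      rw [hz, mul_add, add_mul, mul_smul_comm, mul_smul_comm, smul_mul_assoc, smul_mul_assoc]
    rw [e, Matrix.add_apply, Matrix.smul_apply, Matrix.smul_apply, map_add, RCLike.smul_re,
      RCLike.smul_re]
    ring
  obtain ⟨hx2, hx3⟩ := key x hx1
  obtain ⟨hy2, hy3⟩ := key y hy1
  have hxd := hx3 (by linarith)
  have hyd := hy3 (by linarith)
  have hback : ∀ w : Mat n 𝕜, U * (star U * w * V) * star V = w := fun w => by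
    calc _ = U * star U * w * (V * star V) := by noncomm_ring
      _ = w := by rw [hU2, hV2, one_mul, mul_one]
  rw [← hback x, ← hback y, hxd, hyd]

end InvariantNorm

end

/-! ### The theorem for the two groups -/

theorem proposition6 (n : ℕ) :
    -- the case `G = U(n)`
    (∀ ν : Seminorm ℂ (Mat n ℂ), IsInvariantNorm (Matrix.unitaryGroup (Fin n) ℂ) ν →
      -- (a) cosets of one-parameter groups are geodesics
      (∀ u ∈ Matrix.unitaryGroup (Fin n) ℂ, ∀ x ∈ skewAdjoint (Mat n ℂ),
        IsGeodesicOn (Matrix.unitaryGroup (Fin n) ℂ) ν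
          (fun t : ℝ => u * NormedSpace.exp (t • x)) Set.univ) ∧
      -- the Schatten norms with `1 < p < ∞` are strictly convex
      (∀ p : ℝ, 1 < p → (∀ x, ν x = schattenNorm p x) → IsStrictlyConvexNorm ν) ∧
      (IsStrictlyConvexNorm ν →
        -- (b) every geodesic is a reparametrized arc of a coset of a one-parameter group
        (∀ (I : Set ℝ) (γ : ℝ → Mat n ℂ), I.OrdConnected →
          IsGeodesicOn (Matrix.unitaryGroup (Fin n) ℂ) ν γ I →
          ∃ u ∈ Matrix.unitaryGroup (Fin n) ℂ, ∃ x ∈ skewAdjoint (Mat n ℂ), ∃ φ : ℝ → ℝ,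
            ContinuousOn φ I ∧ StrictMonoOn φ I ∧
              ∀ t ∈ I, γ t = u * NormedSpace.exp (φ t • x)) ∧
        -- (c) existence and uniqueness, up to the parametrization, of the shortest curve
        (∀ u ∈ Matrix.unitaryGroup (Fin n) ℂ, ∀ v ∈ Matrix.unitaryGroup (Fin n) ℂ,
          (-1 : ℂ) ∉ spectrum ℂ (u⁻¹ * v) →
          ∃ x ∈ skewAdjoint (Mat n ℂ),
            IsShortestCurve (Matrix.unitaryGroup (Fin n) ℂ) ν
              (fun t : ℝ => u * NormedSpace.exp (t • x)) 0 1 u v ∧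
            ∀ (a b : ℝ) (γ : ℝ → Mat n ℂ), a < b →
              IsShortestCurve (Matrix.unitaryGroup (Fin n) ℂ) ν γ a b u v →
              ∃ φ : ℝ → ℝ, ContinuousOn φ (Set.Icc a b) ∧ MonotoneOn φ (Set.Icc a b) ∧
                φ a = 0 ∧ φ b = 1 ∧
                ∀ t ∈ Set.Icc a b, γ t = u * NormedSpace.exp (φ t • x)))) ∧
    -- the case `G = SO(n)`
    (∀ ν : Seminorm ℝ (Mat n ℝ), IsInvariantNorm (Matrix.specialOrthogonalGroup (Fin n) ℝ) ν →
      -- (a) cosets of one-parameter groups are geodesics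
      (∀ u ∈ Matrix.specialOrthogonalGroup (Fin n) ℝ, ∀ x ∈ skewAdjoint (Mat n ℝ),
        IsGeodesicOn (Matrix.specialOrthogonalGroup (Fin n) ℝ) ν
          (fun t : ℝ => u * NormedSpace.exp (t • x)) Set.univ) ∧
      -- the Schatten norms with `1 < p < ∞` are strictly convex
      (∀ p : ℝ, 1 < p → (∀ x, ν x = schattenNorm p x) → IsStrictlyConvexNorm ν) ∧
      (IsStrictlyConvexNorm ν →
        -- (b) every geodesic is a reparametrized arc of a coset of a one-parameter group
        (∀ (I : Set ℝ) (γ : ℝ → Mat n ℝ), I.OrdConnected →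
          IsGeodesicOn (Matrix.specialOrthogonalGroup (Fin n) ℝ) ν γ I →
          ∃ u ∈ Matrix.specialOrthogonalGroup (Fin n) ℝ, ∃ x ∈ skewAdjoint (Mat n ℝ), ∃ φ : ℝ → ℝ,
            ContinuousOn φ I ∧ StrictMonoOn φ I ∧
              ∀ t ∈ I, γ t = u * NormedSpace.exp (φ t • x)) ∧
        -- (c) existence and uniqueness, up to the parametrization, of the shortest curve
        (∀ u ∈ Matrix.specialOrthogonalGroup (Fin n) ℝ, ∀ v ∈ Matrix.specialOrthogonalGroup (Fin n) ℝ,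
          (-1 : ℝ) ∉ spectrum ℝ (u⁻¹ * v) →
          ∃ x ∈ skewAdjoint (Mat n ℝ),
            IsShortestCurve (Matrix.specialOrthogonalGroup (Fin n) ℝ) ν
              (fun t : ℝ => u * NormedSpace.exp (t • x)) 0 1 u v ∧
            ∀ (a b : ℝ) (γ : ℝ → Mat n ℝ), a < b →
              IsShortestCurve (Matrix.specialOrthogonalGroup (Fin n) ℝ) ν γ a b u v →
              ∃ φ : ℝ → ℝ, ContinuousOn φ (Set.Icc a b) ∧ MonotoneOn φ (Set.Icc a b) ∧
                φ a = 0 ∧ φ b = 1 ∧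
                ∀ t ∈ Set.Icc a b, γ t = u * NormedSpace.exp (φ t • x)))) := by
  exact ⟨fun ν hν =>
    ⟨fun u hu x hx => InvariantNorm.isGeodesicOn_exp InvariantNorm.isAdmissible_unitaryGroup hν hu hx,
      fun p hp h => InvariantNorm.isStrictlyConvexNorm_of_schattenNorm hp h,
      fun hs => ⟨fun I γ hI hγ => InvariantNorm.IsGeodesicOn.exists_reparametrization InvariantNorm.isAdmissible_unitaryGroup hν hs hI hγ,
        fun u hu v hv h => InvariantNorm.exists_shortest_curve InvariantNorm.isAdmissible_unitaryGroup hν hs hu hv h⟩⟩,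
  fun ν hν =>
    ⟨fun u hu x hx => InvariantNorm.isGeodesicOn_exp InvariantNorm.isAdmissible_specialOrthogonalGroup hν hu hx,
      fun p hp h => InvariantNorm.isStrictlyConvexNorm_of_schattenNorm hp h,
      fun hs => ⟨fun I γ hI hγ => InvariantNorm.IsGeodesicOn.exists_reparametrization InvariantNorm.isAdmissible_specialOrthogonalGroup hν hs hI hγ,
        fun u hu v hv h => InvariantNorm.exists_shortest_curve InvariantNorm.isAdmissible_specialOrthogonalGroup hν hs hu hv h⟩⟩⟩
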